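/- **Theorem 1.1.** Let $n\in\{1,2\}$, $p>1+\frac2n$, $\varepsilon\in[0,2)$, and put $k_0=1$ if $n=1$, $k_0=1+\varepsilon$ if $n=2$. Let $f\in C^2(\mathbb R)$ satisfy $|f^{(j)}(s)|\le A|s|^{p-j}$ for $j=0,1,2$ and all $s\in\mathbb R$, with some constant $A$ (for instance $f(s)=|s|^p$ or $f(s)=\pm|s|^{p-1}s$). For $k\ge0$ let $\||\nabla|^kw\|_2=\||\xi|^k\hat w\|_2$ and let $H^k(\mathbb R^n)$ be the space of real $w\in L^2(\mathbb R^n)$ with $\|w\|_{H^k}=(\|w\|_2^2+\||\nabla|^kw\|_2^2)^{1/2}<\infty$. Put $\kappa=\max\{k_0-2,0\}$ (so $H^\kappa=L^2$ unless $n=2$ and $\varepsilon>1$). A global mild solution of $$\partial_t^2u-\Delta u+\partial_tu-\Delta\partial_tu=f(u)\ \ (t>0,\ x\in\mathbb R^n),\qquad u(0)=u_0,\quad \partial_tu(0)=u_1,$$ is a function $u$ with values in the real space $L^2(\mathbb R^n)$ such that $f(u(\tau))\in L^2$ for all $\tau\ge0$ and, for every $t\ge0$, $$u(t)=K_0(t)u_0+K_1(t)u_1+\int_0^tK_1(t-\tau)f(u(\tau))\,d\tau$$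 with a convergent Bochner integral in $L^2$, where $K_0(t)$, $K_1(t)$ are the Fourier multipliers (for the transform with kernel $e^{-ix\cdot\xi}$) with symbols $$\frac{e^{-t|\xi|^2}-|\xi|^2e^{-t}}{1-|\xi|^2},\qquad \frac{e^{-t|\xi|^2}-e^{-t}}{1-|\xi|^2}.$$ Then there are constants $\delta>0$ and $C>0$, depending only on $n,p,\varepsilon,f$, such that for all real $u_0\in L^1\cap H^{k_0}$ and $u_1\in L^1\cap H^{\kappa}$ with $$\|u_0\|_1+\|u_0\|_{H^{k_0}}+\|u_1\|_1+\|u_1\|_{H^{\kappa}}\le\delta$$ there is a unique global mild solution $u$ in the class $C([0,\infty);H^{k_0}(\mathbb R^n))$, and it satisfies $$\||\nabla|^ku(t)\|_{L^2(\mathbb R^n)}\le C(1+t)^{-\frac n4-\frac k2}\qquad\text{for all } t\ge0 \text{ and all } k\in[0,k_0].$$ -/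

import Mathlib

open MeasureTheory Filter Topology FourierTransform
open scoped ENNReal

noncomputable section

namespace DampedWave

/-- The Euclidean space `ℝⁿ`. -/
abbrev E (n : ℕ) : Type := EuclideanSpace ℝ (Fin n)

/-- The real Hilbert space `L²(ℝⁿ; ℝ)`. -/
abbrev L2R (n : ℕ) : Type := Lp ℝ 2 (volume : Measure (E n))

/-- The complex Hilbert space `L²(ℝⁿ; ℂ)`. -/
abbrev L2C (n : ℕ) : Type := Lp ℂ 2 (volume : Measure (E n))

open Classical in
/-- The class in `L²(ℝⁿ; ℂ)` of a square integrable function (zero for other functions). -/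
def toL2 {n : ℕ} (h : E n → ℂ) : L2C n :=
  if hh : MemLp h 2 volume then hh.toLp h else 0

/-- A real `L²` function regarded as a complex one. -/
def cpx {n : ℕ} (w : L2R n) : L2C n := toL2 fun x => ((w x : ℝ) : ℂ)

/-- The superposition `f(w)`, as an element of `L²(ℝⁿ; ℂ)`. -/
def superpose {n : ℕ} (f : ℝ → ℝ) (w : L2R n) : L2C n := toL2 fun x => ((f (w x) : ℝ) : ℂ)

/-- The modulus of the frequency variable. Mathlib's Fourier transform has the kernel
`exp (-2πi x·ξ)`, so that its variable `ξ` corresponds to `2πξ` for the kernel `exp (-i x·ξ)`. -/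
def freq {n : ℕ} (ξ : E n) : ℝ := 2 * Real.pi * ‖ξ‖

/-- The Fourier multiplier operator `g ↦ 𝓕⁻¹ [m 𝓕 g]` on `L²(ℝⁿ; ℂ)`, for a symbol `m (|ξ|)`. -/
def multiplier {n : ℕ} (m : ℝ → ℝ) (g : L2C n) : L2C n :=
  𝓕⁻ (toL2 fun ξ : E n => ((m (freq ξ) : ℝ) : ℂ) * (𝓕 g : L2C n) ξ)

/-- The symbol `(e^{-t r²} - r² e^{-t}) / (1 - r²)`, `r = |ξ|`, of the propagator `K₀(t)`. It is
bounded for `t ≥ 0`; the sphere `r = 1`, where the quotient reads `0 / 0`, is a null set. -/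
def symbol0 (t r : ℝ) : ℝ :=
  (Real.exp (-(t * r ^ 2)) - r ^ 2 * Real.exp (-t)) / (1 - r ^ 2)

/-- The symbol `(e^{-t r²} - e^{-t}) / (1 - r²)`, `r = |ξ|`, of the propagator `K₁(t)`. It is
bounded for `t ≥ 0`; the sphere `r = 1`, where the quotient reads `0 / 0`, is a null set. -/
def symbol1 (t r : ℝ) : ℝ :=
  (Real.exp (-(t * r ^ 2)) - Real.exp (-t)) / (1 - r ^ 2)

/-- The propagator `K₀(t)`: `K₀(t) u₀` solves the linear equation
`∂ₜ²u - Δu + ∂ₜu - Δ∂ₜu = 0` with data `(u₀, 0)`. -/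
def K0 {n : ℕ} (t : ℝ) (g : L2C n) : L2C n := multiplier (symbol0 t) g

/-- The propagator `K₁(t)`: `K₁(t) u₁` solves the linear equation
`∂ₜ²u - Δu + ∂ₜu - Δ∂ₜu = 0` with data `(0, u₁)`. -/
def K1 {n : ℕ} (t : ℝ) (g : L2C n) : L2C n := multiplier (symbol1 t) g

/-- The norm `‖|∇|^k w‖_{L²} = ‖|ξ|^k ŵ‖_{L²}` in `[0, ∞]`; it is `∞` exactly if `|∇|^k w` is not
square integrable. -/
def fracGradNorm {n : ℕ} (k : ℝ) (w : L2R n) : ℝ≥0∞ :=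
  eLpNorm (fun ξ : E n => ((freq ξ ^ k : ℝ) : ℂ) * (𝓕 (cpx w) : L2C n) ξ) 2 volume

/-- The norm `(‖w‖₂² + ‖|∇|^k w‖₂²)^{1/2}` of `H^k(ℝⁿ)`, in `[0, ∞]`. -/
def sobolevNorm {n : ℕ} (k : ℝ) (w : L2R n) : ℝ≥0∞ :=
  (eLpNorm w 2 volume ^ 2 + fracGradNorm k w ^ 2) ^ (1 / 2 : ℝ)

/-- `w ∈ H^k(ℝⁿ)`. -/
def MemH {n : ℕ} (k : ℝ) (w : L2R n) : Prop := sobolevNorm k w < ∞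

/-- `u ∈ C([0, ∞); H^k(ℝⁿ))`; the values of `u` at negative times are irrelevant. -/
def ContinuousInH {n : ℕ} (k : ℝ) (u : ℝ → L2R n) : Prop :=
  (∀ t, 0 ≤ t → MemH k (u t)) ∧
    ∀ t, 0 ≤ t → Tendsto (fun s => sobolevNorm k (u s - u t)) (𝓝[Set.Ici 0] t) (𝓝 0)

/-- `u` is a global mild solution of `∂ₜ²u - Δu + ∂ₜu - Δ∂ₜu = f(u)` with
`u(0) = u₀`, `∂ₜu(0) = u₁`: for every `t ≥ 0`,
`u(t) = K₀(t) u₀ + K₁(t) u₁ + ∫₀ᵗ K₁(t - τ) f(u(τ)) dτ`,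
where `f(u(τ)) ∈ L²` and the integral is a convergent Bochner integral in `L²`. -/
structure IsMildSolution {n : ℕ} (f : ℝ → ℝ) (u₀ u₁ : L2R n) (u : ℝ → L2R n) : Prop where
  memLp : ∀ τ, 0 ≤ τ → MemLp (fun x => f (u τ x)) 2 volume
  integrable : ∀ t, 0 ≤ t →
    IntervalIntegrable (fun τ => K1 (t - τ) (superpose f (u τ))) volume 0 t
  eq : ∀ t, 0 ≤ t →
    cpx (u t) = K0 t (cpx u₀) + K1 t (cpx u₁) + ∫ τ in (0 : ℝ)..t, K1 (t - τ) (superpose f (u τ))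

/-- Nonlinearities of order `p` (for `p > 2`, such as `|s|^p` and `±|s|^{p-1} s`): `f` is `C²` and
`|f⁽ʲ⁾(s)| ≤ A |s|^{p-j}` for `j = 0, 1, 2`. -/
def PowerType (p : ℝ) (f : ℝ → ℝ) : Prop :=
  ContDiff ℝ 2 f ∧ ∃ A : ℝ, ∀ s : ℝ, |f s| ≤ A * |s| ^ p ∧ |deriv f s| ≤ A * |s| ^ (p - 1) ∧
    |deriv (deriv f) s| ≤ A * |s| ^ (p - 2)

/-- The regularity index `k₀`: `1` in dimension one, `1 + ε` in dimension two. -/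
def regIndex (n : ℕ) (ε : ℝ) : ℝ := if n = 1 then 1 else 1 + ε

end DampedWave

end

open DampedWave

noncomputable section

namespace DampedWave

variable {n : ℕ}

/-! ### Bounds for the symbols of the propagators -/

/-! At low frequencies both propagators behave like the heat semigroup $e^{-t|\xi|^2}$. At high
frequencies they decay exponentially in time, and there `K1` gains two derivatives. Data in $L^1$
have bounded Fourier transforms, so scaling the $L^2$ norm of a Gaussian gives the rate
$(1+t)^{-n/4-k/2}$ for the linear evolution (`weightedNorm_mulL2_le_of_low_high`,
`weightedNorm_linearEvolution_le`).

Put $\gamma=\frac n2(p-1)$; the condition $p>1+\frac2n$ says exactly that $\gamma>1$. If $u(t)$ has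
the size of a heat solution in $H^1$ (`HeatBound`), the Gagliardo-Nirenberg inequality gives
$\|f(u)\|_1\lesssim(1+t)^{-\gamma}$ and $\|f(u)\|_2\lesssim(1+t)^{-\gamma-n/4}$
(`superpose_bounds`). In the Duhamel integral the times $\tau\le t/2$ are estimated from $L^1$,
where $(1+\tau)^{-\gamma}$ is integrable, and the times $\tau\ge t/2$ by smoothing of fewer than two
derivatives. Both halves decay like the linear part (`weightedNorm_duhamel_le`).

Existence follows from a contraction on curves of heat size in $H^1$, with only the distance
$\sup_t\|u(t)-v(t)\|_2$. The set is complete because the $H^1$ bounds survive $L^2$ limits, and the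
map contracts because $f(u)-f(v)$ is estimated in $L^1$ by $\|u-v\|_2$, so no derivative falls on a
difference (`superpose_sub_bound`, `exists_heatDecay_solution`).

Smoothing from $L^2$ gives all orders $k<2$. For $2\le k<3$, decay in $H^{3/2}$ bounds
$\|u\|_\infty$, whence $\|\nabla f(u)\|_2\lesssim\|u\|_\infty^{p-1}\|\nabla u\|_2$, and smoothing
starts from one derivative instead of none (`weightedNorm_duhamel_of_picard`). No fractional chain
rule is needed. Uniqueness in the whole class is Gronwall's inequality together with the same
$L^2\to L^1$ Lipschitz bound (`IsMildSolution.eq_of_continuousInH`). -/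

theorem abs_exp_sub_exp_le {x y m : ℝ} (hx : m ≤ x) (hy : m ≤ y) :
    |Real.exp (-x) - Real.exp (-y)| ≤ |x - y| * Real.exp (-m) := by
  wlog h : x ≤ y generalizing x y
  · rw [abs_sub_comm, abs_sub_comm x]
    exact this hy hx (le_of_not_ge h)
  have h1 : Real.exp (-y) ≤ Real.exp (-x) := Real.exp_le_exp.2 (by linarith)
  rw [abs_of_nonneg (sub_nonneg.2 h1), abs_sub_comm, abs_of_nonneg (sub_nonneg.2 h)]
  have h2 : Real.exp (-y) = Real.exp (-x) * Real.exp (-(y - x)) := by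
    rw [← Real.exp_add]; congr 1; ring
  have h3 := Real.add_one_le_exp (-(y - x))
  have h4 : Real.exp (-x) ≤ Real.exp (-m) := Real.exp_le_exp.2 (by linarith)
  have h5 := Real.exp_pos (-x)
  calc Real.exp (-x) - Real.exp (-y) = (1 - Real.exp (-(y - x))) * Real.exp (-x) := by
        rw [h2]; ring
    _ ≤ (y - x) * Real.exp (-x) := mul_le_mul_of_nonneg_right (by linarith) h5.le
    _ ≤ (y - x) * Real.exp (-m) := by
        apply mul_le_mul_of_nonneg_left h4; linarith

theorem abs_exp_sub_exp_le' {x y m : ℝ} (hx : m ≤ x) (hy : m ≤ y) :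
    |Real.exp (-x) - Real.exp (-y)| ≤ Real.exp (-m) := by
  have h4 : Real.exp (-x) ≤ Real.exp (-m) := Real.exp_le_exp.2 (by linarith)
  have h5 : Real.exp (-y) ≤ Real.exp (-m) := Real.exp_le_exp.2 (by linarith)
  have := Real.exp_pos (-x)
  have := Real.exp_pos (-y)
  rw [abs_le]; constructor <;> linarith

/-- With $a=r^2$, the quotient is harmless where $|1-a|\ge\frac12$. Near $a=1$ the mean value bound
produces the factor $t|1-a|$, which cancels the denominator. The remaining $t$ is absorbed by half
of the exponential, whence the $/2$ in the exponent. -/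
theorem abs_symbol1_le {t : ℝ} (ht : 0 ≤ t) (r : ℝ) :
    |symbol1 t r| ≤ 10 * Real.exp (-(t * min (r ^ 2) 1) / 2) / (1 + r ^ 2) := by
  have ha0 : 0 ≤ r ^ 2 := sq_nonneg r
  unfold symbol1
  generalize r ^ 2 = a at *
  have hE := Real.exp_pos (-(t * min a 1) / 2)
  rcases eq_or_ne a 1 with rfl | h1
  · simp; positivity
  have h1' : 0 < |1 - a| := abs_pos.2 (sub_ne_zero.2 h1.symm)
  have hm0 : 0 ≤ min a 1 := le_min ha0 zero_le_one
  have hx : t * min a 1 ≤ t * a := by gcongr; exact min_le_left _ _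
  have hy : t * min a 1 ≤ t := by nlinarith [min_le_right a 1]
  rw [abs_div, div_le_div_iff₀ h1' (by linarith)]
  have hsq : Real.exp (-(t * min a 1))
      = Real.exp (-(t * min a 1) / 2) * Real.exp (-(t * min a 1) / 2) := by
    rw [← Real.exp_add]; congr 1; ring
  have hE1 : Real.exp (-(t * min a 1) / 2) ≤ 1 := Real.exp_le_one_iff.2 (by nlinarith)
  by_cases h2 : 1 / 2 ≤ |1 - a|
  · have := abs_exp_sub_exp_le' hx hy
    have h3 : 1 + a ≤ 10 * |1 - a| := by
      rcases abs_cases (1 - a) with h | h <;> linarith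
    calc _ ≤ Real.exp (-(t * min a 1)) * (10 * |1 - a|) := by gcongr
      _ ≤ Real.exp (-(t * min a 1) / 2) * (10 * |1 - a|) := by
        gcongr; nlinarith [mul_nonneg ht hm0]
      _ = _ := by ring
  · have h := abs_exp_sub_exp_le hx hy
    have h4 : |t * a - t| = t * |1 - a| := by
      rw [show t * a - t = t * (a - 1) by ring, abs_mul, abs_of_nonneg ht, abs_sub_comm]
    rw [h4] at h
    push Not at h2
    have h5 : 1 / 2 ≤ min a 1 := by
      rw [le_min_iff]; rw [abs_lt] at h2; constructor <;> linarith
    have h6 : a ≤ 3 / 2 := by rw [abs_lt] at h2; linarith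
    -- Here $\min(a,1)\ge\frac12$, so $t\le4x$ with $x=t\min(a,1)/2$, and $xe^{-x}\le1$.
    have h7 : t * Real.exp (-(t * min a 1) / 2) ≤ 4 := by
      have := Real.add_one_le_exp (t * min a 1 / 2)
      have h8 : Real.exp (-(t * min a 1) / 2) = (Real.exp (t * min a 1 / 2))⁻¹ := by
        rw [← Real.exp_neg]; congr 1; ring
      rw [h8, ← div_eq_mul_inv, div_le_iff₀ (Real.exp_pos _)]
      nlinarith
    calc _ ≤ t * |1 - a| * Real.exp (-(t * min a 1)) * (1 + a) := by gcongr
      _ = (t * Real.exp (-(t * min a 1) / 2)) * (1 + a)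
          * (|1 - a| * Real.exp (-(t * min a 1) / 2)) := by rw [hsq]; ring
      _ ≤ 4 * (1 + 3 / 2) * (|1 - a| * Real.exp (-(t * min a 1) / 2)) := by gcongr
      _ = _ := by ring

/-- The extra multiple $e^{-t}$ of the identity does not decay in the frequency, so unlike `K1` the
propagator `K0` gains no derivatives. -/
theorem symbol0_eq {t r : ℝ} (hr : r ^ 2 ≠ 1) : symbol0 t r = symbol1 t r + Real.exp (-t) := by
  have : 1 - r ^ 2 ≠ 0 := sub_ne_zero.2 hr.symm
  unfold symbol0 symbol1
  field_simp
  ring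

theorem abs_symbol0_le {t : ℝ} (ht : 0 ≤ t) (r : ℝ) :
    |symbol0 t r| ≤ 11 * Real.exp (-(t * min (r ^ 2) 1) / 2) := by
  have hE := Real.exp_pos (-(t * min (r ^ 2) 1) / 2)
  by_cases hr : r ^ 2 = 1
  · simp [symbol0, hr]; positivity
  rw [symbol0_eq hr]
  have h1 := abs_symbol1_le ht r
  have h2 : 10 * Real.exp (-(t * min (r ^ 2) 1) / 2) / (1 + r ^ 2)
      ≤ 10 * Real.exp (-(t * min (r ^ 2) 1) / 2) :=
    div_le_self (by positivity) (by nlinarith [sq_nonneg r])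
  have h3 : Real.exp (-t) ≤ Real.exp (-(t * min (r ^ 2) 1) / 2) :=
    Real.exp_le_exp.2 (by nlinarith [min_le_right (r ^ 2) 1])
  have h4 := abs_add_le (symbol1 t r) (Real.exp (-t))
  rw [abs_of_pos (Real.exp_pos _)] at h4
  linarith

/-- Passing from $t$ to $1+t$ costs only $e^{1/2}\le2$ when $r\le1$, and makes the Gaussian bounds
uniform down to $t=0$. -/
theorem exp_min_le {t r : ℝ} (hr : r ≤ 1) (hr0 : 0 ≤ r) :
    Real.exp (-(t * min (r ^ 2) 1) / 2) ≤ 2 * Real.exp (-((1 + t) * r ^ 2) / 2) := by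
  have h1 : min (r ^ 2) 1 = r ^ 2 := min_eq_left (by nlinarith)
  have h2 : Real.exp (1 / 2) ≤ 2 := by
    have h := Real.exp_one_lt_d9
    have h3 : Real.exp (1 / 2) * Real.exp (1 / 2) = Real.exp 1 := by
      rw [← Real.exp_add]; norm_num
    nlinarith [Real.exp_pos (1 / 2)]
  calc _ ≤ Real.exp (1 / 2 + -((1 + t) * r ^ 2) / 2) := by
        rw [h1]; apply Real.exp_le_exp.2; nlinarith
    _ ≤ _ := by rw [Real.exp_add]; gcongr

/-- The propagator symbols decay like a heat kernel at low frequencies and exponentially in time,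
with a gain of two derivatives, at high frequencies. -/
theorem rpow_mul_abs_symbol1_le {t r j k : ℝ} (ht : 0 ≤ t) (hr : 0 ≤ r)
    (hk : k ≤ j + 2) :
    r ^ k * |symbol1 t r| ≤
      20 * (r ^ k * Real.exp (-((1 + t) * r ^ 2) / 2) + Real.exp (-t / 2) * r ^ j) := by
  have h := abs_symbol1_le ht r
  have hE := Real.exp_pos (-(t * min (r ^ 2) 1) / 2)
  have hrk : 0 ≤ r ^ k := Real.rpow_nonneg hr k
  have hrj : 0 ≤ r ^ j := Real.rpow_nonneg hr j
  have hE2 := Real.exp_pos (-t / 2)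
  have hE3 := Real.exp_pos (-((1 + t) * r ^ 2) / 2)
  rcases le_or_gt r 1 with h1 | h1
  · have h2 := exp_min_le (t := t) h1 hr
    have h3 : |symbol1 t r| ≤ 20 * Real.exp (-((1 + t) * r ^ 2) / 2) := by
      refine h.trans ((div_le_self (by positivity) (by nlinarith)).trans (by linarith))
    calc _ ≤ r ^ k * (20 * Real.exp (-((1 + t) * r ^ 2) / 2)) := by gcongr
      _ ≤ _ := by nlinarith [mul_nonneg hE2.le hrj]
  · have h2 : min (r ^ 2) 1 = 1 := min_eq_right (by nlinarith)
    rw [h2, mul_one] at h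
    have h3 : r ^ k ≤ r ^ j * r ^ 2 := by
      rw [← Real.rpow_two, ← Real.rpow_add (by linarith)]
      exact Real.rpow_le_rpow_of_exponent_le h1.le hk
    calc _ ≤ (r ^ j * r ^ 2) * (10 * Real.exp (-t / 2) / (1 + r ^ 2)) := by gcongr
      _ = 10 * (Real.exp (-t / 2) * r ^ j) * (r ^ 2 / (1 + r ^ 2)) := by ring
      _ ≤ 10 * (Real.exp (-t / 2) * r ^ j) * 1 := by
        gcongr; rw [div_le_one (by positivity)]; linarith
      _ ≤ _ := by nlinarith [mul_nonneg hE2.le hrj, mul_nonneg hrk hE3.le]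

theorem rpow_mul_abs_symbol0_le {t r k : ℝ} (ht : 0 ≤ t) (hr : 0 ≤ r) :
    r ^ k * |symbol0 t r| ≤
      22 * (r ^ k * Real.exp (-((1 + t) * r ^ 2) / 2) + Real.exp (-t / 2) * r ^ k) := by
  have h := abs_symbol0_le ht r
  have hrk : 0 ≤ r ^ k := Real.rpow_nonneg hr k
  have hE2 := Real.exp_pos (-t / 2)
  have hE3 := Real.exp_pos (-((1 + t) * r ^ 2) / 2)
  have : |symbol0 t r| ≤ 22 * (Real.exp (-((1 + t) * r ^ 2) / 2) + Real.exp (-t / 2)) := by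
    rcases le_or_gt r 1 with h1 | h1
    · have h2 := exp_min_le (t := t) h1 hr
      linarith
    · have h2 : min (r ^ 2) 1 = 1 := min_eq_right (by nlinarith)
      rw [h2, mul_one] at h
      linarith
  nlinarith [mul_le_mul_of_nonneg_left this hrk]

/-- The high-frequency factor $(1+r^2)^{-1}$ is kept here, not traded for a weight: its square
integrability in dimensions $n\le3$ is what gives $L^1\to L^2$ bounds. -/
theorem abs_symbol1_le_add {t r : ℝ} (ht : 0 ≤ t) (hr : 0 ≤ r) :
    |symbol1 t r| ≤ 20 * Real.exp (-((1 + t) * r ^ 2) / 2)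
      + 10 * Real.exp (-t / 2) * (1 + r ^ 2)⁻¹ := by
  have h := abs_symbol1_le ht r
  have hE2 := Real.exp_pos (-t / 2)
  have hE3 := Real.exp_pos (-((1 + t) * r ^ 2) / 2)
  rcases le_or_gt r 1 with h1 | h1
  · have h2 := exp_min_le (t := t) h1 hr
    have h3 : |symbol1 t r| ≤ 20 * Real.exp (-((1 + t) * r ^ 2) / 2) := by
      refine h.trans ((div_le_self (by positivity) (by nlinarith)).trans (by linarith))
    have : 0 ≤ 10 * Real.exp (-t / 2) * (1 + r ^ 2)⁻¹ := by positivity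
    linarith
  · have h2 : min (r ^ 2) 1 = 1 := min_eq_right (by nlinarith)
    rw [h2, mul_one, div_eq_mul_inv] at h
    linarith

/-- Smoothing of `K₁(t)`: a gain of `k - j ≤ 2` derivatives with the heat kernel's decay rate. -/
theorem rpow_mul_abs_symbol1_le_rpow {t r j k : ℝ} (ht : 0 ≤ t) (hr : 0 ≤ r) (hj : 0 ≤ j)
    (hjk : j ≤ k) (hk : k ≤ j + 2) :
    r ^ k * |symbol1 t r| ≤ 30 * (1 + t) ^ (-((k - j) / 2)) * r ^ j := by
  have ht1 : 0 < 1 + t := by linarith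
  have h := abs_symbol1_le ht r
  have hrk : r ^ k = r ^ (k - j) * r ^ j := by
    rw [← Real.rpow_add_of_nonneg hr (by linarith) hj]; congr 1; ring
  have hrj : 0 ≤ r ^ j := Real.rpow_nonneg hr j
  have key : r ^ (k - j) * |symbol1 t r| ≤ 30 * (1 + t) ^ (-((k - j) / 2)) := by
    rw [Real.rpow_neg ht1.le, ← div_eq_mul_inv, le_div_iff₀ (by positivity)]
    have h1 : r ^ (k - j) * (1 + t) ^ ((k - j) / 2) = ((1 + t) * r ^ 2) ^ ((k - j) / 2) := by
      rw [Real.mul_rpow ht1.le (sq_nonneg r), ← Real.rpow_natCast, ← Real.rpow_mul hr, mul_comm]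
      congr 2; push_cast; ring
    -- The exponent $(k-j)/2$ lies in $[0,1]$, so $y^\theta\le1+y$.
    have h2 : ((1 + t) * r ^ 2) ^ ((k - j) / 2) ≤ 1 + (1 + t) * r ^ 2 := by
      have h0 : 0 ≤ (1 + t) * r ^ 2 := by positivity
      calc _ ≤ (1 + (1 + t) * r ^ 2) ^ ((k - j) / 2) := by
            apply Real.rpow_le_rpow h0 <;> linarith
        _ ≤ (1 + (1 + t) * r ^ 2) ^ (1 : ℝ) :=
            Real.rpow_le_rpow_of_exponent_le (by linarith) (by linarith)
        _ = _ := Real.rpow_one _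
    have ha0 : 0 ≤ r ^ 2 := sq_nonneg r
    have hab := abs_nonneg (symbol1 t r)
    calc _ = (r ^ (k - j) * (1 + t) ^ ((k - j) / 2)) * |symbol1 t r| := by ring
      _ ≤ (1 + (1 + t) * r ^ 2) *
          (10 * Real.exp (-(t * min (r ^ 2) 1) / 2) / (1 + r ^ 2)) := by
        rw [h1]; gcongr
      _ ≤ 30 := by
        generalize r ^ 2 = a at *
        set x := t * min a 1 with hx
        have hx0 : 0 ≤ x := mul_nonneg ht (le_min ha0 zero_le_one)
        -- The factor $1+a$ is cancelled by the two derivatives that the symbol gains, and $1+x$ is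
        -- absorbed by the exponential.
        have h3 : 1 + (1 + t) * a ≤ (1 + x) * (1 + a) := by
          rcases min_cases a 1 with ⟨h, h'⟩ | ⟨h, h'⟩ <;> rw [hx, h] <;>
            nlinarith [mul_nonneg ht ha0]
        have h4 : (1 + x) * Real.exp (-x / 2) ≤ 3 := by
          have := Real.add_one_le_exp (x / 2)
          have h8 : Real.exp (-x / 2) = (Real.exp (x / 2))⁻¹ := by
            rw [← Real.exp_neg]; congr 1; ring
          rw [h8, ← div_eq_mul_inv, div_le_iff₀ (Real.exp_pos _)]
          nlinarith
        rw [mul_div_assoc', div_le_iff₀ (by linarith)]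
        have hE := Real.exp_pos (-x / 2)
        calc _ ≤ (1 + x) * (1 + a) * (10 * Real.exp (-x / 2)) := by gcongr
          _ = 10 * ((1 + x) * Real.exp (-x / 2)) * (1 + a) := by ring
          _ ≤ 10 * 3 * (1 + a) := by gcongr
          _ = _ := by ring
  calc _ = r ^ (k - j) * |symbol1 t r| * r ^ j := by rw [hrk]; ring
    _ ≤ _ := by gcongr

theorem continuous_symbol0 (r : ℝ) : Continuous fun t => symbol0 t r := by
  unfold symbol0; fun_prop

theorem continuous_symbol1 (r : ℝ) : Continuous fun t => symbol1 t r := by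
  unfold symbol1; fun_prop

theorem measurable_symbol0 (t : ℝ) : Measurable (symbol0 t) := by
  unfold symbol0; fun_prop

theorem measurable_symbol1 (t : ℝ) : Measurable (symbol1 t) := by
  unfold symbol1; fun_prop

theorem abs_symbol1_le_ten {t : ℝ} (ht : 0 ≤ t) (r : ℝ) : |symbol1 t r| ≤ 10 := by
  have h0 : 0 ≤ min (r ^ 2) 1 := le_min (sq_nonneg r) zero_le_one
  refine (abs_symbol1_le ht r).trans ((div_le_self (by positivity) (by nlinarith)).trans ?_)
  have : Real.exp (-(t * min (r ^ 2) 1) / 2) ≤ 1 := Real.exp_le_one_iff.2 (by nlinarith)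
  linarith

theorem abs_symbol0_le_eleven {t : ℝ} (ht : 0 ≤ t) (r : ℝ) : |symbol0 t r| ≤ 11 := by
  have h0 : 0 ≤ min (r ^ 2) 1 := le_min (sq_nonneg r) zero_le_one
  refine (abs_symbol0_le ht r).trans ?_
  have : Real.exp (-(t * min (r ^ 2) 1) / 2) ≤ 1 := Real.exp_le_one_iff.2 (by nlinarith)
  linarith

/-! ### Multiplication operators on `L²` -/

theorem toL2_of_memLp {h : E n → ℂ} (hh : MemLp h 2 volume) : toL2 h = hh.toLp h := dif_pos hh

theorem coeFn_toL2 {h : E n → ℂ} (hh : MemLp h 2 volume) : toL2 h =ᵐ[volume] h := by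
  rw [toL2_of_memLp hh]; exact hh.coeFn_toLp

theorem enorm_toL2_le (h : E n → ℂ) : ‖toL2 h‖ₑ ≤ eLpNorm h 2 volume := by
  by_cases hh : MemLp h 2 volume
  · rw [toL2_of_memLp hh, Lp.enorm_toLp]
  · rw [toL2, dif_neg hh]; simp

/-- Multiplication by a function, on `L²`. -/
def mulL2 (m : E n → ℂ) (g : L2C n) : L2C n := toL2 fun ξ => m ξ * g ξ

/-- A measurable function bounded by a given constant. -/
structure BoundedSymbol (m : E n → ℂ) (B : ℝ) : Prop where
  meas : AEStronglyMeasurable m volume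
  bound : ∀ ξ, ‖m ξ‖ ≤ B

namespace BoundedSymbol

variable {m : E n → ℂ} {B : ℝ}

theorem eLpNorm_mul_le (hm : BoundedSymbol m B) (g : L2C n) :
    eLpNorm (fun ξ => m ξ * g ξ) 2 volume ≤ ENNReal.ofReal B * ‖g‖ₑ := by
  refine (eLpNorm_le_mul_eLpNorm_of_ae_le_mul (c := B) (g := (g : E n → ℂ)) ?_ 2).trans_eq ?_
  · filter_upwards with ξ
    rw [norm_mul]
    exact mul_le_mul_of_nonneg_right (hm.bound ξ) (norm_nonneg _)
  · rw [Lp.enorm_def]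

theorem memLp_mul (hm : BoundedSymbol m B) (g : L2C n) : MemLp (fun ξ => m ξ * g ξ) 2 volume :=
  ⟨hm.meas.mul (Lp.aestronglyMeasurable g), (hm.eLpNorm_mul_le g).trans_lt
    (ENNReal.mul_lt_top ENNReal.ofReal_lt_top enorm_lt_top)⟩

theorem coeFn_mulL2 (hm : BoundedSymbol m B) (g : L2C n) :
    mulL2 m g =ᵐ[volume] fun ξ => m ξ * g ξ := coeFn_toL2 (hm.memLp_mul g)

theorem mulL2_add (hm : BoundedSymbol m B) (g h : L2C n) :
    mulL2 m (g + h) = mulL2 m g + mulL2 m h := by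
  apply Lp.ext
  filter_upwards [hm.coeFn_mulL2 (g + h), hm.coeFn_mulL2 g, hm.coeFn_mulL2 h, Lp.coeFn_add g h,
    Lp.coeFn_add (mulL2 m g) (mulL2 m h)] with ξ h1 h2 h3 h4 h5
  rw [h1, h5, Pi.add_apply, h2, h3, h4, Pi.add_apply, mul_add]

theorem mulL2_smul (hm : BoundedSymbol m B) (c : ℂ) (g : L2C n) :
    mulL2 m (c • g) = c • mulL2 m g := by
  apply Lp.ext
  filter_upwards [hm.coeFn_mulL2 (c • g), hm.coeFn_mulL2 g, Lp.coeFn_smul c g,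
    Lp.coeFn_smul c (mulL2 m g)] with ξ h1 h2 h4 h5
  rw [h1, h5, Pi.smul_apply, h2, h4, Pi.smul_apply, smul_eq_mul, smul_eq_mul, mul_left_comm]

theorem enorm_mulL2_le (hm : BoundedSymbol m B) (g : L2C n) :
    ‖mulL2 m g‖ₑ ≤ ENNReal.ofReal B * ‖g‖ₑ := (enorm_toL2_le _).trans (hm.eLpNorm_mul_le g)

theorem nonneg (hm : BoundedSymbol m B) : 0 ≤ B := (norm_nonneg _).trans (hm.bound 0)

theorem norm_mulL2_le (hm : BoundedSymbol m B) (g : L2C n) : ‖mulL2 m g‖ ≤ B * ‖g‖ := by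
  have := ENNReal.toReal_mono (ENNReal.mul_ne_top ENNReal.ofReal_ne_top enorm_ne_top)
    (hm.enorm_mulL2_le g)
  simpa [ENNReal.toReal_mul, ENNReal.toReal_ofReal hm.nonneg] using this

/-- Multiplication by a bounded function as a continuous linear map. -/
def toCLM (hm : BoundedSymbol m B) : L2C n →L[ℂ] L2C n :=
  LinearMap.mkContinuous
    { toFun := mulL2 m, map_add' := hm.mulL2_add, map_smul' := hm.mulL2_smul } B hm.norm_mulL2_le

@[simp]
theorem toCLM_apply (hm : BoundedSymbol m B) (g : L2C n) : hm.toCLM g = mulL2 m g := rfl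

end BoundedSymbol

/-! ### The Fourier transform on `L¹ ∩ L²` -/

theorem continuous_fourier_of_integrable {h : E n → ℂ} (hi : Integrable h) :
    Continuous (𝓕 h) :=
  VectorFourier.fourierIntegral_continuous Real.continuous_fourierChar (innerSL ℝ).continuous₂ hi

theorem continuous_fourierInv_of_integrable {h : E n → ℂ} (hi : Integrable h) :
    Continuous (𝓕⁻ h) := by
  have : 𝓕⁻ h = fun w => 𝓕 h (-w) := by ext w; exact Real.fourierInv_eq_fourier_neg h w
  rw [this]
  exact (continuous_fourier_of_integrable hi).comp continuous_neg

/-- The $L^2$ transform agrees with the integral because both satisfy $\int\hat g\,\psi=\int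
g\,\hat\psi$ for test functions, and locally integrable functions are determined by these pairings.
-/
theorem coeFn_fourier_eq {g : L2C n} (hi : Integrable g) :
    (𝓕 g : L2C n) =ᵐ[volume] 𝓕 (g : E n → ℂ) := by
  apply ae_eq_of_integral_contDiff_smul_eq
  · exact (Lp.memLp _).locallyIntegrable (by norm_num)
  · exact (continuous_fourier_of_integrable hi).locallyIntegrable
  intro φ hφ hc
  have hg₁ : HasCompactSupport (Complex.ofRealCLM ∘ φ) := hc.comp_left rfl
  have hg₂ : ContDiff ℝ (⊤ : ℕ∞) (Complex.ofRealCLM ∘ φ) := Complex.ofRealCLM.contDiff.comp hφ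
  set ψ : SchwartzMap (E n) ℂ := hg₁.toSchwartzMap hg₂
  have h1 : (Lp.toTemperedDistribution (𝓕 g)) ψ = (Lp.toTemperedDistribution g) (𝓕 ψ) := by
    rw [← Lp.fourier_toTemperedDistribution_eq]; rfl
  rw [Lp.toTemperedDistribution_apply, Lp.toTemperedDistribution_apply] at h1
  have h2 : ∫ x, (𝓕 ψ) x • (g : E n → ℂ) x = ∫ x, ψ x • 𝓕 (g : E n → ℂ) x := by
    have := VectorFourier.integral_fourierIntegral_smul_eq_flip (L := innerₗ (E n))
      Real.continuous_fourierChar continuous_inner (ψ.integrable (μ := volume)) hi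
    rw [flip_innerₗ] at this
    exact this
  rw [h2] at h1
  exact h1

theorem coeFn_fourierInv_eq {g : L2C n} (hi : Integrable g) :
    (𝓕⁻ g : L2C n) =ᵐ[volume] 𝓕⁻ (g : E n → ℂ) := by
  apply ae_eq_of_integral_contDiff_smul_eq
  · exact (Lp.memLp _).locallyIntegrable (by norm_num)
  · exact (continuous_fourierInv_of_integrable hi).locallyIntegrable
  intro φ hφ hc
  have hg₁ : HasCompactSupport (Complex.ofRealCLM ∘ φ) := hc.comp_left rfl
  have hg₂ : ContDiff ℝ (⊤ : ℕ∞) (Complex.ofRealCLM ∘ φ) := Complex.ofRealCLM.contDiff.comp hφ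
  set ψ : SchwartzMap (E n) ℂ := hg₁.toSchwartzMap hg₂
  have h1 : (Lp.toTemperedDistribution (𝓕⁻ g)) ψ = (Lp.toTemperedDistribution g) (𝓕⁻ ψ) := by
    rw [← Lp.fourierInv_toTemperedDistribution_eq]; rfl
  rw [Lp.toTemperedDistribution_apply, Lp.toTemperedDistribution_apply] at h1
  have h2 : ∫ x, (𝓕⁻ ψ) x • (g : E n → ℂ) x = ∫ x, ψ x • 𝓕⁻ (g : E n → ℂ) x := by
    have := VectorFourier.integral_fourierIntegral_smul_eq_flip (L := -innerₗ (E n))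
      Real.continuous_fourierChar (by simpa using! continuous_inner.neg) (ψ.integrable (μ := volume)) hi
    have hf : (-innerₗ (E n)).flip = -innerₗ (E n) := by
      ext x y; simp [real_inner_comm]
    rw [hf] at this
    rw [SchwartzMap.fourierInv_coe]
    exact this
  rw [h2] at h1
  exact h1

theorem norm_fourier_le (h : E n → ℂ) (w : E n) : ‖𝓕 h w‖ ≤ ∫ x, ‖h x‖ :=
  VectorFourier.norm_fourierIntegral_le_integral_norm _ _ _ _ _

theorem norm_fourierInv_le (h : E n → ℂ) (w : E n) : ‖𝓕⁻ h w‖ ≤ ∫ x, ‖h x‖ :=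
  VectorFourier.norm_fourierIntegral_le_integral_norm _ _ _ _ _

/-- The Fourier transform is bounded from `L¹` to `L^∞`. -/
theorem enorm_fourier_le (g : L2C n) :
    ∀ᵐ ξ, ‖(𝓕 g : L2C n) ξ‖ₑ ≤ eLpNorm g 1 volume := by
  by_cases hi : Integrable g
  · filter_upwards [coeFn_fourier_eq hi] with ξ hξ
    rw [hξ, eLpNorm_one_eq_lintegral_enorm, ← ofReal_norm,
      ← ofReal_integral_norm_eq_lintegral_enorm hi]
    exact ENNReal.ofReal_le_ofReal (norm_fourier_le _ _)
  · have : eLpNorm g 1 volume = ∞ := by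
      by_contra hne
      exact hi (memLp_one_iff_integrable.1 ⟨Lp.aestronglyMeasurable g, lt_top_iff_ne_top.2 hne⟩)
    filter_upwards with ξ
    rw [this]; exact le_top

theorem enorm_fourierInv_le (g : L2C n) :
    ∀ᵐ ξ, ‖(𝓕⁻ g : L2C n) ξ‖ₑ ≤ eLpNorm g 1 volume := by
  by_cases hi : Integrable g
  · filter_upwards [coeFn_fourierInv_eq hi] with ξ hξ
    rw [hξ, eLpNorm_one_eq_lintegral_enorm, ← ofReal_norm,
      ← ofReal_integral_norm_eq_lintegral_enorm hi]
    exact ENNReal.ofReal_le_ofReal (norm_fourierInv_le _ _)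
  · have : eLpNorm g 1 volume = ∞ := by
      by_contra hne
      exact hi (memLp_one_iff_integrable.1 ⟨Lp.aestronglyMeasurable g, lt_top_iff_ne_top.2 hne⟩)
    filter_upwards with ξ
    rw [this]; exact le_top

/-- Properties of integrable elements of `L²` that define closed sets hold everywhere. -/
theorem induction_of_integrable {p : L2C n → Prop} (hc : IsClosed {g | p g})
    (hp : ∀ g : L2C n, Integrable g → p g) (g : L2C n) : p g := by
  apply DenseRange.induction_on (p := p)
    (SchwartzMap.denseRange_toLpCLM (F := ℂ) (E := E n) (p := 2) (μ := volume)
      ENNReal.ofNat_ne_top) g hc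
  intro φ
  exact hp _ ((integrable_congr (φ.coeFn_toLp 2 volume)).2 φ.integrable)

/-! ### Complex conjugation -/

/-- Complex conjugation on `L²`. -/
def conjL2 : L2C n →L[ℝ] L2C n := (Complex.conjCLE : ℂ →L[ℝ] ℂ).compLpL 2 volume

theorem coeFn_conjL2 (g : L2C n) : conjL2 g =ᵐ[volume] fun x => starRingEnd ℂ (g x) :=
  ContinuousLinearMap.coeFn_compLpL _ g

theorem star_fourier (h : E n → ℂ) (ξ : E n) :
    starRingEnd ℂ (𝓕 h ξ) = 𝓕⁻ (fun x => starRingEnd ℂ (h x)) ξ := by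
  rw [Real.fourier_eq', Real.fourierInv_eq', ← integral_conj]
  congr 1; ext x
  rw [smul_eq_mul, smul_eq_mul, map_mul, ← Complex.exp_conj, map_mul, Complex.conj_ofReal,
    Complex.conj_I]
  congr 2; push_cast; ring

theorem conjL2_fourier (g : L2C n) : conjL2 (𝓕 g : L2C n) = 𝓕⁻ (conjL2 g) := by
  apply induction_of_integrable (p := fun g : L2C n => conjL2 (𝓕 g : L2C n) = 𝓕⁻ (conjL2 g))
  · exact isClosed_eq (conjL2.continuous.comp continuous_fourier)
      (continuous_fourierInv.comp conjL2.continuous)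
  intro g hi
  have hi' : Integrable (conjL2 g) := by
    rw [integrable_congr (coeFn_conjL2 g)]
    exact (Complex.conjCLE : ℂ →L[ℝ] ℂ).integrable_comp hi
  apply Lp.ext
  filter_upwards [coeFn_conjL2 (𝓕 g : L2C n), coeFn_fourier_eq hi, coeFn_fourierInv_eq hi']
    with ξ h1 h2 h3
  rw [h1, h2, h3, star_fourier]
  exact (Real.fourierInv_congr_ae (coeFn_conjL2 g) ξ).symm

theorem conjL2_conjL2 (g : L2C n) : conjL2 (conjL2 g) = g := by
  apply Lp.ext
  filter_upwards [coeFn_conjL2 (conjL2 g), coeFn_conjL2 g] with x h1 h2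
  rw [h1, h2, Complex.conj_conj]

theorem conjL2_fourierInv (g : L2C n) : conjL2 (𝓕⁻ g : L2C n) = 𝓕 (conjL2 g) := by
  have h := conjL2_fourier (conjL2 g)
  rw [conjL2_conjL2] at h
  rw [← h, conjL2_conjL2]

/-- Reflection at the origin, on `L²`. -/
def reflL2 : L2C n →+ L2C n :=
  Lp.compMeasurePreserving (fun x => -x) (Measure.measurePreserving_neg volume)

theorem coeFn_reflL2 (g : L2C n) : reflL2 g =ᵐ[volume] fun x => g (-x) :=
  Lp.coeFn_compMeasurePreserving _ _

theorem fourierInv_eq_reflL2 (g : L2C n) : (𝓕⁻ g : L2C n) = reflL2 (𝓕 g : L2C n) := by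
  have hc : Continuous (reflL2 : L2C n → L2C n) :=
    (Lp.isometry_compMeasurePreserving (Measure.measurePreserving_neg volume)).continuous
  apply induction_of_integrable (p := fun g : L2C n => (𝓕⁻ g : L2C n) = reflL2 (𝓕 g : L2C n))
  · exact isClosed_eq continuous_fourierInv (hc.comp continuous_fourier)
  intro g hi
  apply Lp.ext
  have h := (Measure.measurePreserving_neg (volume : Measure (E n))).quasiMeasurePreserving.ae
    (coeFn_fourier_eq hi)
  filter_upwards [coeFn_reflL2 (𝓕 g : L2C n), h, coeFn_fourierInv_eq hi] with ξ h1 h2 h3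
  rw [h1, h2, h3, Real.fourierInv_eq_fourier_neg]

/-! ### Translations -/

/-- Translation by a vector, on `L²`. -/
def translL2 (a : E n) : L2C n →+ L2C n :=
  Lp.compMeasurePreserving (fun x => x + a) (measurePreserving_add_right volume a)

theorem coeFn_translL2 (a : E n) (g : L2C n) : translL2 a g =ᵐ[volume] fun x => g (x + a) :=
  Lp.coeFn_compMeasurePreserving _ _

/-- The character of frequency space belonging to a translation. -/
def phase (a ξ : E n) : ℂ := (Real.fourierChar (inner ℝ a ξ) : ℂ)

theorem boundedSymbol_phase (a : E n) : BoundedSymbol (phase a) 1 where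
  meas := by
    have : Continuous (phase a) := by
      unfold phase
      exact continuous_subtype_val.comp
        (Real.continuous_fourierChar.comp (continuous_const.inner continuous_id))
    exact this.aestronglyMeasurable
  bound ξ := (Circle.norm_coe _).le

/-- Translations serve as a substitute for derivatives: differences $g(x+a)-g(x)$ are controlled
pointwise under Lipschitz maps, and in frequency space they are multiplications. -/
theorem fourier_translL2 (a : E n) (g : L2C n) :
    (𝓕 (translL2 a g) : L2C n) = mulL2 (phase a) (𝓕 g) := by
  have hc : Continuous (translL2 a : L2C n → L2C n) :=
    (Lp.isometry_compMeasurePreserving (measurePreserving_add_right volume a)).continuous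
  apply induction_of_integrable
    (p := fun g : L2C n => (𝓕 (translL2 a g) : L2C n) = mulL2 (phase a) (𝓕 g))
  · exact isClosed_eq (continuous_fourier.comp hc)
      ((boundedSymbol_phase a).toCLM.continuous.comp continuous_fourier)
  intro g hi
  have hi' : Integrable (translL2 a g) := by
    rw [integrable_congr (coeFn_translL2 a g)]
    exact hi.comp_add_right a
  apply Lp.ext
  filter_upwards [(boundedSymbol_phase a).coeFn_mulL2 (𝓕 g), coeFn_fourier_eq hi,
    coeFn_fourier_eq hi'] with ξ h1 h2 h3
  rw [h1, h2, h3, Real.fourier_congr_ae (coeFn_translL2 a g)]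
  have := congrFun (VectorFourier.fourierIntegral_comp_add_right Real.fourierChar volume
    (innerₗ (E n)) (g : E n → ℂ) a) ξ
  exact this

/-! ### Weighted `L²` norms in frequency space -/

theorem freq_nonneg (ξ : E n) : 0 ≤ freq ξ := by unfold freq; positivity

theorem continuous_freq : Continuous (freq : E n → ℝ) := by unfold freq; fun_prop

theorem measurable_freq : Measurable (freq : E n → ℝ) := continuous_freq.measurable

/-- A radial real function, as a complex function of the frequency. -/
def radial (m : ℝ → ℝ) : E n → ℂ := fun ξ => ((m (freq ξ) : ℝ) : ℂ)

theorem measurable_radial {m : ℝ → ℝ} (hm : Measurable m) : Measurable (radial m : E n → ℂ) :=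
  Complex.measurable_ofReal.comp (hm.comp measurable_freq)

theorem norm_radial (m : ℝ → ℝ) (ξ : E n) : ‖radial m ξ‖ = |m (freq ξ)| := by
  simp [radial]

theorem boundedSymbol_radial {m : ℝ → ℝ} (hm : Measurable m) {B : ℝ}
    (hB : ∀ r, 0 ≤ r → |m r| ≤ B) : BoundedSymbol (radial m : E n → ℂ) B where
  meas := (measurable_radial hm).aestronglyMeasurable
  bound ξ := by rw [norm_radial]; exact hB _ (freq_nonneg ξ)

/-- The norm `‖|ξ|^k g‖₂`. -/
def weightedNorm (k : ℝ) (g : L2C n) : ℝ≥0∞ :=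
  eLpNorm (fun ξ : E n => ((freq ξ ^ k : ℝ) : ℂ) * g ξ) 2 volume

theorem fracGradNorm_eq (k : ℝ) (w : L2R n) : fracGradNorm k w = weightedNorm k (𝓕 (cpx w)) := rfl

theorem multiplier_eq (m : ℝ → ℝ) (g : L2C n) : multiplier m g = 𝓕⁻ (mulL2 (radial m) (𝓕 g)) := rfl

theorem aestronglyMeasurable_weight (k : ℝ) (g : L2C n) :
    AEStronglyMeasurable (fun ξ : E n => ((freq ξ ^ k : ℝ) : ℂ) * g ξ) volume := by
  have h : Measurable fun ξ : E n => ((freq ξ ^ k : ℝ) : ℂ) :=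
    Complex.measurable_ofReal.comp (measurable_freq.pow_const k)
  exact h.aestronglyMeasurable.mul (Lp.aestronglyMeasurable g)

theorem norm_weight (k : ℝ) (g : L2C n) (ξ : E n) :
    ‖((freq ξ ^ k : ℝ) : ℂ) * g ξ‖ = freq ξ ^ k * ‖g ξ‖ := by
  rw [norm_mul, Complex.norm_real, Real.norm_of_nonneg (Real.rpow_nonneg (freq_nonneg ξ) k)]

theorem weightedNorm_zero_index (g : L2C n) : weightedNorm 0 g = ‖g‖ₑ := by
  simp [weightedNorm, Lp.enorm_def]

@[simp]
theorem weightedNorm_zero (k : ℝ) : weightedNorm k (0 : L2C n) = 0 := by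
  rw [weightedNorm, eLpNorm_eq_zero_iff (aestronglyMeasurable_weight k 0) (by norm_num)]
  exact Eventually.of_forall fun ξ => by simp

theorem weightedNorm_add_le (k : ℝ) (g h : L2C n) :
    weightedNorm k (g + h) ≤ weightedNorm k g + weightedNorm k h := by
  refine (eLpNorm_congr_ae ?_).trans_le (eLpNorm_add_le (aestronglyMeasurable_weight k g)
    (aestronglyMeasurable_weight k h) (by norm_num))
  filter_upwards [Lp.coeFn_add g h] with ξ h1
  rw [h1, Pi.add_apply, Pi.add_apply, mul_add]

theorem weightedNorm_neg (k : ℝ) (g : L2C n) : weightedNorm k (-g) = weightedNorm k g := by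
  refine eLpNorm_congr_norm_ae ?_
  filter_upwards [Lp.coeFn_neg g] with ξ h1
  rw [h1, Pi.neg_apply, mul_neg, norm_neg]

theorem weightedNorm_sub_le (k : ℝ) (g h : L2C n) :
    weightedNorm k (g - h) ≤ weightedNorm k g + weightedNorm k h := by
  rw [sub_eq_add_neg, ← weightedNorm_neg k h]
  exact weightedNorm_add_le k g _

theorem weightedNorm_le_of_ae {k j C : ℝ} {h g : L2C n}
    (H : ∀ᵐ ξ, freq ξ ^ k * ‖h ξ‖ ≤ C * (freq ξ ^ j * ‖g ξ‖)) :
    weightedNorm k h ≤ ENNReal.ofReal C * weightedNorm j g := by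
  refine eLpNorm_le_mul_eLpNorm_of_ae_le_mul (c := C) ?_ 2
  filter_upwards [H] with ξ hξ
  rwa [norm_weight, norm_weight]

theorem weightedNorm_mulL2_le {m : ℝ → ℝ} {B : ℝ} (hm : BoundedSymbol (radial m : E n → ℂ) B)
    {k j C : ℝ} (h : ∀ r, 0 ≤ r → r ^ k * |m r| ≤ C * r ^ j) (g : L2C n) :
    weightedNorm k (mulL2 (radial m) g) ≤ ENNReal.ofReal C * weightedNorm j g := by
  apply weightedNorm_le_of_ae
  filter_upwards [hm.coeFn_mulL2 g] with ξ hξ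
  rw [hξ, norm_mul, norm_radial, ← mul_assoc, ← mul_assoc]
  exact mul_le_mul_of_nonneg_right (h _ (freq_nonneg ξ)) (norm_nonneg _)

/-- Interpolation between the weights `1` and `|ξ|^K`. -/
theorem rpow_mul_weightedNorm_le {k K l : ℝ} (hk : 0 ≤ k) (hkK : k ≤ K) (hl : 0 ≤ l) (g : L2C n) :
    ENNReal.ofReal (l ^ k) * weightedNorm k g
      ≤ ‖g‖ₑ + ENNReal.ofReal (l ^ K) * weightedNorm K g := by
  have hc : ∀ k : ℝ, ENNReal.ofReal (l ^ k) * weightedNorm k g =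
      eLpNorm (fun ξ => ((l ^ k * freq ξ ^ k * ‖g ξ‖ : ℝ))) 2 volume := by
    intro k
    rw [weightedNorm, ← Real.enorm_of_nonneg (Real.rpow_nonneg hl k), ← eLpNorm_const_smul]
    refine eLpNorm_congr_norm_ae (Eventually.of_forall fun ξ => ?_)
    have := freq_nonneg ξ
    rw [Pi.smul_apply, norm_smul, norm_weight, Real.norm_of_nonneg (by positivity),
      Real.norm_of_nonneg (by positivity), mul_assoc]
  have hmeas : AEStronglyMeasurable (fun ξ => ((l ^ K * freq ξ ^ K * ‖g ξ‖ : ℝ))) volume :=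
    ((measurable_freq.pow_const K).const_mul _).aestronglyMeasurable.mul
      (Lp.aestronglyMeasurable g).norm
  rw [hc, hc, Lp.enorm_def, ← eLpNorm_norm (g : E n → ℂ)]
  refine le_trans (eLpNorm_mono_real (fun ξ => ?_))
    (eLpNorm_add_le (Lp.aestronglyMeasurable g).norm hmeas (by norm_num))
  have h0 := freq_nonneg ξ
  rw [Real.norm_of_nonneg (by positivity), Pi.add_apply]
  -- The additive form with a free scale $l$ replaces a product of powers of norms. The choice
  -- $l=(1+t)^{1/2}$ later balances the two terms for functions of heat size.
  have h1 : l ^ k * freq ξ ^ k ≤ 1 + l ^ K * freq ξ ^ K := by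
    rw [← Real.mul_rpow hl h0, ← Real.mul_rpow hl h0]
    have h2 : 0 ≤ l * freq ξ := by positivity
    rcases le_total (l * freq ξ) 1 with h | h
    · have := Real.rpow_le_one h2 h hk
      have := Real.rpow_nonneg h2 K
      linarith
    · have := Real.rpow_le_rpow_of_exponent_le h hkK
      linarith
  nlinarith [norm_nonneg (g ξ)]

theorem weightedNorm_le_add {k K : ℝ} (hk : 0 ≤ k) (hkK : k ≤ K) (g : L2C n) :
    weightedNorm k g ≤ ‖g‖ₑ + weightedNorm K g := by
  simpa using rpow_mul_weightedNorm_le hk hkK zero_le_one g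

/-! ### Truncated weights, lower semicontinuity, Minkowski's inequality -/

/-- The weight `r^k` cut off at `R`. -/
def truncWeight (k R : ℝ) : ℝ → ℝ := fun r => if r ≤ R then r ^ k else 0

theorem measurable_truncWeight (k R : ℝ) : Measurable (truncWeight k R) :=
  Measurable.ite measurableSet_Iic (measurable_id.pow_const k) measurable_const

theorem truncWeight_nonneg {k R r : ℝ} (hr : 0 ≤ r) : 0 ≤ truncWeight k R r := by
  unfold truncWeight; split_ifs <;> positivity

theorem truncWeight_le {k R r : ℝ} (hr : 0 ≤ r) : truncWeight k R r ≤ r ^ k := by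
  unfold truncWeight; split_ifs
  · exact le_rfl
  · positivity

theorem boundedSymbol_truncWeight {k R : ℝ} (hk : 0 ≤ k) (hR : 0 ≤ R) :
    BoundedSymbol (radial (truncWeight k R) : E n → ℂ) (R ^ k) := by
  refine boundedSymbol_radial (measurable_truncWeight k R) fun r hr => ?_
  rw [abs_of_nonneg (truncWeight_nonneg hr)]
  unfold truncWeight; split_ifs with h
  · exact Real.rpow_le_rpow hr h hk
  · positivity

theorem enorm_mulL2_truncWeight_le (k R : ℝ) (g : L2C n) :
    ‖mulL2 (radial (truncWeight k R)) g‖ₑ ≤ weightedNorm k g := by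
  refine (enorm_toL2_le _).trans (eLpNorm_mono fun ξ => ?_)
  rw [norm_weight, norm_mul, norm_radial, abs_of_nonneg (truncWeight_nonneg (freq_nonneg ξ))]
  exact mul_le_mul_of_nonneg_right (truncWeight_le (freq_nonneg ξ)) (norm_nonneg _)

/-- By Fatou's lemma. This reduces questions about the unbounded weight $|\xi|^k$ to bounded
operators on $L^2$, which commute with limits and with Bochner integrals. -/
theorem weightedNorm_le_of_truncWeight {k : ℝ} (hk : 0 ≤ k) {g : L2C n} {c : ℝ≥0∞}
    (h : ∀ R : ℕ, ‖mulL2 (radial (truncWeight k R)) g‖ₑ ≤ c) : weightedNorm k g ≤ c := by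
  have hb : ∀ R : ℕ, BoundedSymbol (radial (truncWeight k R) : E n → ℂ) ((R : ℝ) ^ k) :=
    fun R => boundedSymbol_truncWeight hk R.cast_nonneg
  refine (Lp.eLpNorm_lim_le_liminf_eLpNorm (p := 2)
    (f := fun R : ℕ => fun ξ : E n => radial (truncWeight k R) ξ * g ξ)
    (fun R => ((hb R).memLp_mul g).1) _ (Eventually.of_forall fun ξ => ?_)).trans ?_
  · refine tendsto_const_nhds.congr' ?_
    filter_upwards [eventually_ge_atTop ⌈freq ξ⌉₊] with R hR
    have : freq ξ ≤ R := (Nat.le_ceil _).trans (Nat.cast_le.2 hR)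
    simp [radial, truncWeight, this]
  · refine liminf_le_of_le (by isBoundedDefault) fun b hb' => ?_
    obtain ⟨R, hR⟩ := hb'.exists
    refine hR.trans (le_trans (le_of_eq ?_) (h R))
    rw [mulL2, toL2_of_memLp ((hb R).memLp_mul g), Lp.enorm_toLp]

/-- Lower semicontinuity under $L^2$ convergence; it is what makes $H^1$ balls closed for the weaker
metric of the contraction argument. -/
theorem weightedNorm_le_of_tendsto {ι : Type*} {l : Filter ι} [l.NeBot] {k : ℝ} (hk : 0 ≤ k)
    {G : ι → L2C n} {g : L2C n} (hG : Tendsto G l (𝓝 g)) {c : ℝ≥0∞}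
    (h : ∀ᶠ i in l, weightedNorm k (G i) ≤ c) : weightedNorm k g ≤ c := by
  refine weightedNorm_le_of_truncWeight hk fun R => ?_
  have hb := boundedSymbol_truncWeight (n := n) hk R.cast_nonneg
  have h1 : Tendsto (fun i => ‖hb.toCLM (G i)‖ₑ) l (𝓝 ‖hb.toCLM g‖ₑ) :=
    ((hb.toCLM.continuous.enorm).tendsto g).comp hG
  refine le_of_tendsto h1 (h.mono fun i hi => ?_)
  exact (enorm_mulL2_truncWeight_le k R _).trans hi

/-- Convergence of the integral is required only in $L^2$: each truncated weight passes inside it,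
and the truncation is removed afterwards. -/
theorem weightedNorm_integral_le {α : Type*} [MeasurableSpace α] {μ : Measure α} {k : ℝ}
    (hk : 0 ≤ k) {G : α → L2C n} (hG : Integrable G μ) {b : α → ℝ≥0∞}
    (h : ∀ᵐ a ∂μ, weightedNorm k (G a) ≤ b a) :
    weightedNorm k (∫ a, G a ∂μ) ≤ ∫⁻ a, b a ∂μ := by
  refine weightedNorm_le_of_truncWeight hk fun R => ?_
  have hb := boundedSymbol_truncWeight (n := n) hk R.cast_nonneg
  rw [← hb.toCLM_apply, ← hb.toCLM.integral_comp_comm hG]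
  refine (enorm_integral_le_lintegral_enorm _).trans (lintegral_mono_ae ?_)
  filter_upwards [h] with a ha
  exact (enorm_mulL2_truncWeight_le k R _).trans ha

/-! ### Strong continuity of families of multiplication operators -/

/-- Dominated convergence with majorant $2C|\xi|^j|g|$. Two exponents are allowed so that operators
gaining derivatives, such as `K1`, are covered. -/
theorem tendsto_weightedNorm_mulL2_sub {ι : Type*} {l : Filter ι} [l.IsCountablyGenerated]
    {m : ι → ℝ → ℝ} {m₀ : ℝ → ℝ} {B C k j : ℝ}
    (hm : ∀ᶠ i in l, BoundedSymbol (radial (m i) : E n → ℂ) B)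
    (hm₀ : BoundedSymbol (radial m₀ : E n → ℂ) B)
    (hb : ∀ᶠ i in l, ∀ r, 0 ≤ r → r ^ k * |m i r| ≤ C * r ^ j)
    (hb₀ : ∀ r, 0 ≤ r → r ^ k * |m₀ r| ≤ C * r ^ j)
    (hlim : ∀ r, 0 ≤ r → Tendsto (fun i => m i r) l (𝓝 (m₀ r))) {g : L2C n}
    (hg : weightedNorm j g < ∞) :
    Tendsto (fun i => weightedNorm k (mulL2 (radial (m i)) g - mulL2 (radial m₀) g)) l (𝓝 0) := by
  have he : ∀ᶠ i in l, (∫⁻ ξ, ‖((freq ξ ^ k : ℝ) : ℂ) * (radial (m i) ξ - radial m₀ ξ) * g ξ‖ₑ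
      ^ (2 : ℝ)) ^ (1 / 2 : ℝ) =
      weightedNorm k (mulL2 (radial (m i)) g - mulL2 (radial m₀) g) := by
    filter_upwards [hm] with i hi
    rw [weightedNorm, eLpNorm_eq_lintegral_rpow_enorm_toReal (by norm_num) (by norm_num)]
    simp only [ENNReal.toReal_ofNat]
    congr 1
    apply lintegral_congr_ae
    filter_upwards [hi.coeFn_mulL2 g, hm₀.coeFn_mulL2 g,
      Lp.coeFn_sub (mulL2 (radial (m i)) g) (mulL2 (radial m₀) g)] with ξ h1 h2 h3
    rw [h3, Pi.sub_apply, h1, h2]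
    congr 2; ring
  refine Tendsto.congr' he ?_
  have h0 : (0 : ℝ≥0∞) = (∫⁻ _ : E n, (0 : ℝ≥0∞)) ^ (1 / 2 : ℝ) := by simp
  rw [h0]
  refine ((ENNReal.continuous_rpow_const (y := 1 / 2)).tendsto _).comp ?_
  refine tendsto_lintegral_filter_of_dominated_convergence'
    (fun ξ => (ENNReal.ofReal (2 * C) * ‖((freq ξ ^ j : ℝ) : ℂ) * g ξ‖ₑ) ^ (2 : ℝ)) ?_ ?_ ?_ ?_
  · filter_upwards [hm] with i hi
    have h : Measurable fun ξ : E n => ((freq ξ ^ k : ℝ) : ℂ) :=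
      Complex.measurable_ofReal.comp (measurable_freq.pow_const k)
    exact ((h.aestronglyMeasurable.mul (hi.meas.sub hm₀.meas)).mul
      (Lp.aestronglyMeasurable g)).enorm.pow_const _
  · filter_upwards [hb] with i hi
    refine Eventually.of_forall fun ξ => ENNReal.rpow_le_rpow ?_ (by norm_num)
    have hf := freq_nonneg ξ
    rw [← ofReal_norm, ← ofReal_norm, ← ENNReal.ofReal_mul' (norm_nonneg _)]
    apply ENNReal.ofReal_le_ofReal
    rw [norm_weight, norm_mul, norm_mul, Complex.norm_real,
      Real.norm_of_nonneg (Real.rpow_nonneg hf k), ← mul_assoc]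
    refine mul_le_mul_of_nonneg_right ?_ (norm_nonneg _)
    calc _ ≤ freq ξ ^ k * (|m i (freq ξ)| + |m₀ (freq ξ)|) := by
          gcongr
          rw [← norm_radial, ← norm_radial]
          exact norm_sub_le _ _
      _ ≤ _ := by linarith [hi _ hf, hb₀ _ hf]
  · have : ∫⁻ ξ, (ENNReal.ofReal (2 * C) * ‖((freq ξ ^ j : ℝ) : ℂ) * g ξ‖ₑ) ^ (2 : ℝ) =
        ENNReal.ofReal (2 * C) ^ (2 : ℝ) * ∫⁻ ξ, ‖((freq ξ ^ j : ℝ) : ℂ) * g ξ‖ₑ ^ (2 : ℝ) := by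
      rw [← lintegral_const_mul'']
      · congr 1; ext ξ; rw [ENNReal.mul_rpow_of_nonneg _ _ (by norm_num)]
      · exact (aestronglyMeasurable_weight j g).enorm.pow_const _
    rw [this]
    refine ENNReal.mul_ne_top (ENNReal.rpow_ne_top_of_nonneg (by norm_num) ENNReal.ofReal_ne_top) ?_
    have h2 := lintegral_rpow_enorm_lt_top_of_eLpNorm_lt_top (p := 2) (by norm_num) (by norm_num) hg
    simpa using h2.ne
  · refine Eventually.of_forall fun ξ => ?_
    have h1 : Tendsto (fun i => ((freq ξ ^ k : ℝ) : ℂ) * (radial (m i) ξ - radial m₀ ξ) * g ξ) l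
        (𝓝 (((freq ξ ^ k : ℝ) : ℂ) * (radial m₀ ξ - radial m₀ ξ) * g ξ)) := by
      have h2 : Tendsto (fun i => radial (m i) ξ) l (𝓝 (radial m₀ ξ)) :=
        (Complex.continuous_ofReal.tendsto _).comp (hlim _ (freq_nonneg ξ))
      exact ((h2.sub_const _).const_mul _).mul_const _
    have h3 := ((ENNReal.continuous_rpow_const (y := 2)).tendsto _).comp
      ((continuous_enorm.tendsto _).comp h1)
    simpa [Function.comp_def] using h3

/-! ### `L²` norms of radial functions -/

/-- The `L²(ℝⁿ)` norm of a radial function of the frequency. -/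
def radialNorm (n : ℕ) (φ : ℝ → ℝ) : ℝ≥0∞ := eLpNorm (fun ξ : E n => φ (freq ξ)) 2 volume

/-- With $l=(1+t)^{1/2}$ this change of variables is the source of the decay factor $(1+t)^{-n/4}$.
-/
theorem radialNorm_comp_mul (φ : ℝ → ℝ) {l : ℝ} (hl : 0 < l) :
    radialNorm n (fun r => φ (l * r)) = ENNReal.ofReal (l ^ (-((n : ℝ) / 2))) * radialNorm n φ := by
  have h1 : (fun ξ : E n => φ (l * freq ξ)) = (fun ξ : E n => φ (freq ξ)) ∘ (l • ·) := by
    ext ξ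
    simp only [Function.comp, freq, norm_smul, Real.norm_of_nonneg hl.le]
    congr 1; ring
  have h2 : MeasurableEmbedding (fun ξ : E n => l • ξ) :=
    (Homeomorph.smulOfNeZero l hl.ne').measurableEmbedding
  have h3 : 0 < |(l ^ Module.finrank ℝ (E n))⁻¹| := abs_pos.2 (by positivity)
  unfold radialNorm
  rw [h1, ← h2.eLpNorm_map_measure, Measure.map_addHaar_smul _ hl.ne',
    eLpNorm_smul_measure_of_ne_zero (ENNReal.ofReal_pos.2 h3).ne', smul_eq_mul]
  congr 1
  rw [ENNReal.ofReal_rpow_of_pos h3, abs_of_pos (by positivity), finrank_euclideanSpace_fin]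
  congr 1
  rw [← Real.rpow_natCast, ← Real.rpow_neg hl.le, ← Real.rpow_mul hl.le]
  congr 1
  simp; ring

theorem radialNorm_lt_top_of_decay {φ : ℝ → ℝ} (hφ : Measurable φ) {C κ : ℝ}
    (hκ : (n : ℝ) < 2 * κ) (h : ∀ r, 0 ≤ r → |φ r| ≤ C * (1 + r) ^ (-κ)) : radialNorm n φ < ∞ := by
  have hκ0 : 0 < κ := by have := n.cast_nonneg (α := ℝ); linarith
  have h1 : MemLp (fun ξ : E n => (1 + ‖ξ‖) ^ (-κ)) 2 volume := by
    rw [memLp_two_iff_integrable_sq]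
    · refine (integrable_one_add_norm (E := E n) (μ := volume) (r := 2 * κ) (by simpa)).congr ?_
      refine Eventually.of_forall fun ξ => ?_
      show (1 + ‖ξ‖) ^ (-(2 * κ)) = ((1 + ‖ξ‖) ^ (-κ)) ^ 2
      rw [← Real.rpow_natCast, ← Real.rpow_mul (by positivity)]
      congr 1; push_cast; ring
    · exact (Measurable.pow_const (by fun_prop) _).aestronglyMeasurable
  have hC : 0 ≤ C := by simpa using (abs_nonneg _).trans (h 0 le_rfl)
  have h2 : MemLp (fun ξ : E n => φ (freq ξ)) 2 volume := by
    refine (h1.const_mul C).mono (hφ.comp measurable_freq).aestronglyMeasurable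
      (Eventually.of_forall fun ξ => ?_)
    rw [Real.norm_eq_abs, Real.norm_of_nonneg (by positivity)]
    refine (h _ (freq_nonneg ξ)).trans (mul_le_mul_of_nonneg_left ?_ hC)
    refine Real.rpow_le_rpow_of_nonpos (by positivity) ?_ (by linarith)
    have : ‖ξ‖ ≤ freq ξ := by
      unfold freq
      nlinarith [norm_nonneg ξ, Real.pi_gt_three]
    linarith
  exact h2.2

theorem radialNorm_gaussian_lt_top {k : ℝ} (hk : 0 ≤ k) :
    radialNorm n (fun r => r ^ k * Real.exp (-(r ^ 2) / 2)) < ∞ := by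
  set κ : ℝ := n / 2 + 1
  -- The constant is the exponential of the maximum over $r$ of $r(k+\kappa)-r^2/2$.
  refine radialNorm_lt_top_of_decay (κ := κ) (C := Real.exp ((k + κ) ^ 2 / 2)) (by fun_prop)
    (by simp only [κ]; linarith) fun r hr => ?_
  have h1r : 0 < 1 + r := by linarith
  have hκ0 : 0 ≤ κ := by positivity
  rw [abs_of_nonneg (by positivity), Real.rpow_neg h1r.le, ← div_eq_mul_inv,
    le_div_iff₀ (by positivity)]
  have h1 : r ^ k * (1 + r) ^ κ ≤ Real.exp (r * (k + κ)) := by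
    calc _ ≤ (1 + r) ^ k * (1 + r) ^ κ := by gcongr; linarith
      _ = (1 + r) ^ (k + κ) := (Real.rpow_add h1r _ _).symm
      _ ≤ (Real.exp r) ^ (k + κ) := by
        gcongr; linarith [Real.add_one_le_exp r]
      _ = _ := (Real.exp_mul r _).symm
  calc _ = r ^ k * (1 + r) ^ κ * Real.exp (-(r ^ 2) / 2) := by ring
    _ ≤ Real.exp (r * (k + κ)) * Real.exp (-(r ^ 2) / 2) := by gcongr
    _ ≤ _ := by
      rw [← Real.exp_add]
      apply Real.exp_le_exp.2
      nlinarith [sq_nonneg (r - (k + κ))]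

theorem radialNorm_inv_one_add_rpow_lt_top {k : ℝ} (hk : (n : ℝ) < 2 * k) :
    radialNorm n (fun r => (1 + r ^ k)⁻¹) < ∞ := by
  have hk0 : 0 < k := by have := n.cast_nonneg (α := ℝ); linarith
  refine radialNorm_lt_top_of_decay (κ := k) (C := 2 ^ k) (by fun_prop) hk fun r hr => ?_
  have h1r : 0 < 1 + r := by linarith
  rw [abs_of_nonneg (by positivity), Real.rpow_neg h1r.le, ← div_eq_mul_inv, inv_eq_one_div,
    div_le_div_iff₀ (by positivity) (by positivity), one_mul]
  have h2 : 0 ≤ r ^ k := by positivity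
  have h3 : (0 : ℝ) ≤ 2 ^ k := by positivity
  rcases le_total r 1 with h | h
  · calc (1 + r) ^ k ≤ 2 ^ k := by gcongr; linarith
      _ ≤ _ := by nlinarith
  · calc (1 + r) ^ k ≤ (2 * r) ^ k := by gcongr; linarith
      _ = 2 ^ k * r ^ k := Real.mul_rpow (by norm_num) hr
      _ ≤ _ := by nlinarith

/-- In polar coordinates the integrand is $r^{n-1-2s}$ near the origin. The bound serves the
low-frequency part in the Sobolev inequality. -/
theorem radialNorm_indicator_rpow_neg_lt_top [NeZero n] {s : ℝ} (hs : 2 * s < n) :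
    radialNorm n (fun r => if r ≤ 1 then r ^ (-s) else 0) < ∞ := by
  have hm : Measurable fun r : ℝ => if r ≤ 1 then r ^ (-s) else 0 :=
    Measurable.ite measurableSet_Iic (by fun_prop) measurable_const
  have hn : 1 ≤ n := NeZero.one_le
  have : Nontrivial (E n) := by
    apply Module.nontrivial_of_finrank_pos (R := ℝ)
    rw [finrank_euclideanSpace_fin]; omega
  have h2 : MemLp (fun ξ : E n => if freq ξ ≤ 1 then freq ξ ^ (-s) else 0) 2 volume := by
    refine (memLp_two_iff_integrable_sq (hm.comp measurable_freq).aestronglyMeasurable).2 ?_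
    have h := (integrable_fun_norm_addHaar (volume : Measure (E n))
      (f := fun r => (if 2 * Real.pi * r ≤ 1 then (2 * Real.pi * r) ^ (-s) else 0) ^ 2)).2
    refine h ?_
    rw [finrank_euclideanSpace_fin]
    set R : ℝ := (2 * Real.pi)⁻¹
    have hpi : 0 < 2 * Real.pi := by positivity
    have hI : IntegrableOn (fun y : ℝ => (2 * Real.pi) ^ (-(2 * s)) * y ^ ((n : ℝ) - 1 - 2 * s))
        (Set.Ioc 0 R) := by
      refine Integrable.const_mul ?_ _
      rw [← IntegrableOn, ← intervalIntegrable_iff_integrableOn_Ioc_of_le (by positivity)]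
      exact intervalIntegral.intervalIntegrable_rpow' (by linarith)
    have hI2 := (integrable_indicator_iff measurableSet_Ioc).2 hI
    refine (hI2.integrableOn (s := Set.Ioi 0)).congr_fun (fun y (hy : 0 < y) => ?_) measurableSet_Ioi
    by_cases hyR : y ≤ R
    · have h3 : 2 * Real.pi * y ≤ 1 := by
        calc _ ≤ 2 * Real.pi * R := by gcongr
          _ = 1 := mul_inv_cancel₀ hpi.ne'
      rw [Set.indicator_of_mem (Set.mem_Ioc.2 ⟨hy, hyR⟩)]
      simp only [h3, if_true, smul_eq_mul]
      rw [Real.mul_rpow hpi.le hy.le, mul_pow, ← Real.rpow_natCast ((2 * Real.pi) ^ (-s)),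
        ← Real.rpow_mul hpi.le, ← Real.rpow_natCast (y ^ (-s)), ← Real.rpow_mul hy.le,
        ← Real.rpow_natCast y, mul_left_comm, ← Real.rpow_add hy]
      congr 2
      · push_cast; ring
      · rw [Nat.cast_sub hn]; push_cast; ring
    · have h3 : ¬ 2 * Real.pi * y ≤ 1 := by
        intro h3
        apply hyR
        simp only [R]
        rw [← one_div, le_div_iff₀ hpi]; linarith
      rw [Set.indicator_of_notMem (by simp [hyR])]
      simp [h3]
  exact h2.2

theorem radialNorm_const_mul (c : ℝ) (φ : ℝ → ℝ) :
    radialNorm n (fun r => c * φ r) = ENNReal.ofReal |c| * radialNorm n φ := by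
  unfold radialNorm
  rw [← Real.enorm_eq_ofReal_abs, ← eLpNorm_const_smul]
  rfl

/-- The Cauchy-Schwarz inequality for a radial weight. -/
theorem eLpNorm_one_radial_mul_le {φ : ℝ → ℝ} (hφ : Measurable φ) {h : E n → ℝ}
    (hh : AEStronglyMeasurable h volume) :
    eLpNorm (fun ξ => φ (freq ξ) * h ξ) 1 volume ≤ radialNorm n φ * eLpNorm h 2 volume :=
  eLpNorm_smul_le_mul_eLpNorm (𝕜 := ℝ) (p := 2) (q := 2) (r := 1) (f := h)
    (φ := fun ξ : E n => φ (freq ξ)) hh (hφ.comp measurable_freq).aestronglyMeasurable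

/-! ### The `L¹`-`L²` estimates for the propagators -/

/-- The Gaussian part pairs the sup bound on $g$ with the $L^2$ norm of $r^ke^{-(1+t)r^2/2}$,
computed by scaling. The exponentially small part needs only the weighted $L^2$ norm of $g$. The
constant $G$ depends on $n$ and $k$ alone. -/
theorem weightedNorm_mulL2_le_of_low_high {k : ℝ} (hk : 0 ≤ k) :
    ∃ G : ℝ, 0 ≤ G ∧ ∀ (m : ℝ → ℝ) (B C t j : ℝ), 0 ≤ C → 0 ≤ t →
      BoundedSymbol (radial m : E n → ℂ) B →
      (∀ r, 0 ≤ r → r ^ k * |m r| ≤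
        C * (r ^ k * Real.exp (-((1 + t) * r ^ 2) / 2) + Real.exp (-t / 2) * r ^ j)) →
      ∀ (g : L2C n) (N M : ℝ), 0 ≤ N → 0 ≤ M → (∀ᵐ ξ, ‖g ξ‖ ≤ N) →
        weightedNorm j g ≤ ENNReal.ofReal M →
        weightedNorm k (mulL2 (radial m) g) ≤ ENNReal.ofReal
          (C * (G * (1 + t) ^ (-((n : ℝ) / 4) - k / 2) * N + Real.exp (-t / 2) * M)) := by
  set φ : ℝ → ℝ := fun r => r ^ k * Real.exp (-(r ^ 2) / 2)
  have hφ : radialNorm n φ < ∞ := radialNorm_gaussian_lt_top hk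
  refine ⟨(radialNorm n φ).toReal, ENNReal.toReal_nonneg, ?_⟩
  intro m B C t j hC ht hm hb g N M hN hM hgN hgM
  have ht1 : 0 < 1 + t := by linarith
  set l : ℝ := (1 + t) ^ (1 / 2 : ℝ)
  have hl : 0 < l := by positivity
  have hl2 : l ^ 2 = 1 + t := by
    rw [← Real.rpow_natCast, ← Real.rpow_mul ht1.le]; norm_num
  have hscale : ∀ r, 0 ≤ r →
      r ^ k * Real.exp (-((1 + t) * r ^ 2) / 2) = l ^ (-k) * φ (l * r) := by
    intro r hr
    simp only [φ]
    rw [Real.mul_rpow hl.le hr, mul_pow, hl2, Real.rpow_neg hl.le]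
    field_simp
  set a : E n → ℝ := fun ξ => C * N * (l ^ (-k) * φ (l * freq ξ))
  set b : E n → ℝ := fun ξ => C * Real.exp (-t / 2) * (freq ξ ^ j * ‖g ξ‖)
  have ha : AEStronglyMeasurable a volume := by
    have : Measurable φ := by fun_prop
    exact (((this.comp (measurable_freq.const_mul l)).const_mul _).const_mul _).aestronglyMeasurable
  have hbm : AEStronglyMeasurable b volume :=
    ((measurable_freq.pow_const j).aestronglyMeasurable.mul
      (Lp.aestronglyMeasurable g).norm).const_mul _
  have hab : weightedNorm k (mulL2 (radial m) g) ≤ eLpNorm (a + b) 2 volume := by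
    refine eLpNorm_mono_ae_real ?_
    filter_upwards [hm.coeFn_mulL2 g, hgN] with ξ h1 h2
    have hf := freq_nonneg ξ
    rw [norm_weight, h1, norm_mul, norm_radial, ← mul_assoc, Pi.add_apply]
    have h3 := mul_le_mul_of_nonneg_right (hb _ hf) (norm_nonneg (g ξ))
    refine h3.trans ?_
    simp only [a, b]
    rw [hscale _ hf]
    have h4 : 0 ≤ C * (l ^ (-k) * φ (l * freq ξ)) := by
      simp only [φ]; positivity
    nlinarith [mul_le_mul_of_nonneg_left h2 h4]
  refine hab.trans ((eLpNorm_add_le ha hbm (by norm_num)).trans ?_)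
  have h5 : eLpNorm a 2 volume =
      ENNReal.ofReal (C * ((radialNorm n φ).toReal * (1 + t) ^ (-((n : ℝ) / 4) - k / 2) * N)) := by
    have h6 : eLpNorm a 2 volume = radialNorm n (fun r => (C * N * l ^ (-k)) * φ (l * r)) := by
      unfold radialNorm; congr 1; ext ξ; simp only [a]; ring
    rw [h6, radialNorm_const_mul, radialNorm_comp_mul φ hl, abs_of_nonneg (by positivity),
      ← ENNReal.ofReal_toReal hφ.ne, ← ENNReal.ofReal_mul (by positivity),
      ← ENNReal.ofReal_mul (by positivity), ENNReal.toReal_ofReal ENNReal.toReal_nonneg]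
    congr 1
    have h7 : l ^ (-k) * l ^ (-((n : ℝ) / 2)) = (1 + t) ^ (-((n : ℝ) / 4) - k / 2) := by
      rw [← Real.rpow_add hl, ← Real.rpow_mul ht1.le]
      congr 1; ring
    rw [← h7]; ring
  have h8 : eLpNorm b 2 volume ≤ ENNReal.ofReal (C * (Real.exp (-t / 2) * M)) := by
    have : eLpNorm b 2 volume = ENNReal.ofReal (C * Real.exp (-t / 2)) * weightedNorm j g := by
      rw [← Real.enorm_of_nonneg (by positivity), weightedNorm, ← eLpNorm_const_smul]
      refine eLpNorm_congr_norm_ae (Eventually.of_forall fun ξ => ?_)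
      have hf := freq_nonneg ξ
      rw [Pi.smul_apply, norm_smul, norm_weight, Real.norm_of_nonneg (by positivity),
        Real.norm_of_nonneg (by positivity)]
    rw [this, ← mul_assoc, ENNReal.ofReal_mul (p := C * Real.exp (-t / 2)) (by positivity)]
    exact mul_le_mul_right hgM _
  rw [h5, mul_add, ENNReal.ofReal_add (by positivity) (by positivity)]
  gcongr

/-- The propagator `K₁(t)` maps `L¹` to `L²` in dimensions up to three. -/
theorem enorm_mulL2_symbol1_le (hn : n ≤ 3) :
    ∃ G : ℝ, 0 ≤ G ∧ ∀ (t : ℝ), 0 ≤ t → ∀ (g : L2C n) (N : ℝ), 0 ≤ N → (∀ᵐ ξ, ‖g ξ‖ ≤ N) →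
      ‖mulL2 (radial (symbol1 t)) g‖ ≤
        G * ((1 + t) ^ (-((n : ℝ) / 4)) + Real.exp (-t / 2)) * N := by
  set φ : ℝ → ℝ := fun r => r ^ (0 : ℝ) * Real.exp (-(r ^ 2) / 2)
  -- $(1+|\xi|^2)^{-1}$ is square integrable exactly for $n<4$.
  set ψ : ℝ → ℝ := fun r => (1 + r ^ (2 : ℝ))⁻¹
  have hφ : radialNorm n φ < ∞ := radialNorm_gaussian_lt_top le_rfl
  have hψ : radialNorm n ψ < ∞ := radialNorm_inv_one_add_rpow_lt_top (by
    have : (n : ℝ) ≤ 3 := by exact_mod_cast hn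
    linarith)
  refine ⟨20 * ((radialNorm n φ).toReal + (radialNorm n ψ).toReal), by positivity, ?_⟩
  intro t ht g N hN hgN
  have ht1 : 0 < 1 + t := by linarith
  have hm : BoundedSymbol (radial (symbol1 t) : E n → ℂ) 10 :=
    boundedSymbol_radial (measurable_symbol1 t) fun r _ => abs_symbol1_le_ten ht r
  set l : ℝ := (1 + t) ^ (1 / 2 : ℝ)
  have hl : 0 < l := by positivity
  have hl2 : l ^ 2 = 1 + t := by
    rw [← Real.rpow_natCast, ← Real.rpow_mul ht1.le]; norm_num
  set a : E n → ℝ := fun ξ => (20 * N) * φ (l * freq ξ)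
  set b : E n → ℝ := fun ξ => (10 * Real.exp (-t / 2) * N) * ψ (freq ξ)
  have ha : AEStronglyMeasurable a volume := by
    have : Measurable φ := by fun_prop
    exact ((this.comp (measurable_freq.const_mul l)).const_mul _).aestronglyMeasurable
  have hbm : AEStronglyMeasurable b volume := by
    have : Measurable ψ := by fun_prop
    exact ((this.comp measurable_freq).const_mul _).aestronglyMeasurable
  have h1 : ‖mulL2 (radial (symbol1 t)) g‖ₑ ≤ eLpNorm (a + b) 2 volume := by
    refine (enorm_toL2_le _).trans (eLpNorm_mono_ae_real ?_)
    filter_upwards [hgN] with ξ h2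
    have hf := freq_nonneg ξ
    rw [norm_mul, norm_radial, Pi.add_apply]
    have h3 := abs_symbol1_le_add ht hf
    calc _ ≤ _ := mul_le_mul h3 h2 (norm_nonneg _) (by positivity)
      _ = _ := by
        simp only [a, b, φ, ψ]
        rw [Real.rpow_zero, mul_pow, hl2, Real.rpow_two]; ring
  have h5 : eLpNorm a 2 volume =
      ENNReal.ofReal (20 * N * ((1 + t) ^ (-((n : ℝ) / 4)) * (radialNorm n φ).toReal)) := by
    have h6 : eLpNorm a 2 volume = radialNorm n (fun r => (20 * N) * φ (l * r)) := rfl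
    rw [h6, radialNorm_const_mul, radialNorm_comp_mul φ hl, abs_of_nonneg (by positivity),
      ← ENNReal.ofReal_toReal hφ.ne, ← ENNReal.ofReal_mul (by positivity),
      ← ENNReal.ofReal_mul (by positivity), ENNReal.toReal_ofReal ENNReal.toReal_nonneg]
    have h7 : l ^ (-((n : ℝ) / 2)) = (1 + t) ^ (-((n : ℝ) / 4)) := by
      rw [← Real.rpow_mul ht1.le]
      congr 1; ring
    rw [← h7]
  have h8 : eLpNorm b 2 volume =
      ENNReal.ofReal (10 * Real.exp (-t / 2) * N * (radialNorm n ψ).toReal) := by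
    have h6 : eLpNorm b 2 volume = radialNorm n (fun r => (10 * Real.exp (-t / 2) * N) * ψ r) := rfl
    rw [h6, radialNorm_const_mul, abs_of_nonneg (by positivity),
      ← ENNReal.ofReal_toReal hψ.ne, ← ENNReal.ofReal_mul (by positivity),
      ENNReal.toReal_ofReal ENNReal.toReal_nonneg]
  have h9 := h1.trans (eLpNorm_add_le ha hbm (by norm_num))
  rw [h5, h8, ← ENNReal.ofReal_add (by positivity) (by positivity), ← ofReal_norm,
    ENNReal.ofReal_le_ofReal_iff (by positivity)] at h9
  refine h9.trans ?_
  have hx : 0 ≤ (1 + t) ^ (-((n : ℝ) / 4)) := by positivity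
  have hy := Real.exp_pos (-t / 2)
  have hG1 : 0 ≤ (radialNorm n φ).toReal := ENNReal.toReal_nonneg
  have hG2 : 0 ≤ (radialNorm n ψ).toReal := ENNReal.toReal_nonneg
  generalize (radialNorm n φ).toReal = u at *
  generalize (radialNorm n ψ).toReal = v at *
  generalize (1 + t) ^ (-((n : ℝ) / 4)) = x at *
  generalize Real.exp (-t / 2) = y at *
  nlinarith [mul_nonneg (mul_nonneg hx hN) hG2, mul_nonneg (mul_nonneg hy.le hN) hG1,
    mul_nonneg (mul_nonneg hy.le hN) hG2]

/-! ### The uniform norm -/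

/-- `‖g‖₁` is controlled by `‖g‖₂` and `‖|ξ|^k g‖₂` for `k > n / 2`. -/
theorem eLpNorm_one_le {k : ℝ} (hk : (n : ℝ) < 2 * k) :
    ∃ G : ℝ, 0 ≤ G ∧ ∀ (g : L2C n) (l : ℝ), 0 < l →
      eLpNorm g 1 volume ≤ ENNReal.ofReal (G * l ^ (-((n : ℝ) / 2))) *
        (‖g‖ₑ + ENNReal.ofReal (l ^ k) * weightedNorm k g) := by
  set ψ : ℝ → ℝ := fun r => (1 + r ^ k)⁻¹
  have hψ : radialNorm n ψ < ∞ := radialNorm_inv_one_add_rpow_lt_top hk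
  have hψm : Measurable ψ := by fun_prop
  refine ⟨(radialNorm n ψ).toReal, ENNReal.toReal_nonneg, fun g l hl => ?_⟩
  set h : E n → ℝ := fun ξ => ‖g ξ‖ + l ^ k * (freq ξ ^ k * ‖g ξ‖)
  have hm2 : AEStronglyMeasurable (fun ξ : E n => l ^ k * (freq ξ ^ k * ‖g ξ‖)) volume :=
    ((measurable_freq.pow_const k).aestronglyMeasurable.mul
      (Lp.aestronglyMeasurable g).norm).const_mul _
  have hhm : AEStronglyMeasurable h volume := (Lp.aestronglyMeasurable g).norm.add hm2
  have h1 : eLpNorm g 1 volume = eLpNorm (fun ξ => ψ (l * freq ξ) * h ξ) 1 volume := by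
    refine eLpNorm_congr_norm_ae (Eventually.of_forall fun ξ => ?_)
    have hf := freq_nonneg ξ
    have h2 : ψ (l * freq ξ) * h ξ = ‖g ξ‖ := by
      simp only [ψ, h]
      rw [Real.mul_rpow hl.le hf]
      have : 1 + l ^ k * freq ξ ^ k ≠ 0 := by positivity
      field_simp
    rw [h2, norm_norm]
  rw [h1]
  refine (eLpNorm_one_radial_mul_le (φ := fun r => ψ (l * r)) (by fun_prop) hhm).trans ?_
  rw [radialNorm_comp_mul ψ hl, ENNReal.ofReal_mul ENNReal.toReal_nonneg,
    ENNReal.ofReal_toReal hψ.ne, mul_comm (radialNorm n ψ)]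
  gcongr
  refine (eLpNorm_add_le (Lp.aestronglyMeasurable g).norm hm2 (by norm_num)).trans ?_
  gcongr
  · rw [eLpNorm_norm, Lp.enorm_def]
  · rw [weightedNorm, ← Real.enorm_of_nonneg (Real.rpow_nonneg hl.le k), ← eLpNorm_const_smul]
    refine (eLpNorm_congr_norm_ae (Eventually.of_forall fun ξ => ?_)).le
    have hf := freq_nonneg ξ
    rw [Pi.smul_apply, norm_smul, norm_weight, Real.norm_of_nonneg (by positivity),
        Real.norm_of_nonneg (by positivity)]

/-! ### The Sobolev inequality -/

theorem coeFn_mulL2_cutoff (A : ℝ) (h : L2C n) :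
    mulL2 (radial fun r => if r ≤ A then 1 else 0) h
      =ᵐ[volume] fun ξ => if freq ξ ≤ A then h ξ else 0 := by
  have hm : BoundedSymbol (radial (fun r => if r ≤ A then 1 else 0) : E n → ℂ) 1 :=
    boundedSymbol_radial (Measurable.ite measurableSet_Iic measurable_const measurable_const)
      fun r _ => by split_ifs <;> simp
  filter_upwards [hm.coeFn_mulL2 h] with ξ hξ
  rw [hξ]
  simp only [radial]
  split_ifs <;> simp

theorem ae_freq_pos [NeZero n] : ∀ᵐ ξ : E n, 0 < freq ξ := by
  have : Nontrivial (E n) := by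
    apply Module.nontrivial_of_finrank_pos (R := ℝ)
    rw [finrank_euclideanSpace_fin]; exact NeZero.pos n
  filter_upwards [Measure.ae_ne volume (0 : E n)] with ξ hξ
  have := norm_pos_iff.2 hξ
  unfold freq; positivity

/-- Cauchy-Schwarz against $|\xi|^{-s}$ on the ball of radius $A$. Through Fourier inversion it
bounds the low-frequency part of a function uniformly. -/
theorem eLpNorm_one_cutoff_le [NeZero n] {s : ℝ} (hs : 2 * s < n) :
    ∃ c : ℝ, 0 < c ∧ ∀ (h : L2C n) (A M : ℝ), 0 < A → 0 ≤ M → weightedNorm s h ≤ ENNReal.ofReal M →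
      eLpNorm (mulL2 (radial fun r => if r ≤ A then 1 else 0) h) 1 volume ≤
        ENNReal.ofReal (c * A ^ ((n : ℝ) / 2 - s) * M) := by
  set φ : ℝ → ℝ := fun r => if r ≤ 1 then r ^ (-s) else 0
  have hφ : radialNorm n φ < ∞ := radialNorm_indicator_rpow_neg_lt_top hs
  have hφm : Measurable φ := Measurable.ite measurableSet_Iic (by fun_prop) measurable_const
  refine ⟨(radialNorm n φ).toReal + 1, by positivity, fun h A M hA hM hW => ?_⟩
  have hm : AEStronglyMeasurable (fun ξ : E n => A ^ (-s) * (freq ξ ^ s * ‖h ξ‖)) volume :=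
    ((measurable_freq.pow_const s).aestronglyMeasurable.mul
      (Lp.aestronglyMeasurable h).norm).const_mul _
  have h1 : eLpNorm (mulL2 (radial fun r => if r ≤ A then 1 else 0) h) 1 volume =
      eLpNorm (fun ξ => φ (A⁻¹ * freq ξ) * (A ^ (-s) * (freq ξ ^ s * ‖h ξ‖))) 1 volume := by
    refine eLpNorm_congr_norm_ae ?_
    filter_upwards [coeFn_mulL2_cutoff A h, ae_freq_pos] with ξ h2 h3
    have h4 : A⁻¹ * freq ξ ≤ 1 ↔ freq ξ ≤ A := by
      rw [inv_mul_le_iff₀ hA, mul_one]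
    rw [h2]
    simp only [φ, h4]
    split_ifs
    · rw [Real.mul_rpow (by positivity) h3.le, Real.rpow_neg h3.le, Real.inv_rpow hA.le,
        Real.rpow_neg hA.le]
      have h5 : 0 < freq ξ ^ s := by positivity
      have h6 : 0 < A ^ s := by positivity
      rw [inv_inv]
      field_simp
      simp
    · simp
  have h7 : eLpNorm (fun ξ : E n => A ^ (-s) * (freq ξ ^ s * ‖h ξ‖)) 2 volume
      ≤ ENNReal.ofReal (A ^ (-s) * M) := by
    have : eLpNorm (fun ξ : E n => A ^ (-s) * (freq ξ ^ s * ‖h ξ‖)) 2 volume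
        = ENNReal.ofReal (A ^ (-s)) * weightedNorm s h := by
      rw [← Real.enorm_of_nonneg (by positivity), weightedNorm, ← eLpNorm_const_smul]
      refine eLpNorm_congr_norm_ae (Eventually.of_forall fun ξ => ?_)
      have hf := freq_nonneg ξ
      rw [Pi.smul_apply, norm_smul, norm_weight, Real.norm_of_nonneg (by positivity),
        Real.norm_of_nonneg (by positivity)]
    rw [this, ENNReal.ofReal_mul (by positivity)]
    gcongr
  rw [h1]
  refine (eLpNorm_one_radial_mul_le (φ := fun r => φ (A⁻¹ * r)) (by fun_prop) hm).trans ?_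
  rw [radialNorm_comp_mul φ (by positivity), ← ENNReal.ofReal_toReal hφ.ne,
    ← ENNReal.ofReal_mul (by positivity), ENNReal.toReal_ofReal ENNReal.toReal_nonneg]
  refine (mul_le_mul_right h7 _).trans ?_
  rw [← ENNReal.ofReal_mul (by positivity)]
  apply ENNReal.ofReal_le_ofReal
  have h8 : A⁻¹ ^ (-((n : ℝ) / 2)) * A ^ (-s) = A ^ ((n : ℝ) / 2 - s) := by
    rw [Real.inv_rpow hA.le, Real.rpow_neg hA.le, inv_inv, ← Real.rpow_add hA]
    congr 1
  rw [← h8]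
  have h9 : 0 ≤ A⁻¹ ^ (-((n : ℝ) / 2)) * A ^ (-s) * M := by positivity
  nlinarith

/-- If the low-frequency part is at most $l/2$ everywhere, then the high-frequency part must exceed
$l/2$ wherever $|g|>l$; Chebyshev's inequality and Plancherel conclude. -/
theorem volume_lt_norm_le {g : L2C n} {A l : ℝ} (hl : 0 < l)
    (hlow : eLpNorm (mulL2 (radial fun r => if r ≤ A then 1 else 0) (𝓕 g : L2C n)) 1 volume
      ≤ ENNReal.ofReal (l / 2)) :
    volume {x | l < ‖g x‖} ≤ ENNReal.ofReal (4 * l ^ (-2 : ℝ)) *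
      ∫⁻ ξ, (if A < freq ξ then ‖(𝓕 g : L2C n) ξ‖ₑ ^ (2 : ℝ) else 0) := by
  set h : L2C n := 𝓕 g
  set P : L2C n := mulL2 (radial fun r => if r ≤ A then 1 else 0) h
  set u : L2C n := 𝓕⁻ P
  set v : L2C n := 𝓕⁻ (h - P)
  have hg : g = u + v := by
    have : u + v = 𝓕⁻ (P + (h - P)) := (fourierInv_add P (h - P)).symm
    rw [this, add_sub_cancel, fourierInv_fourier_eq]
  have hsub : {x | l < ‖g x‖} ≤ᵐ[volume] {x | ENNReal.ofReal (l / 2) ≤ ‖v x‖ₑ} := by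
    filter_upwards [enorm_fourierInv_le P, Lp.coeFn_add u v] with x h1 h2 (h3 : l < ‖g x‖)
    have h4 : ‖u x‖ ≤ l / 2 := by
      have := h1.trans hlow
      rwa [← ofReal_norm, ENNReal.ofReal_le_ofReal_iff (by positivity)] at this
    have h5 : ‖g x‖ ≤ ‖u x‖ + ‖v x‖ := by
      rw [hg, h2]; exact norm_add_le _ _
    show ENNReal.ofReal (l / 2) ≤ ‖v x‖ₑ
    rw [← ofReal_norm]
    exact ENNReal.ofReal_le_ofReal (by linarith)
  refine (measure_mono_ae hsub).trans ?_
  have hv : eLpNorm v 2 volume ^ (2 : ℝ) =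
      ∫⁻ ξ, (if A < freq ξ then ‖h ξ‖ₑ ^ (2 : ℝ) else 0) := by
    have h1 : eLpNorm v 2 volume = eLpNorm (h - P : L2C n) 2 volume := by
      rw [← Lp.enorm_def, ← Lp.enorm_def, ← ofReal_norm, ← ofReal_norm]
      congr 1
      exact (Lp.fourierTransformₗᵢ (E n) ℂ).symm.norm_map (h - P)
    rw [h1, eLpNorm_eq_lintegral_rpow_enorm_toReal (by norm_num) (by norm_num), ← ENNReal.rpow_mul]
    rw [ENNReal.toReal_ofNat, one_div_mul_cancel (by norm_num), ENNReal.rpow_one]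
    apply lintegral_congr_ae
    filter_upwards [Lp.coeFn_sub h P, coeFn_mulL2_cutoff A h] with ξ h2 h3
    rw [h2, Pi.sub_apply, h3]
    by_cases h4 : freq ξ ≤ A
    · simp [h4, not_lt.2 h4]
    · simp [h4, not_le.1 h4]
  have hcheb := mul_meas_ge_le_pow_eLpNorm' (volume : Measure (E n)) (p := 2) (by norm_num)
    (by norm_num) (Lp.aestronglyMeasurable v) (ENNReal.ofReal (l / 2))
  rw [ENNReal.toReal_ofNat, hv, ENNReal.ofReal_rpow_of_pos (by positivity)] at hcheb
  have h6 : ENNReal.ofReal (4 * l ^ (-2 : ℝ)) * ENNReal.ofReal ((l / 2) ^ (2 : ℝ)) = 1 := by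
    rw [← ENNReal.ofReal_mul (by positivity), Real.rpow_neg hl.le, Real.rpow_two, Real.rpow_two]
    rw [← ENNReal.ofReal_one]
    congr 1
    field_simp
    norm_num
  calc _ = ENNReal.ofReal (4 * l ^ (-2 : ℝ)) * (ENNReal.ofReal ((l / 2) ^ (2 : ℝ)) *
        volume {x | ENNReal.ofReal (l / 2) ≤ ‖v x‖ₑ}) := by rw [← mul_assoc, h6, one_mul]
    _ ≤ _ := mul_le_mul_right hcheb _

theorem lintegral_rpow_lt {q b : ℝ} (hq : 2 < q) (hb : 0 ≤ b) :
    ∫⁻ l in Set.Ioi (0 : ℝ), (if l < b then ENNReal.ofReal (l ^ (q - 3)) else 0) =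
      ENNReal.ofReal (b ^ (q - 2) / (q - 2)) := by
  have h1 : ∀ l : ℝ, (if l < b then ENNReal.ofReal (l ^ (q - 3)) else 0) =
      (Set.Iio b).indicator (fun l => ENNReal.ofReal (l ^ (q - 3))) l := by
    intro l; simp [Set.indicator]
  simp_rw [h1]
  rw [lintegral_indicator measurableSet_Iio, Measure.restrict_restrict measurableSet_Iio,
    Set.inter_comm, Set.Ioi_inter_Iio, Measure.restrict_congr_set Ioo_ae_eq_Ioc,
    ← ofReal_integral_eq_lintegral_ofReal]
  · congr 1
    rw [← intervalIntegral.integral_of_le hb, integral_rpow (Or.inl (by linarith)),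
      Real.zero_rpow (by linarith), sub_zero, show q - 3 + 1 = q - 2 by ring]
  · rw [← IntegrableOn, ← intervalIntegrable_iff_integrableOn_Ioc_of_le hb]
    exact intervalIntegral.intervalIntegrable_rpow' (by linarith)
  · filter_upwards [ae_restrict_mem measurableSet_Ioc] with l hl
    exact Real.rpow_nonneg hl.1.le _

/-- The Sobolev inequality `‖g‖_q ≤ G ‖|∇|^s g‖₂`, `s = n (1/2 - 1/q)`. -/
theorem sobolev [NeZero n] {q : ℝ} (hq : 2 < q) :
    ∃ G : ℝ, 0 < G ∧ ∀ (g : L2C n) (M : ℝ), 0 < M →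
      weightedNorm ((n : ℝ) / 2 - n / q) (𝓕 g : L2C n) ≤ ENNReal.ofReal M →
      eLpNorm g (ENNReal.ofReal q) volume ≤ ENNReal.ofReal (G * M) := by
  have hn : (0 : ℝ) < n := Nat.cast_pos.2 (NeZero.pos n)
  have hq0 : 0 < q := by linarith
  set β : ℝ := n / q
  have hβ : 0 < β := by positivity
  set s : ℝ := (n : ℝ) / 2 - β
  obtain ⟨c, hc, hlow⟩ := eLpNorm_one_cutoff_le (n := n) (s := s) (by simp only [s]; linarith)
  set K : ℝ := q * (4 * ((2 * c) ^ (q - 2) / (q - 2)))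
  have hK : 0 < K := by
    have : 0 < q - 2 := by linarith
    positivity
  refine ⟨K ^ q⁻¹, by positivity, fun g M hM hW => ?_⟩
  set h : L2C n := 𝓕 g
  have h1 : ∫⁻ x, ‖g x‖ₑ ^ q ≤ ENNReal.ofReal (K * M ^ q) := by
    have e1 : ∀ x, ‖g x‖ₑ ^ q = ENNReal.ofReal (‖g x‖ ^ q) := fun x => by
      rw [← ofReal_norm, ENNReal.ofReal_rpow_of_nonneg (norm_nonneg _) hq0.le]
    simp_rw [e1]
    rw [lintegral_rpow_eq_lintegral_meas_lt_mul volume (Eventually.of_forall fun x => norm_nonneg _)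
      (Lp.aestronglyMeasurable g).norm.aemeasurable hq0]
    -- For each level $l$ the cutoff $A(l)$ below turns $A<|\xi|$ into $l<b(\xi)$. After Tonelli the
    -- integral in $l$ is elementary and produces $|\xi|^{\beta(q-2)}=|\xi|^{2s}$.
    set b : E n → ℝ := fun ξ => 2 * c * M * freq ξ ^ β
    have hbm : Measurable b := (measurable_freq.pow_const β).const_mul _
    have hb0 : ∀ ξ, 0 ≤ b ξ := fun ξ => by have := freq_nonneg ξ; positivity
    have hhm : Measurable fun ξ => ‖h ξ‖ₑ ^ (2 : ℝ) :=
      (Lp.stronglyMeasurable h).measurable.enorm.pow_const _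
    have e2 : ∀ l ∈ Set.Ioi (0 : ℝ), volume {x | l < ‖g x‖} * ENNReal.ofReal (l ^ (q - 1)) ≤
        ∫⁻ ξ, ENNReal.ofReal 4 *
          ((if l < b ξ then ENNReal.ofReal (l ^ (q - 3)) else 0) * ‖h ξ‖ₑ ^ (2 : ℝ)) := by
      intro l (hl : 0 < l)
      -- Chosen so that the low-frequency bound $cA^{\beta}M$ equals $l/2$.
      set A : ℝ := (l / (2 * c * M)) ^ β⁻¹
      have hA : 0 < A := by positivity
      have hAβ : A ^ β = l / (2 * c * M) := Real.rpow_inv_rpow (by positivity) hβ.ne'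
      have e3 := hlow h A M hA hM.le hW
      have e4 : c * A ^ ((n : ℝ) / 2 - s) * M = l / 2 := by
        rw [show (n : ℝ) / 2 - s = β by simp only [s]; ring, hAβ]
        field_simp
      rw [e4] at e3
      have e5 : ∀ ξ : E n, (A < freq ξ) ↔ l < b ξ := by
        intro ξ
        rw [← Real.rpow_lt_rpow_iff hA.le (freq_nonneg ξ) hβ, hAβ, div_lt_iff₀ (by positivity),
          mul_comm]
      refine (mul_le_mul_left (volume_lt_norm_le hl e3) _).trans ?_
      rw [mul_right_comm, ← ENNReal.ofReal_mul (by positivity), ← lintegral_const_mul _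
        (Measurable.ite (measurableSet_lt measurable_const measurable_freq) hhm measurable_const)]
      refine lintegral_mono fun ξ => ?_
      have e6 : 4 * l ^ (-2 : ℝ) * l ^ (q - 1) = 4 * l ^ (q - 3) := by
        rw [mul_assoc, ← Real.rpow_add hl]; congr 2; ring
      simp only [e5]
      rw [e6, ENNReal.ofReal_mul (by norm_num)]
      split_ifs
      · rw [mul_assoc]
      · simp
    refine (mul_le_mul_right (setLIntegral_mono' measurableSet_Ioi e2) _).trans ?_
    have hjm : Measurable fun z : ℝ × E n =>
        if z.1 < b z.2 then ENNReal.ofReal (z.1 ^ (q - 3)) else 0 :=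
      Measurable.ite (measurableSet_lt measurable_fst (hbm.comp measurable_snd))
        (measurable_fst.pow_const _).ennreal_ofReal measurable_const
    rw [lintegral_lintegral_swap]
    swap
    · exact ((hjm.mul (hhm.comp measurable_snd)).const_mul _).aemeasurable
    have e7 : ∀ ξ, ∫⁻ l in Set.Ioi (0 : ℝ), ENNReal.ofReal 4 *
          ((if l < b ξ then ENNReal.ofReal (l ^ (q - 3)) else 0) * ‖h ξ‖ₑ ^ (2 : ℝ)) =
        ENNReal.ofReal (4 * ((2 * c * M) ^ (q - 2) / (q - 2))) *
          ‖((freq ξ ^ s : ℝ) : ℂ) * h ξ‖ₑ ^ (2 : ℝ) := by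
      intro ξ
      have hf := freq_nonneg ξ
      have hm' : Measurable fun l : ℝ => if l < b ξ then ENNReal.ofReal (l ^ (q - 3)) else 0 :=
        hjm.comp measurable_prodMk_right
      rw [lintegral_const_mul _ (hm'.mul_const _), lintegral_mul_const _ hm',
        lintegral_rpow_lt hq (hb0 ξ)]
      have e8 : b ξ ^ (q - 2) = (2 * c * M) ^ (q - 2) * (freq ξ ^ s) ^ (2 : ℝ) := by
        simp only [b]
        rw [Real.mul_rpow (by positivity) (by positivity), ← Real.rpow_mul hf, ← Real.rpow_mul hf]
        congr 2
        simp only [s, β]; field_simp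
      rw [e8, enorm_mul, ENNReal.mul_rpow_of_nonneg _ _ (by norm_num), ← mul_assoc, ← mul_assoc]
      congr 1
      have e9 : ‖((freq ξ ^ s : ℝ) : ℂ)‖ₑ ^ (2 : ℝ) = ENNReal.ofReal ((freq ξ ^ s) ^ (2 : ℝ)) := by
        rw [← ofReal_norm, Complex.norm_real, Real.norm_of_nonneg (by positivity),
          ENNReal.ofReal_rpow_of_nonneg (by positivity) (by norm_num)]
      have : 0 < q - 2 := by linarith
      rw [e9, ← ENNReal.ofReal_mul (by norm_num), ← ENNReal.ofReal_mul (by positivity)]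
      congr 1; ring
    simp_rw [e7]
    have hWm : AEMeasurable (fun ξ => ‖((freq ξ ^ s : ℝ) : ℂ) * h ξ‖ₑ ^ (2 : ℝ)) volume :=
      (aestronglyMeasurable_weight s h).enorm.pow_const _
    rw [lintegral_const_mul'' _ hWm]
    have e10 : ∫⁻ ξ, ‖((freq ξ ^ s : ℝ) : ℂ) * h ξ‖ₑ ^ (2 : ℝ) = weightedNorm s h ^ (2 : ℝ) := by
      rw [weightedNorm, eLpNorm_eq_lintegral_rpow_enorm_toReal (by norm_num) (by norm_num),
        ← ENNReal.rpow_mul]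
      simp
    rw [e10]
    have e11 : weightedNorm s h ^ (2 : ℝ) ≤ ENNReal.ofReal (M ^ (2 : ℝ)) := by
      rw [← ENNReal.ofReal_rpow_of_nonneg hM.le (by norm_num)]
      exact ENNReal.rpow_le_rpow hW (by norm_num)
    refine (mul_le_mul_right (mul_le_mul_right e11 _) _).trans ?_
    have : 0 < q - 2 := by linarith
    rw [← ENNReal.ofReal_mul (by positivity), ← ENNReal.ofReal_mul (by positivity)]
    apply ENNReal.ofReal_le_ofReal (le_of_eq _)
    have e12 : M ^ q = M ^ (q - 2) * M ^ (2 : ℝ) := by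
      rw [← Real.rpow_add hM]; congr 1; ring
    rw [e12, Real.mul_rpow (by positivity) hM.le]
    simp only [K]; ring
  rw [eLpNorm_eq_lintegral_rpow_enorm_toReal (ENNReal.ofReal_pos.2 hq0).ne' ENNReal.ofReal_ne_top,
    ENNReal.toReal_ofReal hq0.le]
  refine (ENNReal.rpow_le_rpow h1 (by positivity)).trans (le_of_eq ?_)
  rw [ENNReal.ofReal_rpow_of_nonneg (by positivity) (by positivity)]
  congr 1
  rw [one_div, Real.mul_rpow hK.le (by positivity), Real.rpow_rpow_inv hM.le hq0.ne']

/-! ### Lipschitz maps and first derivatives -/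

theorem norm_phase_sub_one_le (a ξ : E n) : ‖phase a ξ - 1‖ ≤ ‖a‖ * freq ξ := by
  have h := Real.norm_exp_I_mul_ofReal_sub_one_le (x := 2 * Real.pi * inner ℝ a ξ)
  have h2 : phase a ξ = Complex.exp (Complex.I * ((2 * Real.pi * inner ℝ a ξ : ℝ) : ℂ)) := by
    rw [phase, Real.fourierChar_apply, mul_comm]
  rw [h2]
  refine h.trans ?_
  rw [norm_mul, Real.norm_of_nonneg (by positivity), freq]
  have := norm_inner_le_norm (𝕜 := ℝ) a ξ
  nlinarith [Real.pi_pos]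

theorem norm_mulL2_phase_sub (a : E n) (g : L2C n) :
    ‖translL2 a g - g‖ₑ = eLpNorm (fun ξ => (phase a ξ - 1) * (𝓕 g : L2C n) ξ) 2 volume := by
  have h1 : ‖translL2 a g - g‖ₑ = ‖mulL2 (phase a) (𝓕 g) - (𝓕 g : L2C n)‖ₑ := by
    rw [← fourier_translL2]
    have : (𝓕 (translL2 a g - g) : L2C n) = 𝓕 (translL2 a g) - 𝓕 g :=
      (Lp.fourierTransformₗᵢ (E n) ℂ).map_sub _ _
    rw [← this, ← ofReal_norm, ← ofReal_norm, Lp.norm_fourier_eq]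
  rw [h1, Lp.enorm_def]
  apply eLpNorm_congr_ae
  filter_upwards [(boundedSymbol_phase a).coeFn_mulL2 (𝓕 g : L2C n),
    Lp.coeFn_sub (mulL2 (phase a) (𝓕 g)) (𝓕 g : L2C n)] with ξ h2 h3
  rw [h3, Pi.sub_apply, h2]; ring

theorem enorm_translL2_sub_le (a : E n) (g : L2C n) :
    ‖translL2 a g - g‖ₑ ≤ ENNReal.ofReal ‖a‖ * weightedNorm 1 (𝓕 g : L2C n) := by
  rw [norm_mulL2_phase_sub, weightedNorm]
  refine eLpNorm_le_mul_eLpNorm_of_ae_le_mul (Eventually.of_forall fun ξ => ?_) 2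
  rw [norm_mul, norm_weight, Real.rpow_one, ← mul_assoc]
  exact mul_le_mul_of_nonneg_right (norm_phase_sub_one_le a ξ) (norm_nonneg _)

theorem tendsto_phase_sub_one (e ξ : E n) :
    Tendsto (fun m : ℕ => ((m : ℂ) + 1) * (phase (((m : ℝ) + 1)⁻¹ • e) ξ - 1)) atTop
      (𝓝 ((2 * Real.pi * inner ℝ e ξ : ℝ) * Complex.I)) := by
  set y : ℂ := (2 * Real.pi * inner ℝ e ξ : ℝ) * Complex.I
  have hd : HasDerivAt (fun z : ℂ => Complex.exp (z * y)) y 0 := by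
    simpa using ((hasDerivAt_id (0 : ℂ)).mul_const y).cexp
  have hs := hd.tendsto_slope_zero
  have ht : Tendsto (fun m : ℕ => ((m : ℂ) + 1)⁻¹) atTop (𝓝[≠] 0) := by
    rw [tendsto_nhdsWithin_iff]
    refine ⟨?_, Eventually.of_forall fun m => inv_ne_zero (Nat.cast_add_one_ne_zero m)⟩
    simpa [one_div] using tendsto_one_div_add_atTop_nhds_zero_nat (𝕜 := ℂ)
  refine (hs.comp ht).congr fun m => ?_
  have h2 : phase (((m : ℝ) + 1)⁻¹ • e) ξ = Complex.exp (((m : ℂ) + 1)⁻¹ * y) := by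
    rw [phase, Real.fourierChar_apply, inner_smul_left]
    congr 1
    simp only [y]; push_cast; simp; ring
  simp [h2]

/-- If the difference quotients of `G` are bounded by those of `U`, then so is the gradient. -/
theorem weightedNorm_one_le_of_translL2 {G U : L2C n} {L : ℝ}
    (h : ∀ a, ‖translL2 a G - G‖ₑ ≤ ENNReal.ofReal L * ‖translL2 a U - U‖ₑ) :
    weightedNorm 1 (𝓕 G : L2C n) ≤ ENNReal.ofReal (n * L) * weightedNorm 1 (𝓕 U : L2C n) := by
  set D := ENNReal.ofReal L * weightedNorm 1 (𝓕 U : L2C n)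
  set e : Fin n → E n := fun i => EuclideanSpace.single i 1
  have hm : ∀ i, AEStronglyMeasurable
      (fun ξ : E n => ((2 * Real.pi * inner ℝ (e i) ξ : ℝ) * Complex.I) * (𝓕 G : L2C n) ξ) volume := by
    intro i
    have : Continuous fun ξ : E n => ((2 * Real.pi * inner ℝ (e i) ξ : ℝ) * Complex.I) := by
      fun_prop
    exact this.aestronglyMeasurable.mul (Lp.aestronglyMeasurable _)
  have h1 : ∀ i, eLpNorm (fun ξ : E n =>
      ((2 * Real.pi * inner ℝ (e i) ξ : ℝ) * Complex.I) * (𝓕 G : L2C n) ξ) 2 volume ≤ D := by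
    intro i
    -- Fatou's lemma along the difference quotients with increments $e_i/(m+1)$, each of which is
    -- bounded by $D$.
    refine (Lp.eLpNorm_lim_le_liminf_eLpNorm (p := 2) (f := fun m : ℕ => fun ξ : E n =>
      ((m : ℂ) + 1) * (phase (((m : ℝ) + 1)⁻¹ • e i) ξ - 1) * (𝓕 G : L2C n) ξ) (fun m => ?_) _
      (Eventually.of_forall fun ξ => (tendsto_phase_sub_one (e i) ξ).mul_const _)).trans ?_
    · exact (((boundedSymbol_phase _).meas.sub aestronglyMeasurable_const).const_mul _).mul
        (Lp.aestronglyMeasurable _)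
    refine liminf_le_of_le (by isBoundedDefault) fun b hb => ?_
    obtain ⟨m, hm⟩ := hb.exists
    refine hm.trans ?_
    set a : E n := ((m : ℝ) + 1)⁻¹ • e i
    have h2 : eLpNorm (fun ξ : E n => ((m : ℂ) + 1) * (phase a ξ - 1) * (𝓕 G : L2C n) ξ) 2 volume
        = ENNReal.ofReal (m + 1) * ‖translL2 a G - G‖ₑ := by
      rw [norm_mulL2_phase_sub, ← Real.enorm_of_nonneg (by positivity), ← eLpNorm_const_smul]
      refine eLpNorm_congr_norm_ae (Eventually.of_forall fun ξ => ?_)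
      rw [Pi.smul_apply, norm_smul, mul_assoc, norm_mul]
      congr 1
      have : ((m : ℂ) + 1) = ((m + 1 : ℝ) : ℂ) := by push_cast; rfl
      rw [this, Complex.norm_real]
    rw [h2]
    have h3 : ‖a‖ = ((m : ℝ) + 1)⁻¹ := by
      simp only [a, e]
      rw [norm_smul, PiLp.norm_single]
      simp only [norm_one, mul_one]
      exact Real.norm_of_nonneg (by positivity)
    calc _ ≤ ENNReal.ofReal (m + 1) * (ENNReal.ofReal L *
          (ENNReal.ofReal ((m : ℝ) + 1)⁻¹ * weightedNorm 1 (𝓕 U : L2C n))) := by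
          gcongr
          refine (h a).trans ?_
          gcongr
          rw [← h3]
          exact enorm_translL2_sub_le a U
      _ = (ENNReal.ofReal (m + 1) * ENNReal.ofReal ((m : ℝ) + 1)⁻¹) * D := by
          simp only [D]; ring
      _ = D := by
          rw [← ENNReal.ofReal_mul (by positivity), mul_inv_cancel₀ (by positivity),
            ENNReal.ofReal_one, one_mul]
  -- $|\xi|\le\sum_i|\xi_i|$, so the $n$ directions cost the factor $n$.
  calc weightedNorm 1 (𝓕 G : L2C n) ≤ eLpNorm (fun ξ => ∑ i : Fin n,
        ‖((2 * Real.pi * inner ℝ (e i) ξ : ℝ) * Complex.I) * (𝓕 G : L2C n) ξ‖) 2 volume := by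
        refine eLpNorm_mono_real fun ξ => ?_
        rw [norm_weight, Real.rpow_one]
        simp_rw [norm_mul, Complex.norm_I, mul_one, Complex.norm_real]
        rw [← Finset.sum_mul]
        refine mul_le_mul_of_nonneg_right ?_ (norm_nonneg _)
        rw [freq]
        simp_rw [norm_mul _ (inner ℝ _ _ : ℝ), Real.norm_of_nonneg (show 0 ≤ 2 * Real.pi by positivity)]
        rw [← Finset.mul_sum]
        refine mul_le_mul_of_nonneg_left ?_ (by positivity)
        have h4 : ∀ i, ‖(inner ℝ (e i) ξ : ℝ)‖ = ‖ξ i‖ := fun i => by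
          simp [e, EuclideanSpace.inner_single_left]
        simp_rw [h4]
        have h5 : ξ = ∑ i : Fin n, EuclideanSpace.single i (ξ i) := by
          ext j
          simp [Pi.single_apply]
        calc ‖ξ‖ = ‖∑ i : Fin n, EuclideanSpace.single i (ξ i)‖ := by rw [← h5]
          _ ≤ ∑ i : Fin n, ‖EuclideanSpace.single i (ξ i)‖ := norm_sum_le _ _
          _ = _ := by simp
    _ ≤ ∑ i : Fin n, D := by
        have := eLpNorm_sum_le (μ := volume) (p := 2) (s := Finset.univ) (f := fun (i : Fin n) (ξ : E n) =>
          ‖((2 * Real.pi * inner ℝ (e i) ξ : ℝ) * Complex.I) * (𝓕 G : L2C n) ξ‖)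
          (fun i _ => (hm i).norm) (by norm_num)
        have e1 : (∑ i : Fin n, fun ξ : E n =>
          ‖((2 * Real.pi * inner ℝ (e i) ξ : ℝ) * Complex.I) * (𝓕 G : L2C n) ξ‖) = fun ξ => ∑ i : Fin n,
          ‖((2 * Real.pi * inner ℝ (e i) ξ : ℝ) * Complex.I) * (𝓕 G : L2C n) ξ‖ := by
          ext ξ; simp
        rw [e1] at this
        refine this.trans (Finset.sum_le_sum fun i _ => ?_)
        rw [eLpNorm_norm]
        exact h1 i
    _ = _ := by
        simp only [Finset.sum_const, Finset.card_univ, Fintype.card_fin, nsmul_eq_mul, D]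
        rw [← mul_assoc, ENNReal.ofReal_mul (by positivity), ENNReal.ofReal_natCast]

/-! ### Real and complex `L²` functions -/

theorem memLp_ofReal (w : L2R n) : MemLp (fun x => ((w x : ℝ) : ℂ)) 2 volume :=
  (Lp.memLp w).ofReal

theorem coeFn_cpx (w : L2R n) : cpx w =ᵐ[volume] fun x => ((w x : ℝ) : ℂ) :=
  coeFn_toL2 (memLp_ofReal w)

/-- The inclusion of the real into the complex `L²` functions. -/
def cpxL : L2R n →L[ℝ] L2C n := Complex.ofRealCLM.compLpL 2 volume

theorem cpxL_apply (w : L2R n) : cpxL w = cpx w := by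
  apply Lp.ext
  filter_upwards [ContinuousLinearMap.coeFn_compLpL Complex.ofRealCLM w, coeFn_cpx w] with x h1 h2
  rw [h2]; exact h1

theorem cpx_sub (v w : L2R n) : cpx (v - w) = cpx v - cpx w := by
  rw [← cpxL_apply, map_sub, cpxL_apply, cpxL_apply]

theorem continuous_cpx : Continuous (cpx : L2R n → L2C n) := by
  have : (cpx : L2R n → L2C n) = cpxL := funext fun w => (cpxL_apply w).symm
  rw [this]; exact cpxL.continuous

theorem eLpNorm_cpx (w : L2R n) (q : ℝ≥0∞) : eLpNorm (cpx w) q volume = eLpNorm w q volume := by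
  refine eLpNorm_congr_norm_ae ?_
  filter_upwards [coeFn_cpx w] with x h
  rw [h, Complex.norm_real]

theorem enorm_cpx (w : L2R n) : ‖cpx w‖ₑ = ‖w‖ₑ := by
  rw [Lp.enorm_def, Lp.enorm_def, eLpNorm_cpx]

/-- The real part of an `L²` function. -/
def reL : L2C n →L[ℝ] L2R n := Complex.reCLM.compLpL 2 volume

theorem coeFn_reL (g : L2C n) : reL g =ᵐ[volume] fun x => (g x).re :=
  ContinuousLinearMap.coeFn_compLpL Complex.reCLM g

theorem norm_reL_le (g : L2C n) : ‖reL g‖ ≤ ‖g‖ := by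
  refine Lp.norm_le_norm_of_ae_le ?_
  filter_upwards [coeFn_reL g] with x h
  rw [h]
  exact Complex.abs_re_le_norm _

theorem cpx_reL {g : L2C n} (hg : conjL2 g = g) : cpx (reL g) = g := by
  apply Lp.ext
  have h := coeFn_conjL2 g
  rw [hg] at h
  filter_upwards [coeFn_cpx (reL g), coeFn_reL g, h] with x h1 h2 h3
  rw [h1, h2]
  exact Complex.conj_eq_iff_re.1 h3.symm

theorem conjL2_toL2_ofReal {h : E n → ℝ} (hh : MemLp h 2 volume) :
    conjL2 (toL2 fun x => ((h x : ℝ) : ℂ)) = toL2 fun x => ((h x : ℝ) : ℂ) := by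
  apply Lp.ext
  filter_upwards [coeFn_conjL2 (toL2 fun x => ((h x : ℝ) : ℂ)), coeFn_toL2 (h := fun x => ((h x : ℝ) : ℂ)) hh.ofReal] with x h1 h2
  rw [h1, h2]
  exact Complex.conj_ofReal _

theorem conjL2_cpx (w : L2R n) : conjL2 (cpx w) = cpx w := conjL2_toL2_ofReal (Lp.memLp w)

theorem reflL2_eq (g : L2C n) : reflL2 g = 𝓕⁻ (𝓕⁻ g : L2C n) := by
  rw [fourierInv_eq_reflL2 (𝓕⁻ g), fourier_fourierInv_eq]

theorem conjL2_mulL2_radial {m : ℝ → ℝ} {B : ℝ} (hm : BoundedSymbol (radial m : E n → ℂ) B)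
    (g : L2C n) : conjL2 (mulL2 (radial m) g) = mulL2 (radial m) (conjL2 g) := by
  apply Lp.ext
  filter_upwards [coeFn_conjL2 (mulL2 (radial m) g), hm.coeFn_mulL2 g, hm.coeFn_mulL2 (conjL2 g),
    coeFn_conjL2 g] with ξ h1 h2 h3 h4
  rw [h1, h2, h3, h4, map_mul, radial, Complex.conj_ofReal]

theorem reflL2_mulL2_radial {m : ℝ → ℝ} {B : ℝ} (hm : BoundedSymbol (radial m : E n → ℂ) B)
    (g : L2C n) : reflL2 (mulL2 (radial m) g) = mulL2 (radial m) (reflL2 g) := by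
  apply Lp.ext
  have h := (Measure.measurePreserving_neg (volume : Measure (E n))).quasiMeasurePreserving.ae
    (hm.coeFn_mulL2 g)
  filter_upwards [coeFn_reflL2 (mulL2 (radial m) g), h, hm.coeFn_mulL2 (reflL2 g),
    coeFn_reflL2 g] with ξ h1 h2 h3 h4
  rw [h1, h2, h3, h4]
  simp [radial, freq]

/-- Fourier multipliers with real radial symbols preserve real functions. -/
theorem conjL2_multiplier {m : ℝ → ℝ} {B : ℝ} (hm : BoundedSymbol (radial m : E n → ℂ) B)
    (g : L2C n) : conjL2 (multiplier m g) = multiplier m (conjL2 g) := by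
  -- Conjugation exchanges the transform and its inverse. These differ by a reflection, which
  -- commutes with multiplication by radial functions.
  rw [multiplier_eq, multiplier_eq, conjL2_fourierInv, conjL2_mulL2_radial hm, conjL2_fourier,
    fourierInv_eq_reflL2, ← reflL2_mulL2_radial hm, reflL2_eq, fourier_fourierInv_eq]

/-! ### Estimates for the nonlinearity -/

/-- Mean value inequality on the segment from $s$ to $t$: there $|x|\le\max(|s|,|t|)$, and the
larger of the two powers is at most their sum. -/
theorem PowerType.exists_bound {p : ℝ} (hp : 1 < p) {f : ℝ → ℝ} (hf : PowerType p f) :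
    ∃ A : ℝ, 0 ≤ A ∧ (∀ s, |f s| ≤ A * |s| ^ p) ∧
      ∀ s t, |f s - f t| ≤ A * (|s| ^ (p - 1) + |t| ^ (p - 1)) * |s - t| := by
  obtain ⟨hc, A, hA⟩ := hf
  have hA0 : 0 ≤ A := by simpa using (abs_nonneg _).trans (hA 1).1
  refine ⟨A, hA0, fun s => (hA s).1, fun s t => ?_⟩
  have hd : Differentiable ℝ f := hc.differentiable (by norm_num)
  have h := (convex_uIcc s t).norm_image_sub_le_of_norm_deriv_le (f := f)
    (C := A * (|s| ^ (p - 1) + |t| ^ (p - 1))) (fun x _ => hd x) (fun x hx => ?_)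
    (Set.right_mem_uIcc) (Set.left_mem_uIcc)
  · simpa using h
  · refine (hA x).2.1.trans (mul_le_mul_of_nonneg_left ?_ hA0)
    have hx' : |x| ≤ max |s| |t| := by
      rcases Set.mem_uIcc.1 hx with h | h
      · exact abs_le_max_abs_abs h.1 h.2
      · rw [max_comm]; exact abs_le_max_abs_abs h.1 h.2
    have hs : 0 ≤ |s| ^ (p - 1) := by positivity
    have ht : 0 ≤ |t| ^ (p - 1) := by positivity
    rcases le_max_iff.1 hx' with h | h
    · have := Real.rpow_le_rpow (abs_nonneg x) h (show 0 ≤ p - 1 by linarith)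
      linarith
    · have := Real.rpow_le_rpow (abs_nonneg x) h (show 0 ≤ p - 1 by linarith)
      linarith

section Nonlinear

variable {p A : ℝ} {f : ℝ → ℝ}

theorem aestronglyMeasurable_comp_L2R (hfc : Continuous f) (w : L2R n) :
    AEStronglyMeasurable (fun x => f (w x)) volume :=
  hfc.comp_aestronglyMeasurable (Lp.aestronglyMeasurable w)

theorem eLpNorm_comp_le (hp : 0 < p) (h : ∀ s, |f s| ≤ A * |s| ^ p)
    (w : L2R n) (r : ℝ≥0∞) : eLpNorm (fun x => f (w x)) r volume ≤
      ENNReal.ofReal A * eLpNorm w (r * ENNReal.ofReal p) volume ^ p := by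
  rw [← eLpNorm_norm_rpow _ hp]
  refine eLpNorm_le_mul_eLpNorm_of_ae_le_mul (Eventually.of_forall fun x => ?_) r
  rw [Real.norm_eq_abs, Real.norm_of_nonneg (by positivity)]
  exact h _

/-- Hölder's inequality. The exponents $(a,b,r)=(2,2,1)$ serve contraction and uniqueness, and
$(\frac{2p}{p-1},2p,2)$ serves continuity of the superposition in $L^2$. -/
theorem eLpNorm_comp_sub_le (hp : 1 < p) (hA : 0 ≤ A)
    (h : ∀ s t, |f s - f t| ≤ A * (|s| ^ (p - 1) + |t| ^ (p - 1)) * |s - t|)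
    (v w : L2R n) (a b r : ℝ≥0∞) (ha : 1 ≤ a) [ENNReal.HolderTriple a b r] :
    eLpNorm (fun x => f (v x) - f (w x)) r volume ≤
      ENNReal.ofReal A * (eLpNorm v (a * ENNReal.ofReal (p - 1)) volume ^ (p - 1) +
        eLpNorm w (a * ENNReal.ofReal (p - 1)) volume ^ (p - 1)) * eLpNorm (v - w : L2R n) b volume := by
  have hp1 : 0 < p - 1 := by linarith
  have hv : AEStronglyMeasurable (fun x => ‖v x‖ ^ (p - 1)) volume :=
    ((Lp.stronglyMeasurable v).norm.measurable.pow_const _).aestronglyMeasurable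
  have hw : AEStronglyMeasurable (fun x => ‖w x‖ ^ (p - 1)) volume :=
    ((Lp.stronglyMeasurable w).norm.measurable.pow_const _).aestronglyMeasurable
  set φ : E n → ℝ := fun x => A * (‖v x‖ ^ (p - 1) + ‖w x‖ ^ (p - 1))
  have hφ : AEStronglyMeasurable φ volume := (hv.add hw).const_mul A
  calc _ ≤ eLpNorm (φ • ((v - w : L2R n) : E n → ℝ)) r volume := by
        refine eLpNorm_mono_ae ?_
        filter_upwards [Lp.coeFn_sub v w] with x hx
        rw [Pi.smul_apply', hx, Pi.sub_apply, norm_smul, Real.norm_eq_abs,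
          Real.norm_of_nonneg (by simp only [φ]; positivity)]
        exact h _ _
    _ ≤ eLpNorm φ a volume * eLpNorm (v - w : L2R n) b volume :=
        eLpNorm_smul_le_mul_eLpNorm (Lp.aestronglyMeasurable _) hφ
    _ ≤ _ := by
        gcongr
        have : φ = A • ((fun x => ‖v x‖ ^ (p - 1)) + fun x => ‖w x‖ ^ (p - 1)) := rfl
        rw [this, eLpNorm_const_smul, Real.enorm_of_nonneg hA]
        gcongr
        refine (eLpNorm_add_le hv hw ha).trans_eq ?_
        rw [eLpNorm_norm_rpow _ hp1, eLpNorm_norm_rpow _ hp1]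

end Nonlinear

/-- The Gagliardo-Nirenberg inequality in scaled form, in dimensions one and two. -/
theorem gagliardo_nirenberg [NeZero n] (hn : n ≤ 2) {q : ℝ} (hq : 2 < q) :
    ∃ G : ℝ, 0 < G ∧ ∀ (w : L2R n) (l M : ℝ), 0 < l → 0 < M →
      ‖w‖ₑ + ENNReal.ofReal l * fracGradNorm 1 w ≤ ENNReal.ofReal M →
      eLpNorm w (ENNReal.ofReal q) volume ≤
        ENNReal.ofReal (G * (l ^ (-((n : ℝ) / 2 - n / q)) * M)) := by
  obtain ⟨G, hG, hS⟩ := sobolev (n := n) hq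
  refine ⟨G, hG, fun w l M hl hM h => ?_⟩
  have hn2 : (n : ℝ) ≤ 2 := by exact_mod_cast hn
  have hn0 : (0 : ℝ) < n := Nat.cast_pos.2 (NeZero.pos n)
  set s : ℝ := (n : ℝ) / 2 - n / q
  have hs0 : 0 ≤ s := by
    have : (n : ℝ) / q ≤ n / 2 := by gcongr
    simp only [s]; linarith
  have hs1 : s ≤ 1 := by
    have : 0 ≤ (n : ℝ) / q := by positivity
    simp only [s]; linarith
  have h1 := rpow_mul_weightedNorm_le hs0 hs1 hl.le (𝓕 (cpx w) : L2C n)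
  have h2 : ‖(𝓕 (cpx w) : L2C n)‖ₑ = ‖w‖ₑ := by
    rw [← enorm_cpx w, ← ofReal_norm, ← ofReal_norm, Lp.norm_fourier_eq]
  rw [h2, Real.rpow_one] at h1
  rw [← eLpNorm_cpx]
  refine hS (cpx w) _ (by positivity) ?_
  have h3 := h1.trans h
  calc _ = ENNReal.ofReal (l ^ (-s)) *
        (ENNReal.ofReal (l ^ s) * weightedNorm s (𝓕 (cpx w) : L2C n)) := by
        rw [← mul_assoc, ← ENNReal.ofReal_mul (by positivity), ← Real.rpow_add hl]
        simp
    _ ≤ ENNReal.ofReal (l ^ (-s)) * ENNReal.ofReal M := by gcongr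
    _ = _ := (ENNReal.ofReal_mul (by positivity)).symm

/-- `w` has the size, in `H¹`, of a solution of the heat equation at time `t`. -/
def HeatBound (ρ t : ℝ) (w : L2R n) : Prop :=
  ‖w‖ₑ ≤ ENNReal.ofReal (ρ * (1 + t) ^ (-((n : ℝ) / 4))) ∧
    fracGradNorm 1 w ≤ ENNReal.ofReal (ρ * (1 + t) ^ (-((n : ℝ) / 4) - 1 / 2))

/-- At the scale $l=(1+t)^{1/2}$ the two terms of the Gagliardo-Nirenberg inequality have equal
size. The resulting rate is that of the heat kernel in $L^q$. -/
theorem eLpNorm_le_of_heatBound [NeZero n] (hn : n ≤ 2) {q : ℝ} (hq : 2 < q) :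
    ∃ G : ℝ, 0 < G ∧ ∀ (w : L2R n) (ρ t : ℝ), 0 < ρ → 0 ≤ t → HeatBound ρ t w →
      eLpNorm w (ENNReal.ofReal q) volume ≤
        ENNReal.ofReal (G * ρ * (1 + t) ^ (-((n : ℝ) / 2 * (1 - 1 / q)))) := by
  obtain ⟨G, hG, h⟩ := gagliardo_nirenberg hn hq
  refine ⟨2 * G, by positivity, fun w ρ t hρ ht hw => ?_⟩
  have ht1 : 0 < 1 + t := by linarith
  refine (h w ((1 + t) ^ (1 / 2 : ℝ)) (2 * (ρ * (1 + t) ^ (-((n : ℝ) / 4)))) (by positivity)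
    (by positivity) ?_).trans_eq ?_
  · rw [two_mul, ENNReal.ofReal_add (by positivity) (by positivity)]
    refine add_le_add hw.1 ((mul_le_mul_right hw.2 _).trans_eq ?_)
    rw [← ENNReal.ofReal_mul (by positivity), mul_left_comm, ← Real.rpow_add ht1]
    congr 3; ring
  · congr 1
    have : (1 + t) ^ (-((n : ℝ) / 2 * (1 - 1 / q))) =
        ((1 + t) ^ (1 / 2 : ℝ)) ^ (-((n : ℝ) / 2 - n / q)) * (1 + t) ^ (-((n : ℝ) / 4)) := by
      rw [← Real.rpow_mul ht1.le, ← Real.rpow_add ht1]; congr 1; ring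
    rw [this]; ring

/-! ### The nonlinearity on functions of heat kernel size -/

theorem coeFn_superpose {f : ℝ → ℝ} {w : L2R n} (h : MemLp (fun x => f (w x)) 2 volume) :
    superpose f w =ᵐ[volume] fun x => ((f (w x) : ℝ) : ℂ) :=
  coeFn_toL2 (h := fun x => ((f (w x) : ℝ) : ℂ)) h.ofReal

theorem conjL2_superpose {f : ℝ → ℝ} {w : L2R n} (h : MemLp (fun x => f (w x)) 2 volume) :
    conjL2 (superpose f w) = superpose f w := conjL2_toL2_ofReal h

theorem eLpNorm_superpose {f : ℝ → ℝ} {w : L2R n} (h : MemLp (fun x => f (w x)) 2 volume)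
    (r : ℝ≥0∞) : eLpNorm (superpose f w) r volume = eLpNorm (fun x => f (w x)) r volume := by
  refine eLpNorm_congr_norm_ae ?_
  filter_upwards [coeFn_superpose h] with x hx
  rw [hx, Complex.norm_real]

theorem eLpNorm_superpose_sub {f : ℝ → ℝ} {v w : L2R n}
    (hv : MemLp (fun x => f (v x)) 2 volume) (hw : MemLp (fun x => f (w x)) 2 volume)
    (r : ℝ≥0∞) : eLpNorm (superpose f v - superpose f w : L2C n) r volume =
      eLpNorm (fun x => f (v x) - f (w x)) r volume := by
  refine eLpNorm_congr_norm_ae ?_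
  filter_upwards [coeFn_superpose hv, coeFn_superpose hw,
    Lp.coeFn_sub (superpose f v) (superpose f w)] with x h1 h2 h3
  rw [h3, Pi.sub_apply, h1, h2, ← Complex.ofReal_sub, Complex.norm_real]

theorem ae_norm_fourier_le {g : L2C n} {N : ℝ} (hN : 0 ≤ N)
    (h : eLpNorm g 1 volume ≤ ENNReal.ofReal N) : ∀ᵐ ξ, ‖(𝓕 g : L2C n) ξ‖ ≤ N := by
  filter_upwards [enorm_fourier_le g] with ξ hξ
  have := hξ.trans h
  rwa [← ofReal_norm, ENNReal.ofReal_le_ofReal_iff hN] at this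

theorem fracGradNorm_sub_le (k : ℝ) (v w : L2R n) :
    fracGradNorm k (v - w) ≤ fracGradNorm k v + fracGradNorm k w := by
  have : (𝓕 (cpx (v - w)) : L2C n) = 𝓕 (cpx v) - 𝓕 (cpx w) := by
    rw [cpx_sub]; exact (Lp.fourierTransformₗᵢ (E n) ℂ).map_sub _ _
  rw [fracGradNorm_eq, this]
  exact weightedNorm_sub_le k _ _

theorem heatBound_zero_iff {B : ℝ} {w : L2R n} :
    HeatBound B 0 w ↔ ‖w‖ₑ ≤ ENNReal.ofReal B ∧ fracGradNorm 1 w ≤ ENNReal.ofReal B := by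
  simp [HeatBound]

section Bounds

variable [NeZero n] {p : ℝ} {f : ℝ → ℝ}

/-- The norms of $f(w)$ in $L^1$ and $L^2$ are controlled by those of $w$ in $L^p$ and $L^{2p}$;
both exponents exceed 2 since $p>2$. The $L^1$ bound is recorded as a sup bound on the Fourier side,
the form in which the propagator estimates use it. -/
theorem superpose_bounds (hn : n ≤ 2) (hp : 2 < p) (hf : PowerType p f) :
    ∃ C : ℝ, 0 < C ∧ ∀ (w : L2R n) (ρ t : ℝ), 0 < ρ → 0 ≤ t → HeatBound ρ t w →
      MemLp (fun x => f (w x)) 2 volume ∧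
      (∀ᵐ ξ, ‖(𝓕 (superpose f w) : L2C n) ξ‖ ≤
        C * ρ ^ p * (1 + t) ^ (-((n : ℝ) / 2 * (p - 1)))) ∧
      ‖superpose f w‖ₑ ≤
        ENNReal.ofReal (C * ρ ^ p * (1 + t) ^ (-((n : ℝ) / 2 * (p - 1)) - n / 4)) := by
  obtain ⟨A, hA, hA1, -⟩ := hf.exists_bound (by linarith)
  obtain ⟨G₁, hG₁, h₁⟩ := eLpNorm_le_of_heatBound hn (q := p) hp
  obtain ⟨G₂, hG₂, h₂⟩ := eLpNorm_le_of_heatBound hn (q := 2 * p) (by linarith)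
  have hp0 : 0 < p := by linarith
  have key : ∀ (w : L2R n) (r : ℝ≥0∞) (q G ρ t : ℝ), 0 < q → 0 < G → 0 < ρ → 0 ≤ t →
      r * ENNReal.ofReal p = ENNReal.ofReal q → eLpNorm w (ENNReal.ofReal q) volume ≤
        ENNReal.ofReal (G * ρ * (1 + t) ^ (-((n : ℝ) / 2 * (1 - 1 / q)))) →
      eLpNorm (fun x => f (w x)) r volume ≤ ENNReal.ofReal
        (A * G ^ p * ρ ^ p * (1 + t) ^ (-((n : ℝ) / 2 * (p - p / q)))) := by
    intro w r q G ρ t hq hG hρ ht hr h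
    have ht1 : 0 < 1 + t := by linarith
    refine (eLpNorm_comp_le hp0 hA1 w r).trans ?_
    rw [hr]
    refine (mul_le_mul_right (ENNReal.rpow_le_rpow h hp0.le) _).trans_eq ?_
    rw [ENNReal.ofReal_rpow_of_nonneg (by positivity) hp0.le, ← ENNReal.ofReal_mul hA,
      Real.mul_rpow (by positivity) (by positivity), Real.mul_rpow hG.le hρ.le,
      ← Real.rpow_mul ht1.le]
    congr 1
    rw [show -((n : ℝ) / 2 * (p - p / q)) = -((n : ℝ) / 2 * (1 - 1 / q)) * p by ring]
    ring
  refine ⟨A * G₁ ^ p + A * G₂ ^ p + 1, by positivity, fun w ρ t hρ ht hw => ?_⟩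
  have ht1 : 0 < 1 + t := by linarith
  have e1 := key w 1 p G₁ ρ t hp0 hG₁ hρ ht (one_mul _) (h₁ w ρ t hρ ht hw)
  have e2 := key w 2 (2 * p) G₂ ρ t (by linarith) hG₂ hρ ht
    (by rw [ENNReal.ofReal_mul (by norm_num)]; simp) (h₂ w ρ t hρ ht hw)
  have hm : MemLp (fun x => f (w x)) 2 volume :=
    ⟨aestronglyMeasurable_comp_L2R hf.1.continuous w, e2.trans_lt ENNReal.ofReal_lt_top⟩
  refine ⟨hm, ?_, ?_⟩
  · rw [← eLpNorm_superpose hm, div_self hp0.ne'] at e1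
    have hA1 : 0 ≤ A * G₁ ^ p := by positivity
    filter_upwards [ae_norm_fourier_le (by positivity) e1] with ξ hξ
    refine hξ.trans ?_
    gcongr
    have : 0 ≤ A * G₂ ^ p := by positivity
    linarith
  · rw [Lp.enorm_def, eLpNorm_superpose hm]
    refine e2.trans (ENNReal.ofReal_le_ofReal ?_)
    rw [show -((n : ℝ) / 2 * (p - 1)) - n / 4 = -((n : ℝ) / 2 * (p - p / (2 * p))) by
      field_simp; ring]
    gcongr
    have : 0 ≤ A * G₁ ^ p := by positivity
    linarith

/-- The difference enters only through its $L^2$ norm, while the remaining factor uses the decay of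
$v$ and $w$ in $L^{2(p-1)}$. Hence contraction and uniqueness can be run in $L^2$. -/
theorem superpose_sub_bound (hn : n ≤ 2) (hp : 2 < p) (hf : PowerType p f) :
    ∃ C : ℝ, 0 < C ∧ ∀ (v w : L2R n) (ρ t : ℝ), 0 < ρ → 0 ≤ t → HeatBound ρ t v →
      HeatBound ρ t w → ∀ᵐ ξ, ‖(𝓕 (superpose f v - superpose f w) : L2C n) ξ‖ ≤
        C * ρ ^ (p - 1) * (1 + t) ^ (-((n : ℝ) / 2 * (p - 1) - n / 4)) * ‖v - w‖ := by
  obtain ⟨A, hA, hA1, hA2⟩ := hf.exists_bound (by linarith)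
  obtain ⟨G, hG, h⟩ := eLpNorm_le_of_heatBound hn (q := 2 * (p - 1)) (by linarith)
  obtain ⟨C', -, hm⟩ := superpose_bounds hn hp hf
  have hp1 : 0 < p - 1 := by linarith
  refine ⟨2 * A * G ^ (p - 1) + 1, by positivity, fun v w ρ t hρ ht hv hw => ?_⟩
  have ht1 : 0 < 1 + t := by linarith
  have key : ∀ u : L2R n, HeatBound ρ t u →
      eLpNorm u (2 * ENNReal.ofReal (p - 1)) volume ^ (p - 1) ≤ ENNReal.ofReal
        (G ^ (p - 1) * ρ ^ (p - 1) * (1 + t) ^ (-((n : ℝ) / 2 * (p - 1) - n / 4))) := by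
    intro u hu
    have e := h u ρ t hρ ht hu
    rw [ENNReal.ofReal_mul (by norm_num), ENNReal.ofReal_ofNat] at e
    refine (ENNReal.rpow_le_rpow e hp1.le).trans_eq ?_
    rw [ENNReal.ofReal_rpow_of_nonneg (by positivity) hp1.le,
      Real.mul_rpow (by positivity) (by positivity), Real.mul_rpow hG.le hρ.le,
      ← Real.rpow_mul ht1.le]
    congr 3
    field_simp; ring
  have e1 := eLpNorm_comp_sub_le (by linarith : 1 < p) hA hA2 v w 2 2 1 (by norm_num)
  rw [← eLpNorm_superpose_sub (hm v ρ t hρ ht hv).1 (hm w ρ t hρ ht hw).1, ← Lp.enorm_def,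
    ← ofReal_norm] at e1
  have hX : 0 ≤ G ^ (p - 1) * ρ ^ (p - 1) * (1 + t) ^ (-((n : ℝ) / 2 * (p - 1) - n / 4)) := by
    positivity
  have e2 := e1.trans (mul_le_mul_left (mul_le_mul_right (add_le_add (key v hv) (key w hw)) _) _)
  rw [← ENNReal.ofReal_add hX hX, ← ENNReal.ofReal_mul hA, ← ENNReal.ofReal_mul (by positivity)] at e2
  filter_upwards [ae_norm_fourier_le (by positivity) e2] with ξ hξ
  refine hξ.trans (mul_le_mul_of_nonneg_right ?_ (norm_nonneg _))
  have : 0 ≤ ρ ^ (p - 1) * (1 + t) ^ (-((n : ℝ) / 2 * (p - 1) - n / 4)) := by positivity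
  linarith

/-- The superposition operator is continuous for `L²` convergence on bounded sets of `H¹`. -/
theorem tendsto_superpose (hn : n ≤ 2) (hp : 2 < p) (hf : PowerType p f) {ι : Type*}
    {l : Filter ι} {u : ι → L2R n} {w : L2R n} {B : ℝ} (hB : 0 < B)
    (hu : ∀ᶠ i in l, HeatBound B 0 (u i)) (hw : HeatBound B 0 w) (h : Tendsto u l (𝓝 w)) :
    Tendsto (fun i => superpose f (u i)) l (𝓝 (superpose f w)) := by
  obtain ⟨A, hA, -, hA2⟩ := hf.exists_bound (by linarith)
  have hp1 : 0 < p - 1 := by linarith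
  have hp0 : 0 < p := by linarith
  obtain ⟨G, hG, hGN⟩ := gagliardo_nirenberg hn (q := 2 * p) (by linarith)
  obtain ⟨G', hG', hb⟩ := eLpNorm_le_of_heatBound hn (q := 2 * p) (by linarith)
  obtain ⟨C', -, hm⟩ := superpose_bounds hn hp hf
  set s : ℝ := (n : ℝ) / 2 - n / (2 * p)
  have hs1 : s < 1 := by
    have hn2 : (n : ℝ) ≤ 2 := by exact_mod_cast hn
    have hn0 : (0 : ℝ) < n := Nat.cast_pos.2 (NeZero.pos n)
    have : 0 < (n : ℝ) / (2 * p) := by positivity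
    simp only [s]; linarith
  set D : ℝ := A * (2 * (G' * B) ^ (p - 1)) * (G * (3 * B))
  -- Once $\|u_i-w\|_2<rB$, interpolation with the $H^1$ bound at scale $r$ makes the $L^{2p}$ norm
  -- of the difference $O(r^{1-s})$; since $s<1$, letting $r\to0$ gives the limit.
  have key : ∀ r : ℝ, 0 < r → ∀ᶠ i in l,
      ‖superpose f (u i) - superpose f w‖ ≤ D * r ^ (1 - s) := by
    intro r hr
    have hclose : ∀ᶠ i in l, ‖u i - w‖ < r * B := by
      have := (tendsto_iff_norm_sub_tendsto_zero.1 h).eventually (gt_mem_nhds (show 0 < r * B by positivity))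
      exact this
    filter_upwards [hu, hclose] with i hi hc
    -- $\frac{p-1}{2p}+\frac1{2p}=\frac12$.
    have hid : (ENNReal.ofReal (2 * p / (p - 1))).HolderTriple (ENNReal.ofReal (2 * p)) 2 := by
      constructor
      rw [← ENNReal.ofReal_inv_of_pos (by positivity), ← ENNReal.ofReal_inv_of_pos (by positivity),
        ← ENNReal.ofReal_add (by positivity) (by positivity), ← ENNReal.ofReal_ofNat 2,
        ← ENNReal.ofReal_inv_of_pos (by norm_num)]
      congr 1
      field_simp; ring
    have e1 := eLpNorm_comp_sub_le (by linarith : 1 < p) hA hA2 (u i) w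
      (ENNReal.ofReal (2 * p / (p - 1))) (ENNReal.ofReal (2 * p)) 2 (by
        rw [← ENNReal.ofReal_one]
        apply ENNReal.ofReal_le_ofReal
        rw [le_div_iff₀ hp1]; linarith)
    rw [← eLpNorm_superpose_sub (hm _ B 0 hB le_rfl hi).1 (hm w B 0 hB le_rfl hw).1,
      ← Lp.enorm_def, ← ofReal_norm, ← ENNReal.ofReal_mul (by positivity),
      div_mul_cancel₀ _ hp1.ne'] at e1
    have e2 : ∀ v : L2R n, HeatBound B 0 v → eLpNorm v (ENNReal.ofReal (2 * p)) volume ^ (p - 1) ≤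
        ENNReal.ofReal ((G' * B) ^ (p - 1)) := by
      intro v hv
      have := hb v B 0 hB le_rfl hv
      rw [add_zero, Real.one_rpow, mul_one] at this
      rw [← ENNReal.ofReal_rpow_of_nonneg (by positivity) hp1.le]
      exact ENNReal.rpow_le_rpow this hp1.le
    have e3 : eLpNorm (u i - w : L2R n) (ENNReal.ofReal (2 * p)) volume ≤
        ENNReal.ofReal (G * (r ^ (-s) * (3 * r * B))) := by
      refine hGN (u i - w) r _ hr (by positivity) ?_
      rw [heatBound_zero_iff] at hi hw
      calc _ ≤ ENNReal.ofReal (r * B) + ENNReal.ofReal r * (ENNReal.ofReal B + ENNReal.ofReal B) := by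
            gcongr
            · rw [← ofReal_norm]; exact ENNReal.ofReal_le_ofReal hc.le
            · exact (fracGradNorm_sub_le 1 _ _).trans (add_le_add hi.2 hw.2)
        _ = _ := by
            rw [← ENNReal.ofReal_add hB.le hB.le, ← ENNReal.ofReal_mul hr.le,
              ← ENNReal.ofReal_add (by positivity) (by positivity)]
            congr 1; ring
    have hX : 0 ≤ (G' * B) ^ (p - 1) := by positivity
    have e4 := e1.trans (mul_le_mul' (mul_le_mul_right (add_le_add (e2 _ hi) (e2 _ hw)) _) e3)
    rw [← ENNReal.ofReal_add hX hX, ← ENNReal.ofReal_mul hA, ← ENNReal.ofReal_mul (by positivity),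
      ENNReal.ofReal_le_ofReal_iff (by positivity)] at e4
    refine e4.trans_eq ?_
    have e5 : r ^ (1 - s) = r ^ (-s) * r := by
      rw [show 1 - s = -s + 1 by ring, Real.rpow_add hr, Real.rpow_one]
    rw [e5]; simp only [D]; ring
  rw [tendsto_iff_norm_sub_tendsto_zero, Metric.tendsto_nhds]
  intro ε hε
  have hlim : Tendsto (fun r : ℝ => D * r ^ (1 - s)) (𝓝[>] 0) (𝓝 0) := by
    have : Tendsto (fun r : ℝ => D * r ^ (1 - s)) (𝓝 0) (𝓝 (D * 0 ^ (1 - s))) :=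
      ((Real.continuousAt_rpow_const 0 (1 - s) (Or.inr (by linarith))).tendsto).const_mul D
    rw [Real.zero_rpow (by linarith), mul_zero] at this
    exact this.mono_left nhdsWithin_le_nhds
  obtain ⟨r, hr1, hr2⟩ := ((hlim.eventually (gt_mem_nhds hε)).and self_mem_nhdsWithin).exists
  filter_upwards [key r hr2] with i hi
  rw [dist_zero_right, norm_norm]
  exact hi.trans_lt hr1

end Bounds

/-- The chain rule estimate `‖∇ f(w)‖₂ ≤ C ‖w‖_∞^{p-1} ‖∇ w‖₂`. -/
theorem weightedNorm_one_superpose_le {p : ℝ} (hp : 1 < p) {f : ℝ → ℝ} (hf : PowerType p f) :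
    ∃ C : ℝ, 0 ≤ C ∧ ∀ (w : L2R n) (m : ℝ), 0 ≤ m → (∀ᵐ x, ‖w x‖ ≤ m) →
      MemLp (fun x => f (w x)) 2 volume →
      weightedNorm 1 (𝓕 (superpose f w) : L2C n) ≤
        ENNReal.ofReal (C * m ^ (p - 1)) * fracGradNorm 1 w := by
  obtain ⟨A, hA, -, hA2⟩ := hf.exists_bound hp
  refine ⟨n * (2 * A), by positivity, fun w m hm hwm hmem => ?_⟩
  have hp1 : 0 ≤ p - 1 := by linarith
  -- $2Am^{p-1}$ is a Lipschitz constant of $f$ on $[-m,m]$, which contains almost all values of $w$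
  -- and of its translates.
  have h := weightedNorm_one_le_of_translL2 (G := superpose f w) (U := cpx w)
    (L := A * (2 * m ^ (p - 1))) (fun a => ?_)
  · rw [fracGradNorm_eq]
    convert h using 2
    congr 1; ring
  · rw [Lp.enorm_def, Lp.enorm_def]
    refine eLpNorm_le_mul_eLpNorm_of_ae_le_mul ?_ 2
    have hq := (measurePreserving_add_right (volume : Measure (E n)) a).quasiMeasurePreserving
    filter_upwards [coeFn_translL2 a (superpose f w), coeFn_translL2 a (cpx w),
      Lp.coeFn_sub (translL2 a (superpose f w)) (superpose f w),
      Lp.coeFn_sub (translL2 a (cpx w)) (cpx w), coeFn_superpose hmem, coeFn_cpx w,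
      hq.ae (coeFn_superpose hmem), hq.ae (coeFn_cpx w), hwm, hq.ae hwm]
      with x h1 h2 h3 h4 h5 h6 h7 h8 h9 h10
    rw [h3, h4, Pi.sub_apply, Pi.sub_apply, h1, h2, h5, h6, h7, h8, ← Complex.ofReal_sub,
      ← Complex.ofReal_sub, Complex.norm_real, Complex.norm_real]
    refine (hA2 _ _).trans (mul_le_mul_of_nonneg_right (mul_le_mul_of_nonneg_left ?_ hA)
      (abs_nonneg _))
    rw [two_mul]
    gcongr
    · exact h10
    · exact h9

/-- Fourier inversion bounds $\|w\|_\infty$ by $\|\hat w\|_1$, and the weight $k>n/2$ makes the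
latter finite. -/
theorem ae_norm_le_of_fracGradNorm {k : ℝ} (hk : (n : ℝ) < 2 * k) :
    ∃ G : ℝ, 0 ≤ G ∧ ∀ (w : L2R n) (l M : ℝ), 0 < l → 0 ≤ M →
      ‖w‖ₑ + ENNReal.ofReal (l ^ k) * fracGradNorm k w ≤ ENNReal.ofReal M →
      ∀ᵐ x, ‖w x‖ ≤ G * l ^ (-((n : ℝ) / 2)) * M := by
  obtain ⟨G, hG, h⟩ := eLpNorm_one_le (n := n) hk
  refine ⟨G, hG, fun w l M hl hM hw => ?_⟩
  have h1 := h (𝓕 (cpx w)) l hl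
  have h2 : ‖(𝓕 (cpx w) : L2C n)‖ₑ = ‖w‖ₑ := by
    rw [← enorm_cpx w, ← ofReal_norm, ← ofReal_norm, Lp.norm_fourier_eq]
  rw [h2] at h1
  have h3 := h1.trans (mul_le_mul_right hw _)
  rw [← ENNReal.ofReal_mul (by positivity)] at h3
  have h4 := enorm_fourierInv_le (𝓕 (cpx w) : L2C n)
  rw [fourierInv_fourier_eq] at h4
  filter_upwards [h4, coeFn_cpx w] with x h5 h6
  have h7 := h5.trans h3
  rwa [← ofReal_norm, ENNReal.ofReal_le_ofReal_iff (by positivity), h6, Complex.norm_real] at h7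

/-! ### Time integrals -/

theorem intervalIntegrable_one_add_rpow {t : ℝ} (ht : 0 ≤ t) (a : ℝ) :
    IntervalIntegrable (fun τ => (1 + τ) ^ a) volume 0 t := by
  refine ContinuousOn.intervalIntegrable fun τ hτ => ?_
  rw [Set.uIcc_of_le ht] at hτ
  exact (ContinuousAt.rpow_const (by fun_prop) (Or.inl (by linarith [hτ.1]))).continuousWithinAt

theorem intervalIntegrable_one_add_sub_rpow {t : ℝ} (ht : 0 ≤ t) (a : ℝ) :
    IntervalIntegrable (fun τ => (1 + (t - τ)) ^ a) volume 0 t := by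
  refine ContinuousOn.intervalIntegrable fun τ hτ => ?_
  rw [Set.uIcc_of_le ht] at hτ
  exact (ContinuousAt.rpow_const (by fun_prop) (Or.inl (by linarith [hτ.2]))).continuousWithinAt

theorem integral_one_add_sub_rpow (t a : ℝ) :
    ∫ τ in (0 : ℝ)..t, (1 + (t - τ)) ^ a = ∫ τ in (0 : ℝ)..t, (1 + τ) ^ a := by
  have := intervalIntegral.integral_comp_sub_left (a := 0) (b := t) (fun x => (1 + x) ^ a) t
  simpa using this

theorem integral_one_add_rpow_le {t γ : ℝ} (ht : 0 ≤ t) (hγ : 1 < γ) :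
    ∫ τ in (0 : ℝ)..t, (1 + τ) ^ (-γ) ≤ (γ - 1)⁻¹ := by
  have h := intervalIntegral.integral_comp_add_left (a := 0) (b := t) (fun x : ℝ => x ^ (-γ)) 1
  rw [h, integral_rpow (Or.inr ⟨by linarith, fun h => ?_⟩), add_zero, Real.one_rpow]
  · have h1 : 0 ≤ (1 + t) ^ (-γ + 1) := Real.rpow_nonneg (by linarith) _
    have h2 : 0 < γ - 1 := by linarith
    rw [show -γ + 1 = -(γ - 1) by ring] at *
    rw [div_neg, ← neg_div, div_le_iff₀ h2, inv_mul_cancel₀ h2.ne']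
    linarith
  · rw [Set.uIcc_of_le (by linarith)] at h; linarith [h.1]

theorem integral_one_add_rpow_le' {t σ : ℝ} (hσ : σ < 1) :
    ∫ τ in (0 : ℝ)..t, (1 + τ) ^ (-σ) ≤ (1 - σ)⁻¹ * (1 + t) ^ (1 - σ) := by
  have h := intervalIntegral.integral_comp_add_left (a := 0) (b := t) (fun x : ℝ => x ^ (-σ)) 1
  rw [h, integral_rpow (Or.inl (by linarith)), add_zero, Real.one_rpow,
    show -σ + 1 = 1 - σ by ring]
  have h2 : 0 < 1 - σ := by linarith
  rw [div_eq_inv_mul]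
  gcongr
  linarith

/-- Lets the exponentially decaying high-frequency terms be merged into the polynomial rates. The
constant comes from $y\le e^y$ at $y=(1+s)/(2a)$. -/
theorem exp_neg_le_rpow {a : ℝ} (ha : 0 < a) :
    ∃ D : ℝ, 0 < D ∧ ∀ s : ℝ, 0 ≤ s → Real.exp (-s / 2) ≤ D * (1 + s) ^ (-a) := by
  refine ⟨(2 * a) ^ a * Real.exp (1 / 2), by positivity, fun s hs => ?_⟩
  have hs1 : 0 < 1 + s := by linarith
  rw [Real.rpow_neg hs1.le, ← div_eq_mul_inv, le_div_iff₀ (by positivity)]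
  have h1 : 1 + s ≤ 2 * a * Real.exp ((1 + s) / (2 * a)) := by
    have := Real.add_one_le_exp ((1 + s) / (2 * a))
    have h2 : (1 + s) / (2 * a) ≤ Real.exp ((1 + s) / (2 * a)) := by linarith
    rwa [div_le_iff₀ (by positivity), mul_comm] at h2
  have h2 : (1 + s) ^ a ≤ (2 * a) ^ a * Real.exp ((1 + s) / 2) := by
    refine (Real.rpow_le_rpow hs1.le h1 ha.le).trans_eq ?_
    rw [Real.mul_rpow (by positivity) (Real.exp_pos _).le, ← Real.exp_mul]
    congr 2; field_simp
  calc _ ≤ Real.exp (-s / 2) * ((2 * a) ^ a * Real.exp ((1 + s) / 2)) := by gcongr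
    _ = (2 * a) ^ a * (Real.exp (-s / 2) * Real.exp ((1 + s) / 2)) := by ring
    _ = _ := by rw [← Real.exp_add]; congr 2; ring

/-! ### The propagators in frequency space -/

theorem boundedSymbol_symbol1 {t : ℝ} (ht : 0 ≤ t) :
    BoundedSymbol (radial (symbol1 t) : E n → ℂ) 11 :=
  boundedSymbol_radial (measurable_symbol1 t) fun r _ =>
    (abs_symbol1_le_ten ht r).trans (by norm_num)

theorem boundedSymbol_symbol0 {t : ℝ} (ht : 0 ≤ t) :
    BoundedSymbol (radial (symbol0 t) : E n → ℂ) 11 :=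
  boundedSymbol_radial (measurable_symbol0 t) fun r _ => abs_symbol0_le_eleven ht r

theorem fourier_multiplier (m : ℝ → ℝ) (g : L2C n) :
    (𝓕 (multiplier m g) : L2C n) = mulL2 (radial m) (𝓕 g) := by
  rw [multiplier_eq, fourier_fourierInv_eq]

theorem fourier_sub' (g h : L2C n) : (𝓕 (g - h) : L2C n) = 𝓕 g - 𝓕 h :=
  (Lp.fourierTransformₗᵢ (E n) ℂ).map_sub _ _

/-- Fourier multipliers with bounded symbols are continuous linear maps. -/
def multiplierL {m : ℝ → ℝ} {B : ℝ} (hm : BoundedSymbol (radial m : E n → ℂ) B) :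
    L2C n →L[ℂ] L2C n :=
  ((Lp.fourierTransformₗᵢ (E n) ℂ).symm : L2C n →L[ℂ] L2C n) ∘L hm.toCLM ∘L
    ((Lp.fourierTransformₗᵢ (E n) ℂ) : L2C n →L[ℂ] L2C n)

theorem multiplier_sub {m : ℝ → ℝ} {B : ℝ} (hm : BoundedSymbol (radial m : E n → ℂ) B)
    (g h : L2C n) : multiplier m (g - h) = multiplier m g - multiplier m h :=
  (multiplierL hm).map_sub g h

theorem norm_multiplier (m : ℝ → ℝ) (g : L2C n) :
    ‖multiplier m g‖ = ‖mulL2 (radial m) (𝓕 g : L2C n)‖ := by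
  rw [← fourier_multiplier, Lp.norm_fourier_eq]

theorem norm_multiplier_le {m : ℝ → ℝ} {B : ℝ} (hm : BoundedSymbol (radial m : E n → ℂ) B)
    (g : L2C n) : ‖multiplier m g‖ ≤ B * ‖g‖ := by
  rw [norm_multiplier, ← Lp.norm_fourier_eq g]
  exact hm.norm_mulL2_le _

theorem fourier_intervalIntegral {G : ℝ → L2C n} {a b : ℝ}
    (hG : IntervalIntegrable G volume a b) :
    (𝓕 (∫ τ in a..b, G τ) : L2C n) = ∫ τ in a..b, (𝓕 (G τ) : L2C n) :=
  (((Lp.fourierTransformₗᵢ (E n) ℂ) : L2C n →L[ℂ] L2C n).intervalIntegral_comp_comm hG).symm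

theorem weightedNorm_intervalIntegral_le {k t : ℝ} (hk : 0 ≤ k) (ht : 0 ≤ t) {G : ℝ → L2C n}
    (hG : IntervalIntegrable G volume 0 t) {b : ℝ → ℝ} (hb : IntervalIntegrable b volume 0 t)
    (hb0 : ∀ τ, 0 ≤ τ → τ ≤ t → 0 ≤ b τ)
    (h : ∀ τ, 0 ≤ τ → τ ≤ t → weightedNorm k (𝓕 (G τ) : L2C n) ≤ ENNReal.ofReal (b τ)) :
    weightedNorm k (𝓕 (∫ τ in (0 : ℝ)..t, G τ) : L2C n) ≤
      ENNReal.ofReal (∫ τ in (0 : ℝ)..t, b τ) := by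
  rw [fourier_intervalIntegral hG, intervalIntegral.integral_of_le ht,
    intervalIntegral.integral_of_le ht]
  rw [intervalIntegrable_iff_integrableOn_Ioc_of_le ht] at hG hb
  have hG' : IntegrableOn (fun τ => (𝓕 (G τ) : L2C n)) (Set.Ioc 0 t) :=
    ((Lp.fourierTransformₗᵢ (E n) ℂ) : L2C n →L[ℂ] L2C n).integrable_comp hG
  rw [ofReal_integral_eq_lintegral_ofReal hb]
  · refine weightedNorm_integral_le hk hG' ?_
    filter_upwards [ae_restrict_mem measurableSet_Ioc] with τ hτ
    exact h τ hτ.1.le hτ.2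
  · filter_upwards [ae_restrict_mem measurableSet_Ioc] with τ hτ
    exact hb0 τ hτ.1.le hτ.2

/-! ### The Duhamel integral -/

/-- For $\tau\le t/2$ the propagator itself supplies $(1+t)^{-n/4-k/2}$ and $(1+\tau)^{-\gamma}$ is
integrable. For $\tau\ge t/2$ the source supplies its full decay in $t$, and the smoothing factor
$(1+t-\tau)^{-(k-j)/2}$ integrates to $(1+t)^{1-(k-j)/2}$ because $k<j+2$. -/
theorem weightedNorm_duhamel_le [NeZero n] {k j γ : ℝ} (hj : 0 ≤ j) (hjk : j ≤ k)
    (hkj : k < j + 2) (hγ : 1 < γ) :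
    ∃ C : ℝ, 0 ≤ C ∧ ∀ (F : ℝ → L2C n) (c t : ℝ), 0 ≤ c → 0 ≤ t →
      IntervalIntegrable (fun τ => K1 (t - τ) (F τ)) volume 0 t →
      (∀ τ, 0 ≤ τ → τ ≤ t → (∀ᵐ ξ, ‖(𝓕 (F τ) : L2C n) ξ‖ ≤ c * (1 + τ) ^ (-γ)) ∧
        weightedNorm j (𝓕 (F τ) : L2C n) ≤
          ENNReal.ofReal (c * (1 + τ) ^ (-γ - n / 4 - j / 2))) →
      weightedNorm k (𝓕 (∫ τ in (0 : ℝ)..t, K1 (t - τ) (F τ)) : L2C n) ≤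
        ENNReal.ofReal (C * c * (1 + t) ^ (-((n : ℝ) / 4) - k / 2)) := by
  have hk0 : 0 ≤ k := hj.trans hjk
  obtain ⟨G, hG, hlow⟩ := weightedNorm_mulL2_le_of_low_high (n := n) hk0
  set a : ℝ := (n : ℝ) / 4 + k / 2
  have ha : 0 < a := by
    have : (0 : ℝ) < n := Nat.cast_pos.2 (NeZero.pos n)
    positivity
  obtain ⟨D, hD, hexp⟩ := exp_neg_le_rpow ha
  set σ : ℝ := (k - j) / 2
  set b : ℝ := γ + n / 4 + j / 2
  have hσ1 : σ < 1 := by simp only [σ]; linarith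
  have hb0 : 0 ≤ b := by positivity
  set C₁ : ℝ := 20 * (G + D) * 2 ^ a
  set C₂ : ℝ := 30 * 2 ^ b
  refine ⟨C₁ * (γ - 1)⁻¹ + C₂ * (1 - σ)⁻¹, ?_, ?_⟩
  · have : 0 < γ - 1 := by linarith
    have : 0 < 1 - σ := by linarith
    positivity
  intro F c t hc ht hI hF
  have ht1 : 0 < 1 + t := by linarith
  -- The sum of the bounds for the two halves, each integrated over all of $[0,t]$ so that no
  -- interval has to be split.
  set β : ℝ → ℝ := fun τ => C₁ * c * (1 + t) ^ (-a) * (1 + τ) ^ (-γ) +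
    C₂ * c * (1 + t) ^ (-b) * (1 + (t - τ)) ^ (-σ)
  have hI1 := (intervalIntegrable_one_add_rpow ht (-γ)).const_mul (C₁ * c * (1 + t) ^ (-a))
  have hI2 := (intervalIntegrable_one_add_sub_rpow ht (-σ)).const_mul (C₂ * c * (1 + t) ^ (-b))
  have main := weightedNorm_intervalIntegral_le hk0 ht hI (b := β) (hI1.add hI2)
    (fun τ h0 h1 => by
      have : 0 ≤ 1 + (t - τ) := by linarith
      positivity) (fun τ h0 h1 => ?_)
  · refine main.trans (ENNReal.ofReal_le_ofReal ?_)
    simp only [β]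
    rw [intervalIntegral.integral_add hI1 hI2, intervalIntegral.integral_const_mul,
      intervalIntegral.integral_const_mul, integral_one_add_sub_rpow]
    have i1 := integral_one_add_rpow_le ht hγ
    have i2 := integral_one_add_rpow_le' (t := t) hσ1
    -- The exponents satisfy $-b+1-\sigma=-a-(\gamma-1)$, so $\gamma>1$ even leaves room.
    have e1 : (1 + t) ^ (-b) * (1 + t) ^ (1 - σ) ≤ (1 + t) ^ (-a) := by
      rw [← Real.rpow_add ht1]
      refine Real.rpow_le_rpow_of_exponent_le (by linarith) ?_
      simp only [a, b, σ]; linarith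
    have hs : 0 ≤ (1 - σ)⁻¹ := inv_nonneg.2 (by linarith)
    calc _ ≤ C₁ * c * (1 + t) ^ (-a) * (γ - 1)⁻¹ +
          C₂ * c * (1 + t) ^ (-b) * ((1 - σ)⁻¹ * (1 + t) ^ (1 - σ)) := by gcongr
      _ = C₁ * c * (1 + t) ^ (-a) * (γ - 1)⁻¹ +
          C₂ * c * (1 - σ)⁻¹ * ((1 + t) ^ (-b) * (1 + t) ^ (1 - σ)) := by ring
      _ ≤ C₁ * c * (1 + t) ^ (-a) * (γ - 1)⁻¹ + C₂ * c * (1 - σ)⁻¹ * (1 + t) ^ (-a) := by gcongr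
      _ = _ := by
        rw [show -((n : ℝ) / 4) - k / 2 = -a by simp only [a]; ring]; ring
  · obtain ⟨hN, hW⟩ := hF τ h0 h1
    have hs0 : 0 ≤ t - τ := by linarith
    have hτ1 : 0 < 1 + τ := by linarith
    have hs1 : 0 < 1 + (t - τ) := by linarith
    rw [K1, fourier_multiplier]
    -- In the first case $1+t-\tau\ge\frac{1+t}2$, in the second $1+\tau\ge\frac{1+t}2$: hence the
    -- powers of 2 in $C_1$ and $C_2$.
    rcases le_total τ (t / 2) with h2 | h2
    · refine (hlow (symbol1 (t - τ)) 11 20 (t - τ) j (by norm_num) hs0 (boundedSymbol_symbol1 hs0)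
        (fun r hr => rpow_mul_abs_symbol1_le hs0 hr hkj.le) _ _ _ (by positivity) (by positivity)
        hN hW).trans (ENNReal.ofReal_le_ofReal ?_)
      have e1 : (1 + τ) ^ (-γ - n / 4 - j / 2) ≤ (1 + τ) ^ (-γ) := by
        refine Real.rpow_le_rpow_of_exponent_le (by linarith) ?_
        have : 0 ≤ (n : ℝ) / 4 := by positivity
        linarith
      have e2 : (1 + (t - τ)) ^ (-a) ≤ 2 ^ a * (1 + t) ^ (-a) := by
        have h3 : (1 + t) / 2 ≤ 1 + (t - τ) := by linarith
        refine (Real.rpow_le_rpow_of_nonpos (by positivity) h3 (by linarith)).trans_eq ?_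
        rw [Real.div_rpow ht1.le (by norm_num), Real.rpow_neg (by norm_num : (0 : ℝ) ≤ 2),
          div_inv_eq_mul, mul_comm]
      have e3 : 0 ≤ C₂ * c * (1 + t) ^ (-b) * (1 + (t - τ)) ^ (-σ) := by positivity
      rw [show -((n : ℝ) / 4) - k / 2 = -a by simp only [a]; ring]
      calc _ ≤ 20 * (G * (1 + (t - τ)) ^ (-a) * (c * (1 + τ) ^ (-γ)) +
            (D * (1 + (t - τ)) ^ (-a)) * (c * (1 + τ) ^ (-γ))) := by
            gcongr; exact hexp _ hs0
        _ = 20 * (G + D) * (c * (1 + τ) ^ (-γ)) * (1 + (t - τ)) ^ (-a) := by ring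
        _ ≤ 20 * (G + D) * (c * (1 + τ) ^ (-γ)) * (2 ^ a * (1 + t) ^ (-a)) := by gcongr
        _ = C₁ * c * (1 + t) ^ (-a) * (1 + τ) ^ (-γ) := by simp only [C₁]; ring
        _ ≤ _ := le_add_of_nonneg_right e3
    · refine (weightedNorm_mulL2_le (boundedSymbol_symbol1 hs0)
        (fun r hr => rpow_mul_abs_symbol1_le_rpow hs0 hr hj hjk hkj.le) _).trans ?_
      refine (mul_le_mul_right hW _).trans ?_
      rw [← ENNReal.ofReal_mul (by positivity)]
      refine ENNReal.ofReal_le_ofReal ?_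
      have e2 : (1 + τ) ^ (-b) ≤ 2 ^ b * (1 + t) ^ (-b) := by
        have h3 : (1 + t) / 2 ≤ 1 + τ := by linarith
        refine (Real.rpow_le_rpow_of_nonpos (by positivity) h3 (by linarith)).trans_eq ?_
        rw [Real.div_rpow ht1.le (by norm_num), Real.rpow_neg (by norm_num : (0 : ℝ) ≤ 2),
          div_inv_eq_mul, mul_comm]
      have e3 : 0 ≤ C₁ * c * (1 + t) ^ (-a) * (1 + τ) ^ (-γ) := by positivity
      rw [show -γ - (n : ℝ) / 4 - j / 2 = -b by simp only [b]; ring]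
      calc _ ≤ 30 * (1 + (t - τ)) ^ (-σ) * (c * (2 ^ b * (1 + t) ^ (-b))) := by gcongr
        _ = C₂ * c * (1 + t) ^ (-b) * (1 + (t - τ)) ^ (-σ) := by simp only [C₂]; ring
        _ ≤ _ := le_add_of_nonneg_left e3

/-- The smoothing estimate `‖K₁(t) g‖₂ ≤ C (1 + t)^{-n/4} ‖ĝ‖_∞`. -/
theorem norm_K1_le [NeZero n] (hn : n ≤ 3) :
    ∃ C : ℝ, 0 < C ∧ ∀ t : ℝ, 0 ≤ t → ∀ (g : L2C n) (N : ℝ), 0 ≤ N →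
      (∀ᵐ ξ, ‖(𝓕 g : L2C n) ξ‖ ≤ N) → ‖K1 t g‖ ≤ C * (1 + t) ^ (-((n : ℝ) / 4)) * N := by
  obtain ⟨G, hG, h⟩ := enorm_mulL2_symbol1_le hn
  have hn0 : (0 : ℝ) < n := Nat.cast_pos.2 (NeZero.pos n)
  obtain ⟨D, hD, hexp⟩ := exp_neg_le_rpow (a := (n : ℝ) / 4) (by positivity)
  refine ⟨G * (1 + D) + 1, by positivity, fun t ht g N hN hg => ?_⟩
  rw [K1, norm_multiplier]
  refine (h t ht _ N hN hg).trans (mul_le_mul_of_nonneg_right ?_ hN)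
  have hx : 0 ≤ (1 + t) ^ (-((n : ℝ) / 4)) := by positivity
  calc _ ≤ G * ((1 + t) ^ (-((n : ℝ) / 4)) + D * (1 + t) ^ (-((n : ℝ) / 4))) := by
        gcongr; exact hexp t ht
    _ = G * (1 + D) * (1 + t) ^ (-((n : ℝ) / 4)) := by ring
    _ ≤ _ := by gcongr; linarith

/-- Replacing the larger base by the smaller one bounds the product by a single power; this removes
the need to split a convolution integral. -/
theorem rpow_neg_mul_rpow_neg_le {x y a b : ℝ} (hx : 1 ≤ x) (hy : 1 ≤ y) (ha : 0 ≤ a)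
    (hb : 0 ≤ b) : x ^ (-a) * y ^ (-b) ≤ x ^ (-(a + b)) + y ^ (-(a + b)) := by
  have hx0 : 0 < x := by linarith
  have hy0 : 0 < y := by linarith
  rcases le_total x y with h | h
  · have h1 : y ^ (-b) ≤ x ^ (-b) := Real.rpow_le_rpow_of_nonpos hx0 h (by linarith)
    calc _ ≤ x ^ (-a) * x ^ (-b) := by gcongr
      _ = x ^ (-(a + b)) := by rw [← Real.rpow_add hx0]; congr 1; ring
      _ ≤ _ := le_add_of_nonneg_right (by positivity)
  · have h1 : x ^ (-a) ≤ y ^ (-a) := Real.rpow_le_rpow_of_nonpos hy0 h (by linarith)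
    calc _ ≤ y ^ (-a) * y ^ (-b) := by gcongr
      _ = y ^ (-(a + b)) := by rw [← Real.rpow_add hy0]; congr 1; ring
      _ ≤ _ := le_add_of_nonneg_left (by positivity)

/-- A bound for the Duhamel integral that is uniform in time. -/
theorem norm_duhamel_le [NeZero n] (hn : n ≤ 3) {γ : ℝ} (hγ : 1 < γ) :
    ∃ C : ℝ, 0 < C ∧ ∀ (H : ℝ → L2C n) (c t : ℝ), 0 ≤ c → 0 ≤ t →
      (∀ τ, 0 ≤ τ → τ ≤ t →
        ∀ᵐ ξ, ‖(𝓕 (H τ) : L2C n) ξ‖ ≤ c * (1 + τ) ^ (-(γ - (n : ℝ) / 4))) →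
      ‖∫ τ in (0 : ℝ)..t, K1 (t - τ) (H τ)‖ ≤ C * c := by
  obtain ⟨C, hC, h⟩ := norm_K1_le (n := n) hn
  have hγ1 : 0 < γ - 1 := by linarith
  have hn3 : (n : ℝ) ≤ 3 := by exact_mod_cast hn
  refine ⟨C * (2 * (γ - 1)⁻¹), by positivity, fun H c t hc ht hH => ?_⟩
  have hI1 := (intervalIntegrable_one_add_rpow ht (-γ)).const_mul (C * c)
  have hI2 := (intervalIntegrable_one_add_sub_rpow ht (-γ)).const_mul (C * c)
  refine (intervalIntegral.norm_integral_le_of_norm_le ht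
    (g := fun τ => C * c * (1 + τ) ^ (-γ) + C * c * (1 + (t - τ)) ^ (-γ)) ?_ (hI1.add hI2)).trans ?_
  · refine Eventually.of_forall fun τ hτ => ?_
    have hs0 : 0 ≤ t - τ := by linarith [hτ.2]
    have hτ1 : 0 < 1 + τ := by linarith [hτ.1]
    refine (h (t - τ) hs0 (H τ) _ (by positivity) (hH τ hτ.1.le hτ.2)).trans ?_
    -- The exponents $\frac n4$ and $\gamma-\frac n4$ add up to the integrable exponent $\gamma$;
    -- the second is nonnegative because $n\le3$ and $\gamma>1$.
    have e := rpow_neg_mul_rpow_neg_le (x := 1 + (t - τ)) (y := 1 + τ) (a := (n : ℝ) / 4)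
      (b := γ - n / 4) (by linarith) (by linarith [hτ.1]) (by positivity) (by linarith)
    rw [add_sub_cancel] at e
    calc _ = C * c * ((1 + (t - τ)) ^ (-((n : ℝ) / 4)) * (1 + τ) ^ (-(γ - (n : ℝ) / 4))) := by ring
      _ ≤ C * c * ((1 + (t - τ)) ^ (-γ) + (1 + τ) ^ (-γ)) := by gcongr
      _ = _ := by ring
  · rw [intervalIntegral.integral_add hI1 hI2, intervalIntegral.integral_const_mul,
      intervalIntegral.integral_const_mul, integral_one_add_sub_rpow]
    have i1 := integral_one_add_rpow_le ht hγ
    have hCc : 0 ≤ C * c := by positivity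
    nlinarith [mul_le_mul_of_nonneg_left i1 hCc]

/-! ### Sobolev norms -/

theorem sq_le_add_sq_rpow (a b : ℝ≥0∞) : a ≤ (a ^ 2 + b ^ 2) ^ (1 / 2 : ℝ) := by
  calc a = (a ^ 2) ^ (1 / 2 : ℝ) := by
        rw [← ENNReal.rpow_natCast, ← ENNReal.rpow_mul]; norm_num
    _ ≤ _ := ENNReal.rpow_le_rpow le_self_add (by norm_num)

theorem enorm_le_sobolevNorm (k : ℝ) (w : L2R n) : ‖w‖ₑ ≤ sobolevNorm k w := by
  rw [Lp.enorm_def]; exact sq_le_add_sq_rpow _ _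

theorem fracGradNorm_le_sobolevNorm (k : ℝ) (w : L2R n) : fracGradNorm k w ≤ sobolevNorm k w := by
  rw [sobolevNorm, add_comm]; exact sq_le_add_sq_rpow _ _

theorem sobolevNorm_le (k : ℝ) (w : L2R n) : sobolevNorm k w ≤ ‖w‖ₑ + fracGradNorm k w := by
  have h : eLpNorm w 2 volume ^ 2 + fracGradNorm k w ^ 2 ≤
      (eLpNorm w 2 volume + fracGradNorm k w) ^ 2 := by
    rw [add_sq]
    exact add_le_add_left le_self_add _
  refine (ENNReal.rpow_le_rpow h (by norm_num)).trans_eq ?_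
  rw [← ENNReal.rpow_natCast, ← ENNReal.rpow_mul, Lp.enorm_def]; norm_num

theorem enorm_fourier_cpx (w : L2R n) : ‖(𝓕 (cpx w) : L2C n)‖ₑ = ‖w‖ₑ := by
  rw [← enorm_cpx w, ← ofReal_norm, ← ofReal_norm, Lp.norm_fourier_eq]

theorem fracGradNorm_le_of_le {k K : ℝ} (hk : 0 ≤ k) (hkK : k ≤ K) (w : L2R n) :
    fracGradNorm k w ≤ ‖w‖ₑ + fracGradNorm K w := by
  have := weightedNorm_le_add hk hkK (𝓕 (cpx w) : L2C n)
  rwa [enorm_fourier_cpx] at this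

theorem fracGradNorm_zero (w : L2R n) : fracGradNorm 0 w = ‖w‖ₑ := by
  rw [fracGradNorm_eq, weightedNorm_zero_index, enorm_fourier_cpx]

/-! ### The linear evolution -/

/-- The solution of the linear equation with data `(u₀, u₁)`. -/
def linearEvolution (u₀ u₁ : L2R n) (t : ℝ) : L2C n := K0 t (cpx u₀) + K1 t (cpx u₁)

theorem fourier_linearEvolution (u₀ u₁ : L2R n) (t : ℝ) :
    (𝓕 (linearEvolution u₀ u₁ t) : L2C n) =
      mulL2 (radial (symbol0 t)) (𝓕 (cpx u₀)) + mulL2 (radial (symbol1 t)) (𝓕 (cpx u₁)) := by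
  rw [← fourier_multiplier, ← fourier_multiplier]
  exact (Lp.fourierTransformₗᵢ (E n) ℂ).map_add _ _

/-- Decay of the linear evolution. -/
theorem weightedNorm_linearEvolution_le [NeZero n] {k j : ℝ} (hk : 0 ≤ k) (hkj : k ≤ j + 2) :
    ∃ C : ℝ, 0 < C ∧ ∀ (u₀ u₁ : L2R n) (d t : ℝ), 0 ≤ d → 0 ≤ t →
      (∀ᵐ ξ, ‖(𝓕 (cpx u₀) : L2C n) ξ‖ ≤ d) → (∀ᵐ ξ, ‖(𝓕 (cpx u₁) : L2C n) ξ‖ ≤ d) →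
      fracGradNorm k u₀ ≤ ENNReal.ofReal d → fracGradNorm j u₁ ≤ ENNReal.ofReal d →
      weightedNorm k (𝓕 (linearEvolution u₀ u₁ t) : L2C n) ≤
        ENNReal.ofReal (C * d * (1 + t) ^ (-((n : ℝ) / 4) - k / 2)) := by
  obtain ⟨G, hG, hlow⟩ := weightedNorm_mulL2_le_of_low_high (n := n) hk
  have hn0 : (0 : ℝ) < n := Nat.cast_pos.2 (NeZero.pos n)
  obtain ⟨D, hD, hexp⟩ := exp_neg_le_rpow (a := (n : ℝ) / 4 + k / 2) (by positivity)
  -- $42=22+20$, the constants in the bounds for the two symbols.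
  refine ⟨42 * (G + D), by positivity, fun u₀ u₁ d t hd ht h0 h1 hk0 hj1 => ?_⟩
  rw [fourier_linearEvolution]
  refine (weightedNorm_add_le _ _ _).trans ?_
  have e0 := hlow (symbol0 t) 11 22 t k (by norm_num) ht (boundedSymbol_symbol0 ht)
    (fun r hr => rpow_mul_abs_symbol0_le ht hr) _ d d hd hd h0 hk0
  have e1 := hlow (symbol1 t) 11 20 t j (by norm_num) ht (boundedSymbol_symbol1 ht)
    (fun r hr => rpow_mul_abs_symbol1_le ht hr hkj) _ d d hd hd h1 hj1
  refine (add_le_add e0 e1).trans ?_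
  rw [← ENNReal.ofReal_add (by positivity) (by positivity)]
  refine ENNReal.ofReal_le_ofReal ?_
  have e2 := hexp t ht
  rw [neg_add'] at e2
  set X := (1 + t) ^ (-((n : ℝ) / 4) - k / 2)
  calc _ = 42 * (G * X * d + Real.exp (-t / 2) * d) := by ring
    _ ≤ 42 * (G * X * d + (D * X) * d) := by gcongr
    _ = _ := by ring

/-- Strong continuity of the linear evolution. -/
theorem tendsto_linearEvolution {k j : ℝ} (hj : 0 ≤ j) (hjk : j ≤ k) (hkj : k ≤ j + 2)
    {u₀ u₁ : L2R n} (h0 : fracGradNorm k u₀ < ∞) (h1 : fracGradNorm j u₁ < ∞) {t : ℝ}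
    (ht : 0 ≤ t) :
    Tendsto (fun s => weightedNorm k (𝓕 (linearEvolution u₀ u₁ s) -
      𝓕 (linearEvolution u₀ u₁ t) : L2C n)) (𝓝[Set.Ici 0] t) (𝓝 0) := by
  have e0 := tendsto_weightedNorm_mulL2_sub (l := 𝓝[Set.Ici 0] t) (m := symbol0) (m₀ := symbol0 t)
    (B := 11) (C := 11) (k := k) (j := k) (g := (𝓕 (cpx u₀) : L2C n))
    (eventually_mem_nhdsWithin.mono fun s hs => boundedSymbol_symbol0 hs)
    (boundedSymbol_symbol0 ht)
    (eventually_mem_nhdsWithin.mono fun s hs r hr => by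
      rw [mul_comm]
      exact mul_le_mul_of_nonneg_right (abs_symbol0_le_eleven hs r) (by positivity))
    (fun r hr => by
      rw [mul_comm]
      exact mul_le_mul_of_nonneg_right (abs_symbol0_le_eleven ht r) (by positivity))
    (fun r _ => ((continuous_symbol0 r).tendsto t).mono_left nhdsWithin_le_nhds) h0
  have hb : ∀ s : ℝ, 0 ≤ s → ∀ r, 0 ≤ r → r ^ k * |symbol1 s r| ≤ 30 * r ^ j := by
    intro s hs r hr
    refine (rpow_mul_abs_symbol1_le_rpow hs hr hj hjk hkj).trans ?_
    have : (1 + s) ^ (-((k - j) / 2)) ≤ 1 :=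
      Real.rpow_le_one_of_one_le_of_nonpos (by linarith) (by linarith)
    have : 0 ≤ r ^ j := by positivity
    nlinarith
  have e1 := tendsto_weightedNorm_mulL2_sub (l := 𝓝[Set.Ici 0] t) (m := symbol1) (m₀ := symbol1 t)
    (B := 11) (C := 30) (k := k) (j := j) (g := (𝓕 (cpx u₁) : L2C n))
    (eventually_mem_nhdsWithin.mono fun s hs => boundedSymbol_symbol1 hs)
    (boundedSymbol_symbol1 ht)
    (eventually_mem_nhdsWithin.mono fun s hs => hb s hs) (hb t ht)
    (fun r _ => ((continuous_symbol1 r).tendsto t).mono_left nhdsWithin_le_nhds) h1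
  have e2 := e0.add e1
  rw [add_zero] at e2
  refine tendsto_of_tendsto_of_tendsto_of_le_of_le tendsto_const_nhds e2 (fun _ => zero_le) ?_
  intro s
  simp only [fourier_linearEvolution]
  rw [add_sub_add_comm]
  exact weightedNorm_add_le _ _ _

/-! ### Continuity of the Duhamel integral -/

/-- The uniform operator bound combines with strong continuity to give joint continuity. Cutting the
time at zero extends the statement to the whole line, since the symbol is unbounded in the frequency
at negative times. -/
theorem continuous_K1 : Continuous fun z : ℝ × L2C n => K1 (max z.1 0) z.2 := by
  rw [continuous_iff_continuousAt]
  rintro ⟨s₀, g₀⟩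
  have hm : ∀ s : ℝ, BoundedSymbol (radial (symbol1 (max s 0)) : E n → ℂ) 11 :=
    fun s => boundedSymbol_symbol1 (le_max_right s 0)
  have e1 := tendsto_weightedNorm_mulL2_sub (l := 𝓝 s₀) (m := fun s => symbol1 (max s 0))
    (m₀ := symbol1 (max s₀ 0)) (B := 11) (C := 11) (k := 0) (j := 0) (g := (𝓕 g₀ : L2C n))
    (Eventually.of_forall hm) (hm s₀)
    (Eventually.of_forall fun s r _ => by
      simpa using (abs_symbol1_le_ten (le_max_right s 0) r).trans (by norm_num))
    (fun r _ => by simpa using (abs_symbol1_le_ten (le_max_right s₀ 0) r).trans (by norm_num))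
    (fun r _ => ((continuous_symbol1 r).comp (continuous_id.max continuous_const)).tendsto s₀)
    (by rw [weightedNorm_zero_index]; exact enorm_lt_top)
  simp only [weightedNorm_zero_index] at e1
  have e2 : Tendsto (fun s => ‖K1 (max s 0) g₀ - K1 (max s₀ 0) g₀‖) (𝓝 s₀) (𝓝 0) := by
    have := (ENNReal.tendsto_toReal ENNReal.zero_ne_top).comp e1
    refine this.congr fun s => ?_
    simp only [Function.comp, toReal_enorm]
    rw [K1, K1, ← fourier_multiplier, ← fourier_multiplier, ← fourier_sub', Lp.norm_fourier_eq]
  rw [ContinuousAt, tendsto_iff_norm_sub_tendsto_zero]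
  have e3 : Tendsto (fun z : ℝ × L2C n => 11 * ‖z.2 - g₀‖ +
      ‖K1 (max z.1 0) g₀ - K1 (max s₀ 0) g₀‖) (𝓝 (s₀, g₀)) (𝓝 0) := by
    have h1 : Tendsto (fun z : ℝ × L2C n => 11 * ‖z.2 - g₀‖) (𝓝 (s₀, g₀)) (𝓝 0) := by
      have : Continuous fun z : ℝ × L2C n => 11 * ‖z.2 - g₀‖ := by fun_prop
      simpa using this.tendsto (s₀, g₀)
    have h2 := e2.comp ((continuous_fst (X := ℝ) (Y := L2C n)).tendsto (s₀, g₀))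
    simpa using h1.add h2
  refine squeeze_zero (fun _ => norm_nonneg _) (fun z => ?_) e3
  have h : K1 (max z.1 0) z.2 - K1 (max s₀ 0) g₀ =
      multiplier (symbol1 (max z.1 0)) (z.2 - g₀) + (K1 (max z.1 0) g₀ - K1 (max s₀ 0) g₀) := by
    rw [multiplier_sub (hm z.1)]
    simp only [K1]; abel
  rw [h]
  exact (norm_add_le _ _).trans (add_le_add_left (norm_multiplier_le (hm z.1) _) _)

theorem duhamel_integrand_eq {F : ℝ → L2C n} {t : ℝ} (ht : 0 ≤ t) :
    Set.EqOn (fun τ => K1 (max (t - τ) 0) (F τ)) (fun τ => K1 (t - τ) (F τ)) (Set.uIcc 0 t) := by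
  intro τ hτ
  rw [Set.uIcc_of_le ht] at hτ
  simp only [max_eq_left (sub_nonneg.2 hτ.2)]

theorem continuous_K1_comp {X : Type*} [TopologicalSpace X] {a : X → ℝ} {F : X → L2C n}
    (ha : Continuous a) (hF : Continuous F) : Continuous fun x => K1 (max (a x) 0) (F x) := by
  have h := continuous_K1 (n := n)
  generalize (K1 : ℝ → L2C n → L2C n) = K at h ⊢
  exact h.comp (ha.prodMk hF)

theorem intervalIntegrable_duhamel {F : ℝ → L2C n} (hF : Continuous F) {t : ℝ} (ht : 0 ≤ t) :
    IntervalIntegrable (fun τ => K1 (t - τ) (F τ)) volume 0 t := by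
  have h : Continuous fun τ => K1 (max (t - τ) 0) (F τ) :=
    continuous_K1_comp (continuous_const.sub continuous_id) hF
  refine (h.intervalIntegrable 0 t).congr fun τ hτ => ?_
  exact duhamel_integrand_eq ht (Set.uIoc_subset_uIcc hτ)

theorem continuousOn_duhamel {F : ℝ → L2C n} (hF : Continuous F) :
    ContinuousOn (fun t => ∫ τ in (0 : ℝ)..t, K1 (t - τ) (F τ)) (Set.Ici 0) := by
  have h : Continuous fun t : ℝ => ∫ τ in (0 : ℝ)..t, K1 (max (t - τ) 0) (F τ) := by
    have h1 : Continuous fun z : ℝ × ℝ => K1 (max (z.1 - z.2) 0) (F z.2) :=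
      continuous_K1_comp (continuous_fst.sub continuous_snd) (hF.comp continuous_snd)
    generalize (K1 : ℝ → L2C n → L2C n) = K at h1 ⊢
    exact intervalIntegral.continuous_parametric_intervalIntegral_of_continuous
      (f := fun t τ => K (max (t - τ) 0) (F τ)) h1 continuous_id
  refine h.continuousOn.congr fun t ht => ?_
  exact (intervalIntegral.integral_congr (duhamel_integrand_eq ht)).symm

theorem continuousOn_linearEvolution (u₀ u₁ : L2R n) :
    ContinuousOn (linearEvolution u₀ u₁) (Set.Ici 0) := by
  intro t ht
  have h := tendsto_linearEvolution (k := 0) (j := 0) le_rfl le_rfl (by norm_num)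
    (u₀ := u₀) (u₁ := u₁) (by rw [fracGradNorm_zero]; exact enorm_lt_top)
    (by rw [fracGradNorm_zero]; exact enorm_lt_top) ht
  simp only [weightedNorm_zero_index] at h
  rw [ContinuousWithinAt, tendsto_iff_norm_sub_tendsto_zero]
  refine ((ENNReal.tendsto_toReal ENNReal.zero_ne_top).comp h).congr fun s => ?_
  simp only [Function.comp, toReal_enorm]
  rw [← fourier_sub', Lp.norm_fourier_eq]

theorem conjL2_linearEvolution (u₀ u₁ : L2R n) {t : ℝ} (ht : 0 ≤ t) :
    conjL2 (linearEvolution u₀ u₁ t) = linearEvolution u₀ u₁ t := by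
  rw [linearEvolution, map_add, K0, K1, conjL2_multiplier (boundedSymbol_symbol0 ht),
    conjL2_multiplier (boundedSymbol_symbol1 ht), conjL2_cpx, conjL2_cpx]

theorem conjL2_duhamel {F : ℝ → L2C n} (hF : Continuous F) (hc : ∀ τ, conjL2 (F τ) = F τ) {t : ℝ}
    (ht : 0 ≤ t) : conjL2 (∫ τ in (0 : ℝ)..t, K1 (t - τ) (F τ)) =
      ∫ τ in (0 : ℝ)..t, K1 (t - τ) (F τ) := by
  rw [← conjL2.intervalIntegral_comp_comm (intervalIntegrable_duhamel hF ht)]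
  refine intervalIntegral.integral_congr fun τ hτ => ?_
  rw [Set.uIcc_of_le ht] at hτ
  simp only [K1]
  rw [conjL2_multiplier (boundedSymbol_symbol1 (sub_nonneg.2 hτ.2)), hc]

/-! ### Curves with the decay of the heat semigroup -/

theorem HeatBound.mono {ρ ρ' t : ℝ} {w : L2R n} (h : HeatBound ρ t w) (hρ : ρ ≤ ρ') (ht : 0 ≤ t) :
    HeatBound ρ' t w := by
  have ht1 : 0 < 1 + t := by linarith
  exact ⟨h.1.trans (ENNReal.ofReal_le_ofReal (by gcongr)),
    h.2.trans (ENNReal.ofReal_le_ofReal (by gcongr))⟩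

theorem HeatBound.at_zero {ρ t : ℝ} {w : L2R n} (h : HeatBound ρ t w) (hρ : 0 ≤ ρ) (ht : 0 ≤ t) :
    HeatBound ρ 0 w := by
  rw [heatBound_zero_iff]
  have h1 : ∀ a : ℝ, 0 ≤ a → ENNReal.ofReal (ρ * (1 + t) ^ (-a)) ≤ ENNReal.ofReal ρ := fun a ha =>
    ENNReal.ofReal_le_ofReal (mul_le_of_le_one_right hρ
      (Real.rpow_le_one_of_one_le_of_nonpos (by linarith) (by linarith)))
  refine ⟨h.1.trans (h1 _ (by positivity)), h.2.trans ?_⟩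
  rw [← neg_add']
  exact h1 _ (by positivity)

/-- Weak bounds of $H^1$ type survive $L^2$ limits by lower semicontinuity, so a contraction in
$L^2$ can stay inside this class. -/
theorem heatBound_of_tendsto {ι : Type*} {l : Filter ι} [l.NeBot] {ρ t : ℝ} {u : ι → L2R n}
    {w : L2R n} (h : Tendsto u l (𝓝 w)) (hu : ∀ᶠ i in l, HeatBound ρ t (u i)) :
    HeatBound ρ t w := by
  have h1 : Tendsto (fun i => (𝓕 (cpx (u i)) : L2C n)) l (𝓝 (𝓕 (cpx w))) :=
    (((Lp.fourierTransformₗᵢ (E n) ℂ).continuous.comp continuous_cpx).tendsto w).comp h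
  refine ⟨?_, ?_⟩
  · exact le_of_tendsto (continuous_enorm.tendsto w |>.comp h) (hu.mono fun i hi => hi.1)
  · exact weightedNorm_le_of_tendsto zero_le_one h1 (hu.mono fun i hi => hi.2)

/-- Continuous curves in `L²` that decay like solutions of the heat equation. -/
structure HeatDecay (ρ : ℝ) (u : ℝ → L2R n) : Prop where
  continuous : Continuous u
  bound : ∀ t, HeatBound ρ (max t 0) (u t)

section Picard

variable [NeZero n] {p : ℝ} {f : ℝ → ℝ}

theorem continuous_superpose (hn : n ≤ 2) (hp : 2 < p) (hf : PowerType p f) {B : ℝ} (hB : 0 < B)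
    {u : ℝ → L2R n} (hu : Continuous u) (hb : ∀ t, HeatBound B 0 (u t)) :
    Continuous fun t => superpose f (u t) :=
  continuous_iff_continuousAt.2 fun t =>
    tendsto_superpose hn hp hf hB (Eventually.of_forall hb) (hb t) (hu.tendsto t)

theorem HeatDecay.continuous_superpose (hn : n ≤ 2) (hp : 2 < p) (hf : PowerType p f) {ρ : ℝ}
    (hρ : 0 < ρ) {u : ℝ → L2R n} (hu : HeatDecay ρ u) : Continuous fun t => superpose f (u t) :=
  DampedWave.continuous_superpose hn hp hf hρ hu.continuous
    fun t => (hu.bound t).at_zero hρ.le (le_max_right _ _)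

theorem HeatDecay.weightedNorm_duhamel_le (hn : n ≤ 2) (hp : 2 < p)
    (hγ : 1 < (n : ℝ) / 2 * (p - 1)) (hf : PowerType p f) {k : ℝ} (hk : 0 ≤ k) (hk2 : k < 2) :
    ∃ C : ℝ, 0 ≤ C ∧ ∀ (u : ℝ → L2R n) (ρ t : ℝ), 0 < ρ → 0 ≤ t → HeatDecay ρ u →
      weightedNorm k (𝓕 (∫ τ in (0 : ℝ)..t, K1 (t - τ) (superpose f (u τ))) : L2C n) ≤
        ENNReal.ofReal (C * ρ ^ p * (1 + t) ^ (-((n : ℝ) / 4) - k / 2)) := by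
  obtain ⟨A, hA, h1⟩ := superpose_bounds (n := n) hn hp hf
  obtain ⟨D, hD, h2⟩ := DampedWave.weightedNorm_duhamel_le (n := n) (k := k) (j := 0) le_rfl hk
    (by linarith) hγ
  refine ⟨D * A, by positivity, fun u ρ t hρ ht hu => ?_⟩
  refine (h2 (fun τ => superpose f (u τ)) (A * ρ ^ p) t (by positivity) ht
    (intervalIntegrable_duhamel (hu.continuous_superpose hn hp hf hρ) ht) ?_).trans_eq ?_
  · intro τ hτ _
    have hb := hu.bound τ
    rw [max_eq_left hτ] at hb
    obtain ⟨-, h3, h4⟩ := h1 (u τ) ρ τ hρ hτ hb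
    refine ⟨h3, ?_⟩
    rw [weightedNorm_zero_index, zero_div, sub_zero]
    rwa [← ofReal_norm, Lp.norm_fourier_eq, ofReal_norm]
  · ring_nf

/-- The factor $\rho^{p-1}$ is what becomes small. The estimate is uniform in $t$ although the
distance $D$ carries no decay. -/
theorem HeatDecay.norm_duhamel_sub_le (hn : n ≤ 2) (hp : 2 < p)
    (hγ : 1 < (n : ℝ) / 2 * (p - 1)) (hf : PowerType p f) :
    ∃ C : ℝ, 0 < C ∧ ∀ (u v : ℝ → L2R n) (ρ D t : ℝ), 0 < ρ → 0 ≤ D → 0 ≤ t → HeatDecay ρ u →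
      HeatDecay ρ v → (∀ τ, ‖u τ - v τ‖ ≤ D) →
      ‖(∫ τ in (0 : ℝ)..t, K1 (t - τ) (superpose f (u τ))) -
        ∫ τ in (0 : ℝ)..t, K1 (t - τ) (superpose f (v τ))‖ ≤ C * ρ ^ (p - 1) * D := by
  obtain ⟨A, hA, h1⟩ := superpose_sub_bound (n := n) hn hp hf
  obtain ⟨B, hB, h2⟩ := norm_duhamel_le (n := n) (by omega) hγ
  refine ⟨B * A, by positivity, fun u v ρ D t hρ hD ht hu hv huv => ?_⟩
  have e : (∫ τ in (0 : ℝ)..t, K1 (t - τ) (superpose f (u τ))) -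
      (∫ τ in (0 : ℝ)..t, K1 (t - τ) (superpose f (v τ))) =
      ∫ τ in (0 : ℝ)..t, K1 (t - τ) (superpose f (u τ) - superpose f (v τ)) := by
    rw [← intervalIntegral.integral_sub
      (intervalIntegrable_duhamel (hu.continuous_superpose hn hp hf hρ) ht)
      (intervalIntegrable_duhamel (hv.continuous_superpose hn hp hf hρ) ht)]
    refine intervalIntegral.integral_congr fun τ hτ => ?_
    rw [Set.uIcc_of_le ht] at hτ
    exact (multiplier_sub (boundedSymbol_symbol1 (sub_nonneg.2 hτ.2)) _ _).symm
  rw [e]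
  refine (h2 _ (A * ρ ^ (p - 1) * D) t (by positivity) ht fun τ hτ _ => ?_).trans_eq (by ring)
  have hbu := hu.bound τ
  have hbv := hv.bound τ
  rw [max_eq_left hτ] at hbu hbv
  filter_upwards [h1 (u τ) (v τ) ρ τ hρ hτ hbu hbv] with ξ hξ
  have hτ1 : 0 < 1 + τ := by linarith
  refine hξ.trans ?_
  calc _ ≤ A * ρ ^ (p - 1) * (1 + τ) ^ (-((n : ℝ) / 2 * (p - 1) - n / 4)) * D := by
        gcongr; exact huv τ
    _ = _ := by ring

/-- The Picard map of the integral equation. -/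
def picard (f : ℝ → ℝ) (u₀ u₁ : L2R n) (u : ℝ → L2R n) (t : ℝ) : L2R n :=
  reL (linearEvolution u₀ u₁ (max t 0) +
    ∫ τ in (0 : ℝ)..(max t 0), K1 (max t 0 - τ) (superpose f (u τ)))

/-- Nothing is lost by taking the real part in `picard`: data, superpositions and propagators all
respect complex conjugation. -/
theorem cpx_picard (hn : n ≤ 2) (hp : 2 < p) (hf : PowerType p f) {ρ : ℝ} (hρ : 0 < ρ)
    {u : ℝ → L2R n} (hu : HeatDecay ρ u) (u₀ u₁ : L2R n) (t : ℝ) :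
    cpx (picard f u₀ u₁ u t) = linearEvolution u₀ u₁ (max t 0) +
      ∫ τ in (0 : ℝ)..(max t 0), K1 (max t 0 - τ) (superpose f (u τ)) := by
  obtain ⟨A, hA, h1⟩ := superpose_bounds (n := n) hn hp hf
  refine cpx_reL ?_
  rw [map_add, conjL2_linearEvolution _ _ (le_max_right _ _),
    conjL2_duhamel (hu.continuous_superpose hn hp hf hρ) _ (le_max_right _ _)]
  exact fun τ => conjL2_superpose (h1 (u τ) ρ _ hρ (le_max_right _ _) (hu.bound τ)).1

theorem continuous_picard (hn : n ≤ 2) (hp : 2 < p) (hf : PowerType p f) {ρ : ℝ} (hρ : 0 < ρ)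
    {u : ℝ → L2R n} (hu : HeatDecay ρ u) (u₀ u₁ : L2R n) : Continuous (picard f u₀ u₁ u) := by
  have h := (continuousOn_linearEvolution u₀ u₁).add
    (continuousOn_duhamel (hu.continuous_superpose hn hp hf hρ))
  have h1 : Continuous fun t : ℝ => max t 0 := continuous_id.max continuous_const
  exact reL.continuous.comp (h.comp_continuous h1 fun t => Set.mem_Ici.2 (le_max_right _ _))

/-- Small data for the low regularity theory. -/
structure SmallData (d : ℝ) (u₀ u₁ : L2R n) : Prop where
  fourier₀ : ∀ᵐ ξ, ‖(𝓕 (cpx u₀) : L2C n) ξ‖ ≤ d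
  fourier₁ : ∀ᵐ ξ, ‖(𝓕 (cpx u₁) : L2C n) ξ‖ ≤ d
  norm₀ : ‖u₀‖ₑ ≤ ENNReal.ofReal d
  grad₀ : fracGradNorm 1 u₀ ≤ ENNReal.ofReal d
  norm₁ : ‖u₁‖ₑ ≤ ENNReal.ofReal d

theorem heatBound_picard (hn : n ≤ 2) (hp : 2 < p) (hγ : 1 < (n : ℝ) / 2 * (p - 1))
    (hf : PowerType p f) :
    ∃ C : ℝ, 0 < C ∧ ∀ (u₀ u₁ : L2R n) (u : ℝ → L2R n) (d ρ t : ℝ), 0 ≤ d → 0 < ρ →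
      SmallData d u₀ u₁ → HeatDecay ρ u →
      HeatBound (C * (d + ρ ^ p)) (max t 0) (picard f u₀ u₁ u t) := by
  obtain ⟨A, hA, l0⟩ := weightedNorm_linearEvolution_le (n := n) (k := 0) (j := 0) le_rfl
    (by norm_num)
  obtain ⟨B, hB, l1⟩ := weightedNorm_linearEvolution_le (n := n) (k := 1) (j := 0) zero_le_one
    (by norm_num)
  obtain ⟨A', hA', d0⟩ := HeatDecay.weightedNorm_duhamel_le (n := n) hn hp hγ hf (k := 0) le_rfl
    (by norm_num)
  obtain ⟨B', hB', d1⟩ := HeatDecay.weightedNorm_duhamel_le (n := n) hn hp hγ hf (k := 1)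
    zero_le_one (by norm_num)
  refine ⟨A + B + A' + B', by positivity, fun u₀ u₁ u d ρ t hd hρ hs hu => ?_⟩
  have ht := le_max_right t 0
  have e1 := fun k => weightedNorm_add_le k (𝓕 (linearEvolution u₀ u₁ (max t 0)) : L2C n)
    (𝓕 (∫ τ in (0 : ℝ)..(max t 0), K1 (max t 0 - τ) (superpose f (u τ))) : L2C n)
  have e2 : ∀ k, fracGradNorm k (picard f u₀ u₁ u t) =
      weightedNorm k ((𝓕 (linearEvolution u₀ u₁ (max t 0)) : L2C n) +
        𝓕 (∫ τ in (0 : ℝ)..(max t 0), K1 (max t 0 - τ) (superpose f (u τ))) : L2C n) := by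
    intro k
    rw [fracGradNorm_eq, cpx_picard hn hp hf hρ hu]
    exact congrArg _ ((Lp.fourierTransformₗᵢ (E n) ℂ).map_add _ _)
  have q0 := l0 u₀ u₁ d _ hd ht hs.fourier₀ hs.fourier₁ (by rw [fracGradNorm_zero]; exact hs.norm₀)
    (by rw [fracGradNorm_zero]; exact hs.norm₁)
  have q1 := l1 u₀ u₁ d _ hd ht hs.fourier₀ hs.fourier₁ hs.grad₀
    (by rw [fracGradNorm_zero]; exact hs.norm₁)
  have r0 := d0 u ρ _ hρ ht hu
  have r1 := d1 u ρ _ hρ ht hu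
  have ht1 : 0 < 1 + max t 0 := by linarith
  have key : ∀ a b X : ℝ, 0 ≤ a → 0 ≤ b → a ≤ A + B + A' + B' → b ≤ A + B + A' + B' → 0 ≤ X →
      ENNReal.ofReal (a * d * X) + ENNReal.ofReal (b * ρ ^ p * X) ≤
        ENNReal.ofReal ((A + B + A' + B') * (d + ρ ^ p) * X) := by
    intro a b X ha hb ha' hb' hX
    rw [← ENNReal.ofReal_add (by positivity) (by positivity)]
    refine ENNReal.ofReal_le_ofReal ?_
    rw [← add_mul, mul_add]
    gcongr
  refine ⟨?_, ?_⟩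
  · rw [← fracGradNorm_zero, e2]
    refine ((e1 0).trans (add_le_add q0 r0)).trans ?_
    rw [zero_div, sub_zero]
    exact key _ _ _ hA.le hA' (by linarith) (by linarith) (by positivity)
  · rw [e2]
    exact ((e1 1).trans (add_le_add q1 r1)).trans
      (key _ _ _ hB.le hB' (by linarith) (by linarith) (by positivity))

open scoped NNReal BoundedContinuousFunction in
/-- Global existence for small data, at the regularity of `H¹`. -/
theorem exists_heatDecay_solution (hn : n ≤ 2) (hp : 2 < p) (hγ : 1 < (n : ℝ) / 2 * (p - 1))
    (hf : PowerType p f) :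
    ∃ d ρ : ℝ, 0 < d ∧ 0 < ρ ∧ ∀ u₀ u₁ : L2R n, SmallData d u₀ u₁ →
      ∃ u : ℝ → L2R n, HeatDecay ρ u ∧ ∀ t, u t = picard f u₀ u₁ u t := by
  obtain ⟨C, hC, hb⟩ := heatBound_picard (n := n) hn hp hγ hf
  obtain ⟨D, hD, hcontr⟩ := HeatDecay.norm_duhamel_sub_le (n := n) hn hp hγ hf
  -- Since $p>1$, a small radius $\rho$ achieves $(C+D)\rho^{p-1}<\frac12$, which yields both
  -- invariance and contraction.
  have hlim : Tendsto (fun r : ℝ => (C + D) * r ^ (p - 1)) (𝓝[>] 0) (𝓝 0) := by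
    have : Tendsto (fun r : ℝ => (C + D) * r ^ (p - 1)) (𝓝 0) (𝓝 ((C + D) * 0 ^ (p - 1))) :=
      ((Real.continuousAt_rpow_const 0 (p - 1) (Or.inr (by linarith))).tendsto).const_mul (C + D)
    rw [Real.zero_rpow (by linarith), mul_zero] at this
    exact this.mono_left nhdsWithin_le_nhds
  obtain ⟨ρ, hρ1, hρ⟩ :=
    ((hlim.eventually (gt_mem_nhds (show (0 : ℝ) < 1 / 2 by norm_num))).and
      self_mem_nhdsWithin).exists
  have hρ : 0 < ρ := hρ
  set X := ρ ^ (p - 1) with hX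
  have hX0 : 0 < X := by positivity
  have hpow : ρ ^ p = X * ρ := by
    rw [hX, ← Real.rpow_add_one hρ.ne']; congr 1; ring
  have hCX : C * X ≤ 1 / 2 := by nlinarith
  have hDX : D * X ≤ 1 / 2 := by nlinarith
  -- With this $d$ the linear part contributes $Cd=\rho/2$, and the nonlinear part at most
  -- $C\rho^p\le\rho/2$.
  refine ⟨ρ / (2 * C), ρ, by positivity, hρ, fun u₀ u₁ hs => ?_⟩
  have hb' : ∀ u : ℝ → L2R n, HeatDecay ρ u → HeatDecay ρ (picard f u₀ u₁ u) := fun u hu =>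
    ⟨continuous_picard hn hp hf hρ hu u₀ u₁, fun t =>
      (hb u₀ u₁ u _ ρ t (by positivity) hρ hs hu).mono (by
        rw [hpow, mul_add, mul_div_assoc', mul_comm 2 C, mul_div_mul_left _ _ hC.ne']
        nlinarith) (le_max_right _ _)⟩
  let ext : (ℝ≥0 →ᵇ L2R n) → ℝ → L2R n := fun w t => w t.toNNReal
  -- Heat-size curves on the half line inside the bounded continuous $L^2$-valued curves; the norm
  -- is uniform in time and carries neither weights nor derivatives.
  let M : Set (ℝ≥0 →ᵇ L2R n) := {w | ∀ t : ℝ≥0, HeatBound ρ t (w t)}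
  have hext : ∀ w ∈ M, HeatDecay ρ (ext w) := fun w hw =>
    ⟨w.continuous.comp continuous_real_toNNReal, fun t => by
      have := hw t.toNNReal
      rwa [Real.coe_toNNReal'] at this⟩
  have hM : IsClosed M := by
    refine isClosed_of_closure_subset fun w hw t => ?_
    obtain ⟨l, hl1, hl2⟩ := mem_closure_iff_ultrafilter.1 hw
    exact heatBound_of_tendsto (l := (l : Filter _)) (u := fun v : ℝ≥0 →ᵇ L2R n => v t)
      (((continuous_eval_const t).tendsto w).mono_left hl2)
      (Filter.mem_of_superset hl1 fun v hv => hv t)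
  have hbound : ∀ u : ℝ → L2R n, HeatDecay ρ u → ∀ t, ‖u t‖ ≤ ρ := by
    intro u hu t
    have := (heatBound_zero_iff.1 ((hu.bound t).at_zero hρ.le (le_max_right _ _))).1
    rwa [← ofReal_norm, ENNReal.ofReal_le_ofReal_iff hρ.le] at this
  let Ψ : M → M := fun w =>
    ⟨BoundedContinuousFunction.ofNormedAddCommGroup
      (fun t : ℝ≥0 => picard f u₀ u₁ (ext w) t)
      ((continuous_picard hn hp hf hρ (hext w w.2) u₀ u₁).comp NNReal.continuous_coe) ρ
      (fun t => hbound _ (hb' _ (hext w w.2)) t), fun t => by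
        have := (hb' _ (hext w w.2)).bound t
        rwa [max_eq_left (NNReal.coe_nonneg t)] at this⟩
  have hΨ : ContractingWith (1 / 2) Ψ := by
    refine ⟨by norm_num, LipschitzWith.of_dist_le_mul fun v w => ?_⟩
    rw [Subtype.dist_eq, Subtype.dist_eq]
    refine (BoundedContinuousFunction.dist_le (by positivity)).2 fun t => ?_
    change dist (picard f u₀ u₁ (ext v) t) (picard f u₀ u₁ (ext w) t) ≤ _
    rw [dist_eq_norm, picard, picard, ← map_sub]
    refine (norm_reL_le _).trans ?_
    rw [add_sub_add_left_eq_sub]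
    refine (hcontr (ext v) (ext w) ρ (dist v.1 w.1) _ hρ dist_nonneg (le_max_right _ _)
      (hext v v.2) (hext w w.2) fun τ => ?_).trans ?_
    · rw [← dist_eq_norm]
      exact BoundedContinuousFunction.dist_coe_le_dist _
    · refine mul_le_mul_of_nonneg_right ?_ dist_nonneg
      simpa using hDX
  have hne : Nonempty M := ⟨⟨0, fun t => by
    have h : fracGradNorm 1 (0 : L2R n) = 0 := by
      rw [fracGradNorm_eq, show cpx (0 : L2R n) = 0 by rw [← cpxL_apply, map_zero],
        show (𝓕 (0 : L2C n) : L2C n) = 0 from (Lp.fourierTransformₗᵢ (E n) ℂ).map_zero,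
        weightedNorm_zero]
    exact ⟨by simp, by
      change fracGradNorm 1 (0 : L2R n) ≤ _
      rw [h]; exact zero_le⟩⟩⟩
  have : CompleteSpace M := hM.completeSpace_coe
  have hfix := hΨ.fixedPoint_isFixedPt
  set w := ContractingWith.fixedPoint Ψ hΨ
  refine ⟨ext w, hext w w.2, fun t => ?_⟩
  have h1 : (Ψ w).1 t.toNNReal = w.1 t.toNNReal := by rw [hfix]
  change w.1 t.toNNReal = _
  rw [← h1]
  change picard f u₀ u₁ (ext w) (t.toNNReal : ℝ) = _
  rw [Real.coe_toNNReal', picard, picard, max_eq_left (le_max_right t 0)]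

theorem HeatDecay.isMildSolution (hn : n ≤ 2) (hp : 2 < p) (hf : PowerType p f) {ρ : ℝ}
    (hρ : 0 < ρ) {u₀ u₁ : L2R n} {u : ℝ → L2R n} (hu : HeatDecay ρ u)
    (h : ∀ t, u t = picard f u₀ u₁ u t) : IsMildSolution f u₀ u₁ u where
  memLp τ _ := by
    obtain ⟨A, -, h1⟩ := superpose_bounds (n := n) hn hp hf
    exact (h1 (u τ) ρ _ hρ (le_max_right _ _) (hu.bound τ)).1
  integrable t ht := intervalIntegrable_duhamel (hu.continuous_superpose hn hp hf hρ) ht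
  eq t ht := by
    conv_lhs => rw [h t]
    rw [cpx_picard hn hp hf hρ hu, max_eq_left ht, linearEvolution]

end Picard

/-! ### Higher regularity -/

theorem fourier_add' (g h : L2C n) : (𝓕 (g + h) : L2C n) = 𝓕 g + 𝓕 h :=
  (Lp.fourierTransformₗᵢ (E n) ℂ).map_add g h

/-- Interpolation between the decay of two norms. -/
theorem weightedNorm_le_of_decay {k K a t A B : ℝ} {g : L2C n} (hk : 0 ≤ k) (hkK : k ≤ K)
    (ht : 0 ≤ t) (hA : 0 ≤ A) (hB : 0 ≤ B) (h0 : ‖g‖ₑ ≤ ENNReal.ofReal (A * (1 + t) ^ (-a)))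
    (h1 : weightedNorm K g ≤ ENNReal.ofReal (B * (1 + t) ^ (-a - K / 2))) :
    weightedNorm k g ≤ ENNReal.ofReal ((A + B) * (1 + t) ^ (-a - k / 2)) := by
  have ht1 : 0 < 1 + t := by linarith
  have hl : ∀ j : ℝ, ((1 + t) ^ (1 / 2 : ℝ)) ^ j = (1 + t) ^ (j / 2) := fun j => by
    rw [← Real.rpow_mul ht1.le]; congr 1; ring
  have h := rpow_mul_weightedNorm_le hk hkK (Real.rpow_nonneg ht1.le (1 / 2)) g
  rw [hl, hl] at h
  have h2 : ENNReal.ofReal ((1 + t) ^ (k / 2)) * weightedNorm k g ≤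
      ENNReal.ofReal ((A + B) * (1 + t) ^ (-a)) := by
    refine (h.trans (add_le_add h0 (mul_le_mul_right h1 _))).trans_eq ?_
    rw [← ENNReal.ofReal_mul (by positivity), ← ENNReal.ofReal_add (by positivity) (by positivity)]
    congr 1
    have : (1 + t) ^ (K / 2) * (1 + t) ^ (-a - K / 2) = (1 + t) ^ (-a) := by
      rw [← Real.rpow_add ht1]; congr 1; ring
    linear_combination B * this
  have h3 := mul_le_mul_right h2 (ENNReal.ofReal ((1 + t) ^ (-(k / 2))))
  rw [← mul_assoc, ← ENNReal.ofReal_mul (by positivity), ← ENNReal.ofReal_mul (by positivity),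
    ← Real.rpow_add ht1, neg_add_cancel, Real.rpow_zero, ENNReal.ofReal_one, one_mul] at h3
  refine h3.trans_eq ?_
  rw [sub_eq_add_neg, Real.rpow_add ht1]
  congr 1; ring

/-- Smallness in `L²` together with boundedness in a stronger norm. -/
theorem tendsto_weightedNorm_of_bounded {ι : Type*} {l : Filter ι} {k K B : ℝ} {G : ι → L2C n}
    (hk : 0 ≤ k) (hkK : k < K) (hB : 0 ≤ B) (h : Tendsto G l (𝓝 0))
    (hG : ∀ᶠ i in l, weightedNorm K (G i) ≤ ENNReal.ofReal B) :
    Tendsto (fun i => weightedNorm k (G i)) l (𝓝 0) := by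
  have key : ∀ r : ℝ, 0 < r → ∀ᶠ i in l,
      weightedNorm k (G i) ≤ ENNReal.ofReal ((1 + B) * r ^ (K - k)) := by
    intro r hr
    have hclose : ∀ᶠ i in l, ‖G i‖ < r ^ K := by
      have := (tendsto_norm_zero.comp h).eventually (gt_mem_nhds (show 0 < r ^ K by positivity))
      exact this
    filter_upwards [hclose, hG] with i h0 h1
    have h2 := rpow_mul_weightedNorm_le hk hkK.le hr.le (G i)
    have h3 : ENNReal.ofReal (r ^ k) * weightedNorm k (G i) ≤
        ENNReal.ofReal ((1 + B) * r ^ K) := by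
      refine (h2.trans (add_le_add ?_ (mul_le_mul_right h1 _))).trans_eq
        (b := ENNReal.ofReal (r ^ K) + ENNReal.ofReal (r ^ K) * ENNReal.ofReal B) ?_
      · rw [← ofReal_norm]; exact ENNReal.ofReal_le_ofReal h0.le
      · rw [← ENNReal.ofReal_mul (by positivity),
          ← ENNReal.ofReal_add (by positivity) (by positivity)]
        congr 1; ring
    have h4 := mul_le_mul_right h3 (ENNReal.ofReal (r ^ (-k)))
    rw [← mul_assoc, ← ENNReal.ofReal_mul (by positivity), ← ENNReal.ofReal_mul (by positivity),
      ← Real.rpow_add hr, neg_add_cancel, Real.rpow_zero, ENNReal.ofReal_one, one_mul] at h4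
    refine h4.trans_eq ?_
    rw [sub_eq_add_neg, Real.rpow_add hr]
    congr 1; ring
  have hlim : Tendsto (fun r : ℝ => ENNReal.ofReal ((1 + B) * r ^ (K - k))) (𝓝[>] 0) (𝓝 0) := by
    have : Tendsto (fun r : ℝ => (1 + B) * r ^ (K - k)) (𝓝 0) (𝓝 ((1 + B) * 0 ^ (K - k))) :=
      ((Real.continuousAt_rpow_const 0 (K - k) (Or.inr (by linarith))).tendsto).const_mul _
    rw [Real.zero_rpow (by linarith), mul_zero] at this
    simpa using ENNReal.tendsto_ofReal (this.mono_left nhdsWithin_le_nhds)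
  rw [ENNReal.tendsto_nhds_zero]
  intro ε hε
  obtain ⟨r, hr1, hr2⟩ := ((hlim.eventually (gt_mem_nhds hε)).and self_mem_nhdsWithin).exists
  filter_upwards [key r hr2] with i hi
  exact hi.trans hr1.le

section Regularity

variable [NeZero n] {p : ℝ} {f : ℝ → ℝ}

theorem fracGradNorm_picard_le (hn : n ≤ 2) (hp : 2 < p) (hf : PowerType p f) {ρ : ℝ}
    (hρ : 0 < ρ) {u₀ u₁ : L2R n} {u : ℝ → L2R n} (hu : HeatDecay ρ u)
    (h : ∀ t, u t = picard f u₀ u₁ u t) (k : ℝ) {t : ℝ} (ht : 0 ≤ t) :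
    fracGradNorm k (u t) ≤ weightedNorm k (𝓕 (linearEvolution u₀ u₁ t) : L2C n) +
      weightedNorm k (𝓕 (∫ τ in (0 : ℝ)..t, K1 (t - τ) (superpose f (u τ))) : L2C n) := by
  rw [fracGradNorm_eq, h t, cpx_picard hn hp hf hρ hu, max_eq_left ht, fourier_add']
  exact weightedNorm_add_le _ _ _

/-- A single bootstrap. Orders below 2 come from the $L^2$ bound of $f(u)$. For $2\le k<3$ the
already known order $\frac32$ yields decay of $\|u\|_\infty$, then of $\|\nabla f(u)\|_2$, and
smoothing starts from $j=1$. -/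
theorem weightedNorm_duhamel_of_picard (hn : n ≤ 2) (hp : 2 < p)
    (hγ : 1 < (n : ℝ) / 2 * (p - 1)) (hf : PowerType p f) {k d ρ : ℝ} (hk : 0 ≤ k) (hk3 : k < 3)
    (hd : 0 ≤ d) (hρ : 0 < ρ) :
    ∃ C : ℝ, 0 ≤ C ∧ ∀ (u₀ u₁ : L2R n) (u : ℝ → L2R n), SmallData d u₀ u₁ →
      (2 ≤ k → fracGradNorm (3 / 2) u₀ ≤ ENNReal.ofReal d) → HeatDecay ρ u →
      (∀ t, u t = picard f u₀ u₁ u t) → ∀ t, 0 ≤ t →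
      weightedNorm k (𝓕 (∫ τ in (0 : ℝ)..t, K1 (t - τ) (superpose f (u τ))) : L2C n) ≤
        ENNReal.ofReal (C * (1 + t) ^ (-((n : ℝ) / 4) - k / 2)) := by
  rcases lt_or_ge k 2 with hk2 | hk2
  · obtain ⟨C, hC, h⟩ := HeatDecay.weightedNorm_duhamel_le (n := n) hn hp hγ hf hk hk2
    exact ⟨C * ρ ^ p, by positivity, fun u₀ u₁ u _ _ hu _ t ht => h u ρ t hρ ht hu⟩
  have hn2 : (n : ℝ) ≤ 2 := by exact_mod_cast hn
  obtain ⟨A, hA, l1⟩ := weightedNorm_linearEvolution_le (n := n) (k := 3 / 2) (j := 0)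
    (by norm_num) (by norm_num)
  obtain ⟨B, hB, d1⟩ := HeatDecay.weightedNorm_duhamel_le (n := n) hn hp hγ hf (k := 3 / 2)
    (by norm_num) (by norm_num)
  -- The order $\frac32$ exceeds $\frac n2\le1$, hence controls the sup norm, and is below 2, hence
  -- needs no bound on derivatives of $f(u)$.
  obtain ⟨G, hG, hsup⟩ := ae_norm_le_of_fracGradNorm (n := n) (k := 3 / 2) (by linarith)
  obtain ⟨D, hD, hchain⟩ := weightedNorm_one_superpose_le (n := n) (by linarith : 1 < p) hf
  obtain ⟨S, hS, hS1⟩ := superpose_bounds (n := n) hn hp hf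
  obtain ⟨C, hC, hduh⟩ := weightedNorm_duhamel_le (n := n) (k := k) (j := 1) zero_le_one
    (by linarith) (by linarith) hγ
  set M : ℝ := ρ + (A * d + B * ρ ^ p) with hM
  have hM0 : 0 ≤ M := by positivity
  set c : ℝ := S * ρ ^ p + D * (G * M) ^ (p - 1) * ρ with hc
  refine ⟨C * c, by positivity, fun u₀ u₁ u hs h0 hu hfix t ht => ?_⟩
  refine hduh (fun τ => superpose f (u τ)) c t (by positivity) ht
    (intervalIntegrable_duhamel (hu.continuous_superpose hn hp hf hρ) ht) fun τ hτ _ => ?_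
  have hτ1 : 0 < 1 + τ := by linarith
  have hb := hu.bound τ
  rw [max_eq_left hτ] at hb
  obtain ⟨s1, s2, -⟩ := hS1 (u τ) ρ τ hρ hτ hb
  refine ⟨?_, ?_⟩
  · filter_upwards [s2] with ξ hξ
    refine hξ.trans (mul_le_mul_of_nonneg_right ?_ (by positivity))
    rw [hc]
    exact le_add_of_nonneg_right (by positivity)
  · have e1 : fracGradNorm (3 / 2) (u τ) ≤
        ENNReal.ofReal ((A * d + B * ρ ^ p) * (1 + τ) ^ (-((n : ℝ) / 4) - (3 / 2) / 2)) := by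
      refine ((fracGradNorm_picard_le hn hp hf hρ hu hfix (3 / 2) hτ).trans (add_le_add
        (l1 u₀ u₁ d τ hd hτ hs.fourier₀ hs.fourier₁ (h0 hk2)
          (by rw [fracGradNorm_zero]; exact hs.norm₁)) (d1 u ρ τ hρ hτ hu))).trans_eq ?_
      rw [← ENNReal.ofReal_add (by positivity) (by positivity), add_mul]
    have e2 : ∀ᵐ x, ‖u τ x‖ ≤ G * M * (1 + τ) ^ (-((n : ℝ) / 2)) := by
      have h1 := hsup (u τ) ((1 + τ) ^ (1 / 2 : ℝ)) (M * (1 + τ) ^ (-((n : ℝ) / 4)))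
        (by positivity) (by positivity) (by
          refine (add_le_add hb.1 (mul_le_mul_right e1 _)).trans_eq ?_
          rw [← ENNReal.ofReal_mul (by positivity), ← Real.rpow_mul hτ1.le,
            ← ENNReal.ofReal_add (by positivity) (by positivity)]
          have : (1 + τ) ^ (1 / 2 * (3 / 2) : ℝ) * (1 + τ) ^ (-((n : ℝ) / 4) - (3 / 2) / 2) =
              (1 + τ) ^ (-((n : ℝ) / 4)) := by
            rw [← Real.rpow_add hτ1]; congr 1; ring
          congr 1
          rw [hM]
          linear_combination (A * d + B * ρ ^ p) * this)
      filter_upwards [h1] with x hx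
      refine hx.trans_eq ?_
      rw [← Real.rpow_mul hτ1.le]
      have : (1 + τ) ^ (1 / 2 * -((n : ℝ) / 2)) * (1 + τ) ^ (-((n : ℝ) / 4)) =
          (1 + τ) ^ (-((n : ℝ) / 2)) := by
        rw [← Real.rpow_add hτ1]; congr 1; ring
      linear_combination G * M * this
    have e3 := hchain (u τ) _ (by positivity) e2 s1
    refine (e3.trans (mul_le_mul_right hb.2 _)).trans ?_
    rw [← ENNReal.ofReal_mul (by positivity)]
    refine ENNReal.ofReal_le_ofReal ?_
    rw [Real.mul_rpow (by positivity) (by positivity), ← Real.rpow_mul hτ1.le]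
    -- The decay $(1+\tau)^{-n/2}$ of the sup norm, raised to $p-1$, gives exactly $\gamma$, so the
    -- total is the rate required of the source when $j=1$.
    have : (1 + τ) ^ (-((n : ℝ) / 2) * (p - 1)) * (1 + τ) ^ (-((n : ℝ) / 4) - 1 / 2) =
        (1 + τ) ^ (-((n : ℝ) / 2 * (p - 1)) - n / 4 - 1 / 2) := by
      rw [← Real.rpow_add hτ1]; congr 1; ring
    calc _ = (D * (G * M) ^ (p - 1) * ρ) *
          ((1 + τ) ^ (-((n : ℝ) / 2) * (p - 1)) * (1 + τ) ^ (-((n : ℝ) / 4) - 1 / 2)) := by ring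
      _ ≤ c * (1 + τ) ^ (-((n : ℝ) / 2 * (p - 1)) - n / 4 - 1 / 2) := by
          rw [this]
          refine mul_le_mul_of_nonneg_right ?_ (by positivity)
          rw [hc]
          exact le_add_of_nonneg_left (by positivity)

/-- Decay in `H^k`, for `0 ≤ k < 3`. -/
theorem fracGradNorm_le_of_picard (hn : n ≤ 2) (hp : 2 < p)
    (hγ : 1 < (n : ℝ) / 2 * (p - 1)) (hf : PowerType p f) {k d ρ : ℝ} (hk : 0 ≤ k) (hk3 : k < 3)
    (hd : 0 < d) (hρ : 0 < ρ) :
    ∃ C : ℝ, 0 < C ∧ ∀ (u₀ u₁ : L2R n) (u : ℝ → L2R n), SmallData d u₀ u₁ →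
      (2 ≤ k → fracGradNorm (3 / 2) u₀ ≤ ENNReal.ofReal d) →
      fracGradNorm k u₀ ≤ ENNReal.ofReal d → fracGradNorm (max (k - 2) 0) u₁ ≤ ENNReal.ofReal d →
      HeatDecay ρ u → (∀ t, u t = picard f u₀ u₁ u t) → ∀ t, 0 ≤ t →
      fracGradNorm k (u t) ≤ ENNReal.ofReal (C * (1 + t) ^ (-((n : ℝ) / 4) - k / 2)) := by
  obtain ⟨A, hA, h1⟩ := weightedNorm_linearEvolution_le (n := n) (k := k) (j := max (k - 2) 0) hk
    (by linarith [le_max_left (k - 2) 0])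
  obtain ⟨B, hB, h2⟩ := weightedNorm_duhamel_of_picard (n := n) hn hp hγ hf hk hk3 hd.le hρ
  refine ⟨A * d + B, by positivity, fun u₀ u₁ u hs h0 hk0 hk1 hu hfix t ht => ?_⟩
  have ht1 : 0 < 1 + t := by linarith
  refine ((fracGradNorm_picard_le hn hp hf hρ hu hfix k ht).trans (add_le_add
    (h1 u₀ u₁ d t hd.le ht hs.fourier₀ hs.fourier₁ hk0 hk1) (h2 u₀ u₁ u hs h0 hu hfix t ht))).trans_eq
    ?_
  rw [← ENNReal.ofReal_add (by positivity) (by positivity), add_mul]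

/-- The linear part is strongly continuous. The Duhamel part is continuous in $L^2$ and bounded at
some order $K>k$, so interpolation makes it continuous at order $k$. -/
theorem continuousInH_of_picard (hn : n ≤ 2) (hp : 2 < p)
    (hγ : 1 < (n : ℝ) / 2 * (p - 1)) (hf : PowerType p f) {k d ρ : ℝ} (hk : 0 ≤ k) (hk3 : k < 3)
    (hd : 0 < d) (hρ : 0 < ρ) {u₀ u₁ : L2R n} {u : ℝ → L2R n} (hs : SmallData d u₀ u₁)
    (h0 : 2 ≤ k → fracGradNorm (3 / 2) u₀ ≤ ENNReal.ofReal d)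
    (hk0 : fracGradNorm k u₀ ≤ ENNReal.ofReal d)
    (hk1 : fracGradNorm (max (k - 2) 0) u₁ ≤ ENNReal.ofReal d) (hu : HeatDecay ρ u)
    (hfix : ∀ t, u t = picard f u₀ u₁ u t) : ContinuousInH k u := by
  refine ⟨fun t ht => ?_, fun t ht => ?_⟩
  · obtain ⟨C, -, h⟩ := fracGradNorm_le_of_picard (n := n) hn hp hγ hf hk hk3 hd hρ
    refine (sobolevNorm_le k _).trans_lt (ENNReal.add_lt_top.2 ⟨enorm_lt_top, ?_⟩)
    exact (h u₀ u₁ u hs h0 hk0 hk1 hu hfix t ht).trans_lt ENNReal.ofReal_lt_top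
  -- $K$ stays below 2 whenever $k$ does, so that no further regularity of $u_0$ is called for.
  obtain ⟨K, hkK, hK3, hK2⟩ : ∃ K, k < K ∧ K < 3 ∧ (2 ≤ K → 2 ≤ k) := by
    rcases lt_or_ge k 2 with h | h
    · exact ⟨(k + 2) / 2, by linarith, by linarith, fun _ => by linarith⟩
    · exact ⟨(k + 3) / 2, by linarith, by linarith, fun _ => h⟩
  obtain ⟨B, hB, hB1⟩ := weightedNorm_duhamel_of_picard (n := n) hn hp hγ hf (hk.trans hkK.le) hK3
    hd.le hρ
  set I : ℝ → L2C n := fun t => ∫ τ in (0 : ℝ)..t, K1 (t - τ) (superpose f (u τ)) with hI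
  have hI1 : ∀ s, 0 ≤ s → weightedNorm K (𝓕 (I s) : L2C n) ≤ ENNReal.ofReal B := fun s hs' => by
    refine (hB1 u₀ u₁ u hs (fun h => h0 (hK2 h)) hu hfix s hs').trans (ENNReal.ofReal_le_ofReal
      (mul_le_of_le_one_right hB (Real.rpow_le_one_of_one_le_of_nonpos (by linarith) ?_)))
    have : (0 : ℝ) ≤ (n : ℝ) / 4 := by positivity
    linarith
  have hIc : Tendsto (fun s => (𝓕 (I s) - 𝓕 (I t) : L2C n)) (𝓝[Set.Ici 0] t) (𝓝 0) := by
    have h1 : Tendsto I (𝓝[Set.Ici 0] t) (𝓝 (I t)) :=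
      continuousOn_duhamel (hu.continuous_superpose hn hp hf hρ) t ht
    have h2 := (((Lp.fourierTransformₗᵢ (E n) ℂ).continuous).tendsto (I t)).comp h1
    exact tendsto_sub_nhds_zero_iff.2 h2
  have e1 := tendsto_weightedNorm_of_bounded hk hkK (add_nonneg hB hB) hIc
    (eventually_mem_nhdsWithin.mono fun s hs' => (weightedNorm_sub_le K _ _).trans
      ((add_le_add (hI1 s hs') (hI1 t ht)).trans_eq (ENNReal.ofReal_add hB hB).symm))
  have e2 := tendsto_linearEvolution (k := k) (j := max (k - 2) 0) (le_max_right _ _)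
    (max_le (by linarith) hk) (by linarith [le_max_left (k - 2) 0])
    (hk0.trans_lt ENNReal.ofReal_lt_top) (hk1.trans_lt ENNReal.ofReal_lt_top) ht
  have e3 : Tendsto (fun s => ‖u s - u t‖ₑ) (𝓝[Set.Ici 0] t) (𝓝 0) := by
    have h1 : Tendsto (fun s => u s - u t) (𝓝[Set.Ici 0] t) (𝓝 0) :=
      tendsto_sub_nhds_zero_iff.2 ((hu.continuous.tendsto t).mono_left nhdsWithin_le_nhds)
    have h2 := (continuous_enorm.tendsto (0 : L2R n)).comp h1
    rwa [enorm_zero] at h2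
  have e4 := e3.add (e2.add e1)
  rw [add_zero, add_zero] at e4
  refine tendsto_of_tendsto_of_tendsto_of_le_of_le' tendsto_const_nhds e4
    (Eventually.of_forall fun _ => zero_le) (eventually_mem_nhdsWithin.mono fun s hs' => ?_)
  refine (sobolevNorm_le k _).trans (add_le_add_right ?_ _)
  have hcpx : ∀ r, 0 ≤ r → (𝓕 (cpx (u r)) : L2C n) = 𝓕 (linearEvolution u₀ u₁ r) + 𝓕 (I r) := by
    intro r hr
    rw [hfix r, cpx_picard hn hp hf hρ hu, max_eq_left hr, fourier_add']
  rw [fracGradNorm_eq, cpx_sub, fourier_sub', hcpx s hs', hcpx t ht, add_sub_add_comm]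
  exact weightedNorm_add_le _ _ _

end Regularity

/-! ### Uniqueness -/

/-- Gronwall's inequality is applied to the primitive $\int_0^t\varphi$, whose derivative is
$\varphi$. -/
theorem eq_zero_of_le_mul_integral {φ : ℝ → ℝ} {L T : ℝ} (hφ : Continuous φ) (h0 : ∀ t, 0 ≤ φ t)
    (h : ∀ t ∈ Set.Icc 0 T, φ t ≤ L * ∫ τ in (0 : ℝ)..t, φ τ) : ∀ t ∈ Set.Icc 0 T, φ t = 0 := by
  intro t ht
  have hd : ∀ s, HasDerivAt (fun s => ∫ τ in (0 : ℝ)..s, φ τ) (φ s) s := fun s =>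
    intervalIntegral.integral_hasDerivAt_right (hφ.intervalIntegrable _ _)
      hφ.stronglyMeasurable.stronglyMeasurableAtFilter hφ.continuousAt
  have hi : ∀ s ∈ Set.Icc 0 T, 0 ≤ ∫ τ in (0 : ℝ)..s, φ τ := fun s hs =>
    intervalIntegral.integral_nonneg hs.1 fun τ _ => h0 τ
  have hz := norm_le_gronwallBound_of_norm_deriv_right_le (δ := 0) (K := L) (ε := 0) (a := 0)
    (b := T) (fun s _ => (hd s).continuousAt.continuousWithinAt)
    (fun s _ => (hd s).hasDerivWithinAt) (by simp) (fun s hs => by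
      have hs' := Set.Ico_subset_Icc_self hs
      rw [Real.norm_of_nonneg (h0 s), Real.norm_of_nonneg (hi s hs'), add_zero]
      exact h s hs') t ht
  rw [gronwallBound_ε0_δ0, norm_le_zero_iff] at hz
  have := h t ht
  rw [hz, mul_zero] at this
  exact le_antisymm this (h0 t)

theorem ContinuousInH.continuousOn {k : ℝ} {u : ℝ → L2R n} (hu : ContinuousInH k u) :
    ContinuousOn u (Set.Ici 0) := by
  intro t ht
  rw [ContinuousWithinAt, tendsto_iff_edist_tendsto_0]
  refine tendsto_of_tendsto_of_tendsto_of_le_of_le tendsto_const_nhds (hu.2 t ht)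
    (fun _ => zero_le) fun s => ?_
  change edist (u s) (u t) ≤ _
  rw [edist_eq_enorm_sub]
  exact enorm_le_sobolevNorm k _

/-- Local boundedness plus compactness of $[0,T]$. At time index 0 `HeatBound` is just a ball of
$H^1$ without decay. -/
theorem ContinuousInH.exists_heatBound {k : ℝ} (hk : 1 ≤ k) {u : ℝ → L2R n}
    (hu : ContinuousInH k u) (T : ℝ) : ∃ B : ℝ, 0 < B ∧ ∀ t ∈ Set.Icc 0 T, HeatBound B 0 (u t) := by
  refine isCompact_Icc.induction_on (p := fun S => ∃ B : ℝ, 0 < B ∧ ∀ t ∈ S, HeatBound B 0 (u t))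
    ⟨1, one_pos, fun t ht => ht.elim⟩ ?_ ?_ ?_
  · rintro S S' hS ⟨B, hB, h⟩
    exact ⟨B, hB, fun t ht => h t (hS ht)⟩
  · rintro S S' ⟨B, hB, h⟩ ⟨B', hB', h'⟩
    refine ⟨max B B', lt_max_of_lt_left hB, fun t ht => ?_⟩
    rcases ht with ht | ht
    · exact (h t ht).mono (le_max_left _ _) le_rfl
    · exact (h' t ht).mono (le_max_right _ _) le_rfl
  · intro t ht
    have hev := (hu.2 t ht.1).eventually (gt_mem_nhds (show (0 : ℝ≥0∞) < 1 by norm_num))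
    refine ⟨{s | sobolevNorm k (u s - u t) < 1}, nhdsWithin_mono t Set.Icc_subset_Ici_self hev, ?_⟩
    have hfin : fracGradNorm 1 (u t) ≠ ∞ :=
      ((fracGradNorm_le_of_le zero_le_one hk (u t)).trans_lt (ENNReal.add_lt_top.2
        ⟨enorm_lt_top, (fracGradNorm_le_sobolevNorm k _).trans_lt (hu.1 t ht.1)⟩)).ne
    -- The 2 bounds the gradient of $u(s)-u(t)$: by interpolation it is at most the $L^2$ norm plus
    -- the order-$k$ norm, each at most 1.
    refine ⟨‖u t‖ + (fracGradNorm 1 (u t)).toReal + 2, by positivity, fun s hs => ?_⟩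
    have hs : sobolevNorm k (u s - u t) < 1 := hs
    have h1 : ‖u s - u t‖ₑ ≤ 1 := (enorm_le_sobolevNorm k _).trans hs.le
    have h2 : fracGradNorm 1 (u s - u t) ≤ 2 :=
      (fracGradNorm_le_of_le zero_le_one hk _).trans ((add_le_add h1
        ((fracGradNorm_le_sobolevNorm k _).trans hs.le)).trans_eq (by norm_num))
    rw [heatBound_zero_iff, ENNReal.ofReal_add (by positivity) (by positivity),
      ENNReal.ofReal_add (by positivity) (by positivity), ENNReal.ofReal_toReal hfin, ofReal_norm,
      ENNReal.ofReal_ofNat]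
    refine ⟨?_, ?_⟩
    · calc ‖u s‖ₑ = ‖u t + (u s - u t)‖ₑ := by rw [add_sub_cancel]
        _ ≤ ‖u t‖ₑ + 1 := (enorm_add_le _ _).trans (add_le_add_right h1 _)
        _ ≤ ‖u t‖ₑ + fracGradNorm 1 (u t) + 2 :=
          add_le_add le_self_add (by norm_num)
    · have h3 : fracGradNorm 1 (u s) ≤ fracGradNorm 1 (u s - u t) + fracGradNorm 1 (u t) := by
        simp only [fracGradNorm_eq, cpx_sub, fourier_sub']
        refine (le_of_eq ?_).trans (weightedNorm_add_le 1 _ _)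
        rw [sub_add_cancel]
      calc _ ≤ 2 + fracGradNorm 1 (u t) := h3.trans (add_le_add_left h2 _)
        _ ≤ ‖u t‖ₑ + fracGradNorm 1 (u t) + 2 := by
          rw [add_comm, add_assoc]; exact le_add_self

/-- On $[0,T]$ both solutions stay in one ball of $H^1$, where $f$ is Lipschitz from $L^2$ to $L^1$;
`K1` returns to $L^2$ with a bounded norm, and Gronwall applies. No smallness or decay of the
competitor is required. -/
theorem IsMildSolution.eq_of_continuousInH [NeZero n] {p : ℝ} {f : ℝ → ℝ} (hn : n ≤ 2) (hp : 2 < p)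
    (hf : PowerType p f) {k : ℝ} (hk : 1 ≤ k) {u₀ u₁ : L2R n} {u v : ℝ → L2R n}
    (hu : ContinuousInH k u) (hv : ContinuousInH k v) (hum : IsMildSolution f u₀ u₁ u)
    (hvm : IsMildSolution f u₀ u₁ v) {T : ℝ} (hT : 0 ≤ T) : v T = u T := by
  obtain ⟨B, hB, hBu⟩ := hu.exists_heatBound hk T
  obtain ⟨B', hB', hBv⟩ := hv.exists_heatBound hk T
  obtain ⟨A, hA, hsub⟩ := superpose_sub_bound (n := n) hn hp hf
  obtain ⟨D, hD, hK⟩ := norm_K1_le (n := n) (by omega)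
  set R := max B B'
  have hR : 0 < R := lt_max_of_lt_left hB
  have hmax : Continuous fun t : ℝ => max t 0 := continuous_id.max continuous_const
  have hφ : Continuous fun t => ‖v (max t 0) - u (max t 0)‖ :=
    ((hv.continuousOn.comp_continuous hmax fun t => Set.mem_Ici.2 (le_max_right t 0)).sub
      (hu.continuousOn.comp_continuous hmax fun t => Set.mem_Ici.2 (le_max_right t 0))).norm
  have key := eq_zero_of_le_mul_integral (L := D * (A * R ^ (p - 1))) (T := T) hφ
    (fun _ => norm_nonneg _) (fun t ht => ?_) T ⟨hT, le_rfl⟩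
  · rw [max_eq_left hT, norm_eq_zero, sub_eq_zero] at key
    exact key
  have e1 : cpx (v t - u t) =
      ∫ τ in (0 : ℝ)..t, K1 (t - τ) (superpose f (v τ) - superpose f (u τ)) := by
    rw [cpx_sub, hvm.eq t ht.1, hum.eq t ht.1, add_sub_add_left_eq_sub,
      ← intervalIntegral.integral_sub (hvm.integrable t ht.1) (hum.integrable t ht.1)]
    refine intervalIntegral.integral_congr fun τ hτ => ?_
    rw [Set.uIcc_of_le ht.1] at hτ
    exact (multiplier_sub (boundedSymbol_symbol1 (sub_nonneg.2 hτ.2)) _ _).symm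
  have e2 : ‖v t - u t‖ = ‖cpx (v t - u t)‖ := by
    have := congrArg ENNReal.toReal (enorm_cpx (v t - u t))
    rwa [toReal_enorm, toReal_enorm, eq_comm] at this
  rw [max_eq_left ht.1, e2, e1, ← intervalIntegral.integral_const_mul]
  refine intervalIntegral.norm_integral_le_of_norm_le ht.1 (Eventually.of_forall fun τ hτ => ?_)
    ((continuous_const.mul hφ).intervalIntegrable _ _)
  have hτT : τ ∈ Set.Icc 0 T := ⟨hτ.1.le, hτ.2.trans ht.2⟩
  have hs := hsub (v τ) (u τ) R 0 hR le_rfl ((hBv τ hτT).mono (le_max_right _ _) le_rfl)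
    ((hBu τ hτT).mono (le_max_left _ _) le_rfl)
  rw [add_zero, Real.one_rpow, mul_one] at hs
  have h0 : 0 ≤ t - τ := sub_nonneg.2 hτ.2
  refine (hK (t - τ) h0 _ _ (by positivity) hs).trans ?_
  have h1 : (1 + (t - τ)) ^ (-((n : ℝ) / 4)) ≤ 1 :=
    Real.rpow_le_one_of_one_le_of_nonpos (by linarith) (by
      have : (0 : ℝ) ≤ (n : ℝ) / 4 := by positivity
      linarith)
  rw [max_eq_left hτ.1.le, mul_assoc D, mul_assoc D]
  refine mul_le_mul_of_nonneg_left ?_ hD.le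
  exact mul_le_of_le_one_left (by positivity) h1

/-! ### The data -/

/-- The factor 2 arises since intermediate orders are bounded by the sum of the $L^2$ norm and the
top-order norm. -/
theorem smallData_of_sum_le {k δ : ℝ} (hk : 1 ≤ k) (hδ : 0 ≤ δ) {u₀ u₁ : L2R n}
    (h : eLpNorm u₀ 1 volume + sobolevNorm k u₀
      + (eLpNorm u₁ 1 volume + sobolevNorm (max (k - 2) 0) u₁) ≤ ENNReal.ofReal δ) :
    SmallData (2 * δ) u₀ u₁ ∧
      (∀ j, 0 ≤ j → j ≤ k → fracGradNorm j u₀ ≤ ENNReal.ofReal (2 * δ)) ∧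
      fracGradNorm (max (k - 2) 0) u₁ ≤ ENNReal.ofReal (2 * δ) := by
  have hδ2 : ENNReal.ofReal δ ≤ ENNReal.ofReal (2 * δ) := ENNReal.ofReal_le_ofReal (by linarith)
  have a0 : eLpNorm u₀ 1 volume ≤ ENNReal.ofReal δ :=
    (le_self_add.trans le_self_add).trans h
  have a1 : sobolevNorm k u₀ ≤ ENNReal.ofReal δ := (le_add_self.trans le_self_add).trans h
  have b0 : eLpNorm u₁ 1 volume ≤ ENNReal.ofReal δ := (le_self_add.trans le_add_self).trans h
  have b1 : sobolevNorm (max (k - 2) 0) u₁ ≤ ENNReal.ofReal δ :=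
    (le_add_self.trans le_add_self).trans h
  have hfr : ∀ j, 0 ≤ j → j ≤ k → fracGradNorm j u₀ ≤ ENNReal.ofReal (2 * δ) := fun j hj hjk => by
    refine (fracGradNorm_le_of_le hj hjk u₀).trans ((add_le_add
      ((enorm_le_sobolevNorm k _).trans a1) ((fracGradNorm_le_sobolevNorm k _).trans a1)).trans_eq ?_)
    rw [← ENNReal.ofReal_add hδ hδ, two_mul]
  refine ⟨⟨?_, ?_, ?_, hfr 1 zero_le_one hk, ?_⟩, hfr, ?_⟩
  · exact ae_norm_fourier_le (by positivity) (by rw [eLpNorm_cpx]; exact a0.trans hδ2)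
  · exact ae_norm_fourier_le (by positivity) (by rw [eLpNorm_cpx]; exact b0.trans hδ2)
  · exact ((enorm_le_sobolevNorm k _).trans a1).trans hδ2
  · exact ((enorm_le_sobolevNorm _ _).trans b1).trans hδ2
  · exact ((fracGradNorm_le_sobolevNorm _ _).trans b1).trans hδ2

end DampedWave

end

/-! ### Assembly of the theorem -/

open DampedWave
theorem theorem1p1 (n : ℕ) (hn : n = 1 ∨ n = 2) (p : ℝ) (hp : 1 + 2 / (n : ℝ) < p)
    (ε : ℝ) (hε₀ : 0 ≤ ε) (hε₂ : ε < 2) (f : ℝ → ℝ) (hf : PowerType p f) :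
    ∃ δ C : ℝ, 0 < δ ∧ 0 < C ∧ ∀ u₀ u₁ : L2R n,
      eLpNorm u₀ 1 volume + sobolevNorm (regIndex n ε) u₀
        + (eLpNorm u₁ 1 volume + sobolevNorm (max (regIndex n ε - 2) 0) u₁) ≤ ENNReal.ofReal δ →
      ∃ u : ℝ → L2R n,
        (ContinuousInH (regIndex n ε) u ∧ IsMildSolution f u₀ u₁ u) ∧
        (∀ k : ℝ, 0 ≤ k → k ≤ regIndex n ε → ∀ t : ℝ, 0 ≤ t →
          fracGradNorm k (u t) ≤ ENNReal.ofReal (C * (1 + t) ^ (-((n : ℝ) / 4) - k / 2))) ∧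
        ∀ v : ℝ → L2R n,
          ContinuousInH (regIndex n ε) v → IsMildSolution f u₀ u₁ v →
          ∀ t : ℝ, 0 ≤ t → v t = u t := by
  have hn2 : n ≤ 2 := by omega
  have : NeZero n := ⟨by omega⟩
  have hn0 : (0 : ℝ) < n := Nat.cast_pos.2 (NeZero.pos n)
  have hn2' : (n : ℝ) ≤ 2 := by exact_mod_cast hn2
  -- Since $n\le2$ gives $\frac2n\ge1$; this puts $p$, $2p$ and $2(p-1)$ in the range of the Sobolev
  -- inequality.
  have hp2 : 2 < p := by
    have : 1 ≤ 2 / (n : ℝ) := by rwa [le_div_iff₀ hn0, one_mul]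
    linarith
  have hγ : 1 < (n : ℝ) / 2 * (p - 1) := by
    have h : 2 / (n : ℝ) < p - 1 := by linarith
    rw [div_lt_iff₀ hn0] at h
    linarith
  have hk1 : 1 ≤ regIndex n ε := by rw [regIndex]; split_ifs <;> linarith
  have hk3 : regIndex n ε < 3 := by rw [regIndex]; split_ifs <;> linarith
  generalize regIndex n ε = K at hk1 hk3 ⊢
  have hk0 : 0 ≤ K := zero_le_one.trans hk1
  obtain ⟨d, ρ, hd, hρ, hex⟩ := exists_heatDecay_solution (n := n) hn2 hp2 hγ hf
  obtain ⟨B, hB, hdec⟩ := fracGradNorm_le_of_picard (n := n) hn2 hp2 hγ hf hk0 hk3 hd hρ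
  -- $\delta=d/2$ compensates the doubling in `smallData_of_sum_le`; $\rho$ and $B$ are the
  -- constants at orders 0 and $K$, added by interpolation.
  refine ⟨d / 2, ρ + B, by positivity, by positivity, fun u₀ u₁ hdata => ?_⟩
  obtain ⟨hs, h0, h1⟩ := smallData_of_sum_le hk1 (by positivity) hdata
  rw [mul_div_cancel₀ _ (two_ne_zero' ℝ)] at hs h0 h1
  obtain ⟨u, hu, hfix⟩ := hex u₀ u₁ hs
  have h32 : 2 ≤ K → fracGradNorm (3 / 2) u₀ ≤ ENNReal.ofReal d :=
    fun h => h0 _ (by norm_num) (by linarith)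
  have hcont := continuousInH_of_picard hn2 hp2 hγ hf hk0 hk3 hd hρ hs h32 (h0 K hk0 le_rfl) h1 hu
    hfix
  have hmild := hu.isMildSolution hn2 hp2 hf hρ hfix
  refine ⟨u, ⟨hcont, hmild⟩, fun k hk hkK t ht => ?_, fun v hv hvm t ht =>
    hmild.eq_of_continuousInH hn2 hp2 hf hk1 hcont hv hvm ht⟩
  have hb := (hu.bound t).1
  rw [max_eq_left ht, ← enorm_fourier_cpx] at hb
  -- Interpolating between the two end orders gives one constant for all $k$, whereas a direct
  -- estimate at each order would have a constant depending on $k$.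
  exact weightedNorm_le_of_decay hk hkK ht hρ.le hB.le hb
    (hdec u₀ u₁ u hs h32 (h0 K hk0 le_rfl) h1 hu hfix t ht)
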